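/- Write $u=(u^{(1)},u^{(2)})$ for points and curves in $\mathbb{R}^2$, and $\mathbb{J}=\begin{pmatrix}0&1\\-1&0\end{pmatrix}$. For a Lipschitz curve $\gamma:[0,1]\to\mathbb{R}^2$ put $$E(\gamma)=\int_0^1\sqrt{W(\gamma)}\,|\gamma'|\,dt,\qquad \mathcal{P}(\gamma)=-\int_0^1\gamma^{(2)}(\gamma^{(1)})'\,dt .$$ **Assumptions on $W$.** Let $W:\mathbb{R}^2\to[0,\infty)$ be of class $C^2$, vanishing at precisely two distinct points $\mathbf{p}_-,\mathbf{p}_+$, with positive definite Hessian at both. Suppose there are disjoint balls $B_\pm$ (each open or closed) centered at $\mathbf{p}_\pm$ and a number $m_0>0$ such that $\sqrt{W}\ge m_0$ on $\mathbb{R}^2\setminus(B_+\cup B_-)$, and such that the following holds for $(B,\mathbf{p})=(B_+,\mathbf{p}_+)$ and for $(B,\mathbf{p})=(B_-,\mathbf{p}_-)$: for every $\mathbf{p}_0\in B\setminus\{\mathbf{p}\}$ and every $A\in\mathbb{R}$, the functional $E$ has a minimizer among the Lipschitz curves $\gamma:[0,1]\to B$ with $\gamma(0)=\mathbf{p}_0$,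 $\gamma(1)=\mathbf{p}$ and $\mathcal{P}(\gamma)=A$, and the Euclidean arclength of this minimizer is bounded by a constant depending on $W$, $\mathbf{p}_0$ and $A$. **Classes.** Let $\mathcal{S}_A$ be the set of Lipschitz curves $\gamma:[0,1]\to\mathbb{R}^2$ with $\gamma(0)=\mathbf{p}_-$, $\gamma(1)=\mathbf{p}_+$ and $\mathcal{P}(\gamma)=A$. For functions on the line let $$H(u)=\int_{-\infty}^\infty \tfrac12|u'|^2+W(u)\,dy,\qquad \mathcal{P}(u)=-\int_{-\infty}^\infty u^{(2)}(u^{(1)})'\,dy$$ (the second integral being improper), and let $\mathcal{G}_A$ be the set of $u:\mathbb{R}\to\mathbb{R}^2$ with $u-g\in H^1(\mathbb{R};\mathbb{R}^2)$ and $\mathcal{P}(u)=A$, where $g$ is any smooth function equal to $\mathbf{p}_+$ near $+\infty$ and to $\mathbf{p}_-$ near $-\infty$. For $\nu\in\mathbb{R}$ consider the problem $$-\nu\,\mathbb{J}U'=U''-\nabla W(U)\ \text{ on }\mathbb{R},\qquad U(\pm\infty)=\mathbf{p}_\pm, \tag{1}$$ and let $\mathcal{C}$ be the set of all heteroclinic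 connections, that is, of all classical solutions of (1) with $\nu=0$. **Theorem 4.2.** Let $\gamma_0$ be a minimizer of $E$ among all Lipschitz curves $\gamma:[0,1]\to\mathbb{R}^2$ with $\gamma(0)=\mathbf{p}_-$ and $\gamma(1)=\mathbf{p}_+$. Then there is $\varepsilon_0>0$ such that for every $\varepsilon$ with $0<|\varepsilon|<\varepsilon_0$, writing $A=\mathcal{P}(\gamma_0)+\varepsilon$, the following holds. The functional $E$ has a minimizer in $\mathcal{S}_A$ that is parametrized with constant speed, and every minimizer $\gamma_*$ of $E$ in $\mathcal{S}_A$ that is parametrized with constant speed satisfies $\gamma_*(t)\notin\{\mathbf{p}_-,\mathbf{p}_+\}$ for all $t\in(0,1)$ (it has no bubbles). For each such $\gamma_*$ the function $$y(t)=\frac1{\sqrt2}\int_{1/2}^t\frac{|\gamma_*'(\tau)|}{\sqrt{W(\gamma_*(\tau))}}\,d\tau$$ is a bijection from $(0,1)$ onto $\mathbb{R}$; with $t(y)$ its inverse, the function $U_*(y):=\gamma_*(t(y))$ satisfies $|U_*'|=\sqrt2\sqrt{W(U_*)}$ almost everywhere, and: (i) $U_*\in\mathcal{G}_A$, and $U_*$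 minimizes $H$ in this class: $H(U_*)=\inf_{\mathcal{G}_A}H<\infty$. (ii) If $\mathcal{P}(u)\neq A$ for all $u\in\mathcal{C}$, then there is $\nu\neq0$ such that $U_*$ is a classical solution of (1). -/

import Mathlib

open Set Filter Topology MeasureTheory
open scoped ContDiff ENNReal

noncomputable section

namespace Isoperimetric

/-- The Euclidean plane. -/
abbrev Plane : Type := EuclideanSpace ℝ (Fin 2)

/-! ### Curves on `[0,1]`

A curve is represented by a function on `ℝ`, of which only the restriction to `[0,1]` matters. -/

/-- The degenerate length `E(γ) = ∫₀¹ √W(γ) |γ'| dt`, with conformal factor `F = √W`. -/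
def degLength (W : Plane → ℝ) (γ : ℝ → Plane) : ℝ :=
  ∫ t in (0 : ℝ)..1, √(W (γ t)) * ‖deriv γ t‖

/-- The constraint functional `𝒫(γ) = -∫₀¹ γ⁽²⁾ (γ⁽¹⁾)' dt`. -/
def area (γ : ℝ → Plane) : ℝ :=
  -∫ t in (0 : ℝ)..1, (γ t) 1 * (deriv γ t) 0

/-- The Euclidean arclength of a curve. -/
def arclength (γ : ℝ → Plane) : ℝ :=
  ∫ t in (0 : ℝ)..1, ‖deriv γ t‖

/-- Lipschitz curves `[0,1] → ℝ²` from `p` to `q`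
(on the compact interval `[0,1]`, locally Lipschitz and Lipschitz agree). -/
def curves (p q : Plane) : Set (ℝ → Plane) :=
  {γ | (∃ K, LipschitzOnWith K γ (Icc 0 1)) ∧ γ 0 = p ∧ γ 1 = q}

/-- Lipschitz curves from `p` to `q` with prescribed value `A` of the constraint. -/
def areaCurves (p q : Plane) (A : ℝ) : Set (ℝ → Plane) :=
  {γ | γ ∈ curves p q ∧ area γ = A}

/-- The curve is parametrized on `[0,1]` with constant speed. -/
def ConstantSpeed (γ : ℝ → Plane) : Prop :=
  ∀ᵐ t ∂(volume.restrict (Icc (0 : ℝ) 1)), ‖deriv γ t‖ = arclength γ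

/-! ### Assumptions on the potential -/

/-- `B` is a ball, open or closed, of positive radius about `p`. -/
def IsBallAbout (p : Plane) (B : Set Plane) : Prop :=
  ∃ R > 0, B = Metric.ball p R ∨ B = Metric.closedBall p R

/-- Solvability of the one-well problem in `B`, for the well `p`: for each starting point
`p₀ ∈ B \ {p}` and each real `A`, the degenerate length has a minimizer among the Lipschitz
curves in `B` from `p₀` to `p` with constraint value `A`; the arclength of this minimizer is
bounded by a constant `Λ p₀ A` depending (besides on `W`) on `p₀` and `A`. -/
def OneWellSolvable (W : Plane → ℝ) (p : Plane) (B : Set Plane) : Prop :=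
  ∃ Λ : Plane → ℝ → ℝ, ∀ p₀ ∈ B \ {p}, ∀ A : ℝ,
    ∃ γ ∈ {γ | γ ∈ areaCurves p₀ p A ∧ MapsTo γ (Icc 0 1) B},
      IsMinOn (degLength W) {γ | γ ∈ areaCurves p₀ p A ∧ MapsTo γ (Icc 0 1) B} γ ∧
        arclength γ ≤ Λ p₀ A

/-- The standing assumptions on the double-well potential `W` with wells `pm` and `pp`. -/
structure DoubleWell (W : Plane → ℝ) (pm pp : Plane) : Prop where
  contDiff : ContDiff ℝ 2 W
  nonneg : ∀ p, 0 ≤ W p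
  ne : pm ≠ pp
  zero_iff : ∀ p, W p = 0 ↔ p = pm ∨ p = pp
  /-- The Hessian of `W` is positive definite at both wells. -/
  hessian_pos : ∀ v : Plane, v ≠ 0 →
    0 < fderiv ℝ (fderiv ℝ W) pm v v ∧ 0 < fderiv ℝ (fderiv ℝ W) pp v v
  /-- There are disjoint balls about the wells, in each of which the one-well problem is
  solvable, and outside which `F = √W` has a positive lower bound. -/
  balls : ∃ Bm Bp : Set Plane, IsBallAbout pm Bm ∧ IsBallAbout pp Bp ∧ Disjoint Bm Bp ∧
    OneWellSolvable W pm Bm ∧ OneWellSolvable W pp Bp ∧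
    ∃ m₀ > 0, ∀ p, p ∉ Bm ∪ Bp → m₀ ≤ √(W p)

/-! ### The energy on the line -/

/-- Membership in `H¹(ℝ; ℝ²)`. Elements of `H¹` are identified with their locally absolutely
continuous representatives, whose a.e. derivative is the weak derivative. -/
def MemH1 (v : ℝ → Plane) : Prop :=
  (∀ a b : ℝ, AbsolutelyContinuousOnInterval v a b) ∧ MemLp v 2 ∧ MemLp (deriv v) 2

/-- `𝒫(u) = A` for `u` on the whole line, where `𝒫(u) = -∫_ℝ u⁽²⁾ (u⁽¹⁾)' dy`. The integral is
taken in the improper sense: on `g + H¹` the integrand need not be Lebesgue integrable when the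
second coordinates of the wells do not vanish, but the improper integral always converges. -/
def HasLineArea (u : ℝ → Plane) (A : ℝ) : Prop :=
  Tendsto (fun q : ℝ × ℝ => -∫ y in q.1..q.2, (u y) 1 * (deriv u y) 0)
    (atBot ×ˢ atTop) (𝓝 A)

/-- The admissible class `𝒢_A`: `u - g ∈ H¹(ℝ; ℝ²)` and `𝒫(u) = A`, where `g` is a smooth function
equal to `pm` near `-∞` and to `pp` near `+∞` (the class does not depend on the choice
of `g`). -/
def lineClass (pm pp : Plane) (A : ℝ) : Set (ℝ → Plane) :=
  {u | (∃ g : ℝ → Plane, ContDiff ℝ ∞ g ∧ (∀ᶠ y in atTop, g y = pp) ∧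
      (∀ᶠ y in atBot, g y = pm) ∧ MemH1 (u - g)) ∧ HasLineArea u A}

/-- `H(u) = ∫_ℝ ½|u'|² + W(u) dy`, the integral of a non-negative function. -/
def energy (W : Plane → ℝ) (u : ℝ → Plane) : ℝ≥0∞ :=
  ∫⁻ y, ENNReal.ofReal (1 / 2 * ‖deriv u y‖ ^ 2 + W (u y))

/-- The symplectic matrix `𝕁 = (0 1; -1 0)` as a map of the plane. -/
def symp (v : Plane) : Plane := !₂[v 1, -v 0]

/-- `U` is a classical solution of `-ν 𝕁 U' = U'' - ∇W(U)` on the line,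
with `U(-∞) = pm` and `U(+∞) = pp`. -/
def IsTravelingWave (W : Plane → ℝ) (pm pp : Plane) (ν : ℝ) (U : ℝ → Plane) : Prop :=
  ContDiff ℝ 2 U ∧
    (∀ y, -ν • symp (deriv U y) = deriv (deriv U) y - gradient W (U y)) ∧
    Tendsto U atBot (𝓝 pm) ∧ Tendsto U atTop (𝓝 pp)

/-- The set `𝒞` of all heteroclinic connections, the solutions with speed `ν = 0`. -/
def heteroclinics (W : Plane → ℝ) (pm pp : Plane) : Set (ℝ → Plane) :=
  {u | IsTravelingWave W pm pp 0 u}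

/-! ### The reparametrization -/

/-- `y(t) = (1/√2) ∫_{1/2}^t |γ'| / √W(γ) dτ`, for `t ∈ (0,1)`. -/
def newParam (W : Plane → ℝ) (γ : ℝ → Plane) (t : ℝ) : ℝ :=
  1 / √2 * ∫ τ in (1 / 2 : ℝ)..t, ‖deriv γ τ‖ / √(W (γ τ))

/-- `U(y) = γ(t(y))`, where `y ↦ t(y) ∈ (0,1)` is the inverse of `t ↦ y(t)`. -/
def reparam (W : Plane → ℝ) (γ : ℝ → Plane) (y : ℝ) : Plane :=
  γ (Function.invFunOn (newParam W γ) (Ioo 0 1) y)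

end Isoperimetric

end

noncomputable section

namespace Isoperimetric

/-! ### Absolutely continuous and Lipschitz curves -/

/-! Let E₀ be the unconstrained minimum of E. Near a well p the nondegenerate Hessian gives c|x - p|
≤ √W(x) ≤ C|x - p|. Hence a curve of small energy e starting at p stays near p, and its area a,
recentred at p, satisfies c|a| ≤ e (`HasCurve.well_estimate`): area produced near a well costs at
least c per unit. On the other hand, the first variation of E nearly vanishes along curves of energy
close to E₀, since otherwise a variation of fixed size would push the energy below E₀. Varying along
a divergence free field of unit flux between the wells, one can therefore change the area of such a
curve by a small b at cost at most (c/2)|b| (`DoubleWell.exists_correction`). The gap between the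
prices c and c/2 drives the argument.

No bubbles: a minimizer passing through a well at an interior time contains a loop at a well.
Deleting the loop saves its energy e₁ ≥ c|a₁|, and restoring its area elsewhere costs at most
(c/2)|a₁|, which is a strict gain (`Setup.exists_lt_of_loop`).

Existence: the same comparison, with the initial arc up to x replaced by a segment, shows that a
nearly minimizing curve has spent energy at most a constant times |x - p|² when it is at x
(`Setup.initial_cost`). So √W bounds the square root of the energy spent, and integrating |γ'| =
e'/√W bounds the Euclidean length (`integral_norm_deriv_le`). After parametrization with constant
speed, Arzelà-Ascoli and lower semicontinuity apply (`exists_hasCurve_of_tendsto`).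

On the line: the minimizer for A is stable, in the sense that a curve of nearby area a has energy at
least the minimum minus k|a - A| (`DoubleWell.exists_threshold`). By √2 √W |u'| ≤ |u'|²/2 + W,
truncation and Lipschitz approximation, stability yields √2 E(γ) ≤ H(u) on the whole line class
(`DoubleWell.le_energy`), and the reparametrization by |U'| = √2 √W(U) attains equality. It covers
the whole line because √W decays at least linearly at both ends of the curve.

Equation: the Lagrange multiplier rule, with du Bois-Reymond's lemma for regularity, makes U a
classical solution for some ν (`exists_isTravelingWave`). If ν were 0, then U would be a
heteroclinic connection of area A, which the assumption in (ii) excludes. -/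

theorem ac_coord {u : ℝ → Plane} {a b : ℝ} (hu : AbsolutelyContinuousOnInterval u a b)
    (i : Fin 2) : AbsolutelyContinuousOnInterval (fun t => u t i) a b := by
  rw [absolutelyContinuousOnInterval_iff] at hu ⊢
  intro ε hε
  obtain ⟨δ, hδ, h⟩ := hu ε hε
  refine ⟨δ, hδ, fun E hE hE' => lt_of_le_of_lt (Finset.sum_le_sum fun j _ => ?_) (h E hE hE')⟩
  rw [dist_eq_norm, dist_eq_norm, ← PiLp.sub_apply]
  exact PiLp.norm_apply_le _ i

theorem deriv_coord {u : ℝ → Plane} {t : ℝ} (hu : DifferentiableAt ℝ u t) (i : Fin 2) :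
    deriv (fun s => u s i) t = deriv u t i :=
  ((EuclideanSpace.proj (𝕜 := ℝ) i).hasFDerivAt.comp_hasDerivAt t hu.hasDerivAt).deriv

theorem ac_ae_differentiableAt {u : ℝ → Plane} {a b : ℝ}
    (hu : AbsolutelyContinuousOnInterval u a b) :
    ∀ᵐ x : ℝ, x ∈ uIcc a b → DifferentiableAt ℝ u x :=
  hu.boundedVariationOn.ae_differentiableAt_of_mem_uIcc

theorem ac_ae_deriv_coord {u : ℝ → Plane} {a b : ℝ}
    (hu : AbsolutelyContinuousOnInterval u a b) (i : Fin 2) :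
    ∀ᵐ x : ℝ, x ∈ uIoc a b → deriv (fun s => u s i) x = deriv u x i := by
  filter_upwards [ac_ae_differentiableAt hu] with x hx hx'
  exact deriv_coord (hx (uIoc_subset_uIcc hx')) i

theorem intervalIntegrable_plane_iff {f : ℝ → Plane} {a b : ℝ} :
    IntervalIntegrable f volume a b ↔
      ∀ i, IntervalIntegrable (fun t => f t i) volume a b := by
  constructor
  · intro h i
    exact ⟨(EuclideanSpace.proj (𝕜 := ℝ) i).integrable_comp h.1,
      (EuclideanSpace.proj (𝕜 := ℝ) i).integrable_comp h.2⟩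
  · intro h
    have : f = fun t => f t 0 • EuclideanSpace.single (0 : Fin 2) (1 : ℝ) +
        f t 1 • EuclideanSpace.single (1 : Fin 2) (1 : ℝ) := by
      ext t i; fin_cases i <;> simp
    rw [this]
    have hs : ∀ i, IntervalIntegrable
        (fun t => f t i • EuclideanSpace.single i (1 : ℝ)) volume a b := fun i =>
      ⟨(h i).1.smul_const _, (h i).2.smul_const _⟩
    exact (hs 0).add (hs 1)

theorem integral_coord {f : ℝ → Plane} {a b : ℝ} (hf : IntervalIntegrable f volume a b)
    (i : Fin 2) : (∫ t in a..b, f t) i = ∫ t in a..b, f t i :=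
  ((EuclideanSpace.proj (𝕜 := ℝ) i).intervalIntegral_comp_comm hf).symm

theorem ac_intervalIntegrable_deriv {u : ℝ → Plane} {a b : ℝ}
    (hu : AbsolutelyContinuousOnInterval u a b) : IntervalIntegrable (deriv u) volume a b := by
  rw [intervalIntegrable_plane_iff]
  intro i
  refine (ac_coord hu i).intervalIntegrable_deriv.congr_ae ?_
  rw [EventuallyEq, ae_restrict_iff' measurableSet_uIoc]
  exact ac_ae_deriv_coord hu i

theorem ac_integral_deriv {u : ℝ → Plane} {a b : ℝ}
    (hu : AbsolutelyContinuousOnInterval u a b) : ∫ t in a..b, deriv u t = u b - u a := by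
  ext i
  rw [integral_coord (ac_intervalIntegrable_deriv hu), PiLp.sub_apply,
    ← (ac_coord hu i).integral_deriv_eq_sub]
  refine intervalIntegral.integral_congr_ae ?_
  filter_upwards [ac_ae_deriv_coord hu i] with x hx hx' using (hx hx').symm

theorem _root_.LipschitzWith.ac {X : Type*} [PseudoMetricSpace X] {u : ℝ → X} {K : NNReal}
    (hu : LipschitzWith K u) (a b : ℝ) : AbsolutelyContinuousOnInterval u a b :=
  (hu.lipschitzOnWith (s := uIcc a b)).absolutelyContinuousOnInterval

theorem lip_norm_deriv_le {E : Type*} [NormedAddCommGroup E] [NormedSpace ℝ E]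
    {u : ℝ → E} {K : NNReal} (hu : LipschitzWith K u) (t : ℝ) :
    ‖deriv u t‖ ≤ K := norm_deriv_le_of_lipschitz hu

theorem intervalIntegrable_of_bound {E : Type*} [NormedAddCommGroup E] {f : ℝ → E} {a b C : ℝ}
    (hf : AEStronglyMeasurable f volume) (hC : ∀ t ∈ uIcc a b, ‖f t‖ ≤ C) :
    IntervalIntegrable f volume a b := by
  refine (intervalIntegrable_const (c := C)).mono_fun hf.restrict ?_
  rw [EventuallyLE, ae_restrict_iff' measurableSet_uIoc]
  exact Eventually.of_forall fun t ht =>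
    (hC t (uIoc_subset_uIcc ht)).trans (Real.le_norm_self C)

/-- The product of a continuous function and a bounded measurable one is locally integrable. -/
theorem intervalIntegrable_mul_of_bound {f g : ℝ → ℝ} {a b C : ℝ} (hf : ContinuousOn f (uIcc a b))
    (hg : AEStronglyMeasurable g volume) (hC : ∀ t, ‖g t‖ ≤ C) :
    IntervalIntegrable (fun t => f t * g t) volume a b :=
  (intervalIntegrable_of_bound hg fun t _ => hC t).continuousOn_mul hf

theorem measurable_deriv_plane (u : ℝ → Plane) : Measurable (deriv u) := measurable_deriv u

theorem abs_coord_le (v : Plane) (i : Fin 2) : |v i| ≤ ‖v‖ := PiLp.norm_apply_le v i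

theorem aesm_deriv_coord (u : ℝ → Plane) (i : Fin 2) :
    AEStronglyMeasurable (fun t => deriv u t i) volume :=
  ((EuclideanSpace.proj (𝕜 := ℝ) i).continuous.measurable.comp
    (measurable_deriv_plane u)).aestronglyMeasurable

theorem aesm_norm_deriv (u : ℝ → Plane) :
    AEStronglyMeasurable (fun t => ‖deriv u t‖) volume :=
  (measurable_deriv_plane u).norm.aestronglyMeasurable

section Lipschitz

variable {u : ℝ → Plane} {K : NNReal}

theorem lip_coord_deriv_le (hu : LipschitzWith K u) (i : Fin 2) (t : ℝ) :
    ‖deriv u t i‖ ≤ K := (abs_coord_le _ i).trans (lip_norm_deriv_le hu t)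

theorem lip_mul_norm_deriv (hu : LipschitzWith K u) {f : ℝ → ℝ} {a b : ℝ}
    (hf : ContinuousOn f (uIcc a b)) :
    IntervalIntegrable (fun t => f t * ‖deriv u t‖) volume a b :=
  intervalIntegrable_mul_of_bound hf (aesm_norm_deriv u)
    (fun t => by simpa using lip_norm_deriv_le hu t)

theorem lip_mul_coord_deriv (hu : LipschitzWith K u) {f : ℝ → ℝ} {a b : ℝ}
    (hf : ContinuousOn f (uIcc a b)) (i : Fin 2) :
    IntervalIntegrable (fun t => f t * deriv u t i) volume a b :=
  intervalIntegrable_mul_of_bound hf (aesm_deriv_coord u i) (lip_coord_deriv_le hu i)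

theorem lip_norm_deriv (hu : LipschitzWith K u) (a b : ℝ) :
    IntervalIntegrable (fun t => ‖deriv u t‖) volume a b := by
  simpa using lip_mul_norm_deriv hu (f := fun _ => 1) (a := a) (b := b) continuousOn_const

theorem continuous_coord (hu : Continuous u) (i : Fin 2) : Continuous fun t => u t i :=
  (EuclideanSpace.proj (𝕜 := ℝ) i).continuous.comp hu

theorem lip_dist_le_integral (hu : LipschitzWith K u) {a b : ℝ} (hab : a ≤ b) :
    ‖u b - u a‖ ≤ ∫ t in a..b, ‖deriv u t‖ := by
  rw [← ac_integral_deriv (hu.ac a b)]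
  exact intervalIntegral.norm_integral_le_integral_norm hab

theorem lip_intervalIntegrable_length (hu : LipschitzWith K u) {W : Plane → ℝ} (hW : Continuous W)
    (a b : ℝ) : IntervalIntegrable (fun t => √(W (u t)) * ‖deriv u t‖) volume a b :=
  lip_mul_norm_deriv hu (hW.comp hu.continuous).sqrt.continuousOn

theorem lip_intervalIntegrable_area (hu : LipschitzWith K u)
    (a b : ℝ) : IntervalIntegrable (fun t => u t 1 * deriv u t 0) volume a b :=
  lip_mul_coord_deriv hu (continuous_coord hu.continuous 1).continuousOn 0

end Lipschitz

/-! ### Curves with prescribed energy, area and length -/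

/-- There is a Lipschitz curve from `p` to `q` with degenerate length `e`, constraint value `a`
and Euclidean length `l`. -/
def HasCurve (W : Plane → ℝ) (p q : Plane) (e a l : ℝ) : Prop :=
  ∃ γ : ℝ → Plane, (∃ K, LipschitzWith K γ) ∧ γ 0 = p ∧ γ 1 = q ∧
    degLength W γ = e ∧ area γ = a ∧ arclength γ = l

theorem HasCurve.nonneg {W : Plane → ℝ} {p q : Plane} {e a l : ℝ} (h : HasCurve W p q e a l) :
    0 ≤ e := by
  obtain ⟨γ, -, -, -, rfl, -, -⟩ := h
  exact intervalIntegral.integral_nonneg zero_le_one fun t _ => by positivity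

/-- Pieces of Lipschitz curves. -/
theorem hasCurve_sub {W : Plane → ℝ} {γ : ℝ → Plane} {K : NNReal} (hγ : LipschitzWith K γ)
    (s t : ℝ) (hst : s ≤ t) :
    HasCurve W (γ s) (γ t) (∫ τ in s..t, √(W (γ τ)) * ‖deriv γ τ‖)
      (-∫ τ in s..t, γ τ 1 * deriv γ τ 0) (∫ τ in s..t, ‖deriv γ τ‖) := by
  have hd : ∀ x, deriv (fun x => γ ((t - s) * x + s)) x
      = (t - s) • deriv γ ((t - s) * x + s) := fun x => by
    rw [deriv_comp_mul_left (t - s) (fun y => γ (y + s)) x, deriv_comp_add_const]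
  refine ⟨fun x => γ ((t - s) * x + s), ⟨K * ‖t - s‖₊, ?_⟩, by simp, by simp, ?_, ?_, ?_⟩
  · refine hγ.comp (LipschitzWith.of_dist_le_mul fun x y => ?_)
    simp [Real.dist_eq, ← mul_sub, abs_mul]
  · have := intervalIntegral.smul_integral_comp_mul_add (a := 0) (b := 1)
      (fun τ => √(W (γ τ)) * ‖deriv γ τ‖) (t - s) s
    simp only [mul_zero, zero_add, mul_one, sub_add_cancel] at this
    rw [degLength, ← this, smul_eq_mul, ← intervalIntegral.integral_const_mul]
    refine intervalIntegral.integral_congr fun x _ => ?_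
    simp only [hd, norm_smul, Real.norm_of_nonneg (sub_nonneg.2 hst)]
    ring
  · have := intervalIntegral.smul_integral_comp_mul_add (a := 0) (b := 1)
      (fun τ => γ τ 1 * deriv γ τ 0) (t - s) s
    simp only [mul_zero, zero_add, mul_one, sub_add_cancel] at this
    rw [area, ← this, smul_eq_mul, ← intervalIntegral.integral_const_mul]
    congr 1
    refine intervalIntegral.integral_congr fun x _ => ?_
    simp only [hd, PiLp.smul_apply, smul_eq_mul]
    ring
  · have := intervalIntegral.smul_integral_comp_mul_add (a := 0) (b := 1)
      (fun τ => ‖deriv γ τ‖) (t - s) s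
    simp only [mul_zero, zero_add, mul_one, sub_add_cancel] at this
    rw [arclength, ← this, smul_eq_mul, ← intervalIntegral.integral_const_mul]
    refine intervalIntegral.integral_congr fun x _ => ?_
    simp only [hd, norm_smul, Real.norm_of_nonneg (sub_nonneg.2 hst)]

theorem deriv_eq_of_eqOn_Ioo {γ η : ℝ → Plane} {a b t : ℝ} (h : EqOn γ η (Ioo a b))
    (ht : t ∈ Ioo a b) : deriv γ t = deriv η t :=
  (h.eventuallyEq_of_mem (Ioo_mem_nhds ht.1 ht.2)).deriv_eq

/-- At an endpoint `deriv` sees values outside the interval, so agreement is exploited only in the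
open interval, and the endpoints are discarded as a null set. -/
theorem integral_congr_of_eqOn_Ioo {E : Type*} [NormedAddCommGroup E] [NormedSpace ℝ E]
    (f : Plane → Plane → E) {γ η : ℝ → Plane}
    {a b : ℝ} (hab : a ≤ b) (h : EqOn γ η (Ioo a b)) :
    ∫ t in a..b, f (γ t) (deriv γ t) = ∫ t in a..b, f (η t) (deriv η t) := by
  rw [intervalIntegral.integral_of_le hab, intervalIntegral.integral_of_le hab,
    integral_Ioc_eq_integral_Ioo, integral_Ioc_eq_integral_Ioo]
  refine setIntegral_congr_fun measurableSet_Ioo fun t ht => ?_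
  simp only [h ht, deriv_eq_of_eqOn_Ioo h ht]

theorem degLength_congr (W : Plane → ℝ) {γ η : ℝ → Plane} (h : EqOn γ η (Icc 0 1)) :
    degLength W γ = degLength W η :=
  integral_congr_of_eqOn_Ioo (fun x v => √(W x) * ‖v‖) zero_le_one (h.mono Ioo_subset_Icc_self)

theorem area_congr {γ η : ℝ → Plane} (h : EqOn γ η (Icc 0 1)) : area γ = area η :=
  congrArg Neg.neg
    (integral_congr_of_eqOn_Ioo (fun x v => x 1 * v 0) zero_le_one (h.mono Ioo_subset_Icc_self))

theorem arclength_congr {γ η : ℝ → Plane} (h : EqOn γ η (Icc 0 1)) :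
    arclength γ = arclength η :=
  integral_congr_of_eqOn_Ioo (fun _ v => ‖v‖) zero_le_one (h.mono Ioo_subset_Icc_self)

/-- A Lipschitz curve on `[0,1]` extends to a Lipschitz curve on the line. -/
theorem exists_lipschitz_extension {γ : ℝ → Plane} {K : NNReal}
    (h : LipschitzOnWith K γ (Icc 0 1)) :
    ∃ η : ℝ → Plane, LipschitzWith K η ∧ EqOn γ η (Icc 0 1) := by
  refine ⟨fun t => γ (projIcc (0 : ℝ) 1 zero_le_one t), ?_, fun t ht => ?_⟩
  · have := (lipschitzOnWith_iff_restrict.1 h).comp (LipschitzWith.projIcc zero_le_one)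
    rw [mul_one] at this
    exact this
  · simp only [projIcc_of_mem zero_le_one ht]

theorem exists_curve_of_hasCurve {W : Plane → ℝ} {p q : Plane} {e a l : ℝ}
    (h : HasCurve W p q e a l) : ∃ γ ∈ areaCurves p q a, degLength W γ = e := by
  obtain ⟨γ, ⟨K, hK⟩, h0, h1, he, ha, -⟩ := h
  exact ⟨γ, ⟨⟨⟨K, hK.lipschitzOnWith⟩, h0, h1⟩, ha⟩, he⟩

theorem hasCurve_of_mem {p q : Plane} {γ : ℝ → Plane} (W : Plane → ℝ) (h : γ ∈ curves p q) :
    HasCurve W p q (degLength W γ) (area γ) (arclength γ) := by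
  obtain ⟨⟨K, hK⟩, h0, h1⟩ := h
  obtain ⟨η, hη, heq⟩ := exists_lipschitz_extension hK
  exact ⟨η, ⟨K, hη⟩, by rw [← heq (by simp), h0], by rw [← heq (by simp), h1],
    (degLength_congr W heq).symm, (area_congr heq).symm, (arclength_congr heq).symm⟩

theorem deriv_segment (p q : Plane) (t : ℝ) : deriv (fun t : ℝ => p + t • (q - p)) t = q - p := by
  have := ((hasDerivAt_id t).smul_const (q - p)).const_add p
  simpa using this.deriv

/-- Segments. -/
theorem hasCurve_segment (W : Plane → ℝ) (p q : Plane) :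
    HasCurve W p q (∫ t in (0 : ℝ)..1, √(W (p + t • (q - p))) * ‖q - p‖)
      (-(p 1 * (q 0 - p 0) + (q 1 - p 1) * (q 0 - p 0) / 2)) ‖q - p‖ := by
  refine ⟨fun t => p + t • (q - p), ⟨‖q - p‖₊, ?_⟩, by simp, by simp, ?_, ?_, ?_⟩
  · refine LipschitzWith.of_dist_le_mul fun x y => ?_
    simp [dist_eq_norm, ← sub_smul, norm_smul, mul_comm]
  · simp only [degLength, deriv_segment]
  · simp only [area, deriv_segment]
    have : ∀ t : ℝ, (p + t • (q - p)) 1 * (q - p) 0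
        = p 1 * (q 0 - p 0) + (q 1 - p 1) * (q 0 - p 0) * t := fun t => by
      simp; ring
    simp only [this]
    rw [intervalIntegral.integral_add intervalIntegrable_const
      (Continuous.intervalIntegrable (by fun_prop) _ _),
      intervalIntegral.integral_const, intervalIntegral.integral_const_mul, integral_id]
    simp
    ring
  · simp only [arclength, deriv_segment]
    simp

/-- Concatenation. -/
theorem HasCurve.trans {W : Plane → ℝ} {p q r : Plane} {e a l e' a' l' : ℝ} (hW : Continuous W)
    (h : HasCurve W p q e a l) (h' : HasCurve W q r e' a' l') :
    HasCurve W p r (e + e') (a + a') (l + l') := by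
  obtain ⟨γ, ⟨K, hK⟩, h0, h1, rfl, rfl, rfl⟩ := h
  obtain ⟨η, ⟨L, hL⟩, h0', h1', rfl, rfl, rfl⟩ := h'
  -- The two curves are run one after the other on [0, 2]. Clamping the times makes the formula
  -- globally Lipschitz without case distinctions; `hasCurve_sub` then rescales to [0, 1].
  set ζ : ℝ → Plane := fun t => γ (min t 1) + (η (max (t - 1) 0) - q) with hζ
  have hζl : LipschitzWith (K * 1 + (L * 1 + 0)) ζ := by
    refine (hK.comp (LipschitzWith.id.min_const 1)).add
      ((hL.comp (LipschitzWith.max_const ?_ 0)).sub (LipschitzWith.const q))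
    exact LipschitzWith.of_dist_le_mul fun x y => by simp
  have e1 : EqOn ζ γ (Ioo 0 1) := fun t ht => by
    have h2 : max (t - 1) 0 = 0 := max_eq_right (by linarith [ht.2])
    have h3 : min t 1 = t := min_eq_left ht.2.le
    simp [hζ, h2, h3, h0']
  have e2 : EqOn ζ (fun t => η (t - 1)) (Ioo 1 2) := fun t ht => by
    have h2 : max (t - 1) 0 = t - 1 := max_eq_left (by linarith [ht.1])
    have h3 : min t 1 = 1 := min_eq_right ht.1.le
    simp [hζ, h2, h3, h1]
  have key : ∀ f : Plane → Plane → ℝ,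
      (∀ a b, IntervalIntegrable (fun t => f (ζ t) (deriv ζ t)) volume a b) →
      ∫ t in (0 : ℝ)..2, f (ζ t) (deriv ζ t) = (∫ t in (0 : ℝ)..1, f (γ t) (deriv γ t))
        + ∫ t in (0 : ℝ)..1, f (η t) (deriv η t) := by
    intro f hf
    rw [← intervalIntegral.integral_add_adjacent_intervals (hf 0 1) (hf 1 2),
      integral_congr_of_eqOn_Ioo f zero_le_one e1,
      integral_congr_of_eqOn_Ioo f one_le_two e2]
    congr 1
    simp only [deriv_comp_sub_const]
    rw [intervalIntegral.integral_comp_sub_right (fun t => f (η t) (deriv η t)) 1]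
    norm_num
  have := hasCurve_sub (W := W) hζl 0 2 zero_le_two
  rw [key (fun x v => √(W x) * ‖v‖) (lip_intervalIntegrable_length hζl hW),
    key (fun x v => x 1 * v 0) (lip_intervalIntegrable_area hζl),
    key (fun _ v => ‖v‖) (lip_norm_deriv hζl)] at this
  have hz0 : ζ 0 = p := by
    simp [hζ, h0, h0']
  have hz2 : ζ 2 = r := by
    have h3 : min (2 : ℝ) 1 = 1 := min_eq_right (by norm_num)
    have h2 : max ((2 : ℝ) - 1) 0 = 1 := by norm_num
    simp only [hζ, h1, h2, h3, h1', add_sub_cancel]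
  rw [hz0, hz2, neg_add] at this
  exact this

/-- Reversal. -/
theorem HasCurve.symm {W : Plane → ℝ} {p q : Plane} {e a l : ℝ} (h : HasCurve W p q e a l) :
    HasCurve W q p e (-a) l := by
  obtain ⟨γ, ⟨K, hK⟩, h0, h1, rfl, rfl, rfl⟩ := h
  have hd : ∀ x, deriv (fun x => γ (1 - x)) x = - deriv γ (1 - x) := fun x =>
    deriv_comp_const_sub γ 1 x
  refine ⟨fun x => γ (1 - x), ⟨K * 1, hK.comp ?_⟩, by simpa, by simpa, ?_, ?_, ?_⟩
  · exact LipschitzWith.of_dist_le_mul fun x y => by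
      rw [dist_sub_left, NNReal.coe_one, one_mul]
  · simp only [degLength, hd, norm_neg]
    rw [intervalIntegral.integral_comp_sub_left (fun t => √(W (γ t)) * ‖deriv γ t‖) 1]
    norm_num
  · simp only [area, hd]
    rw [intervalIntegral.integral_comp_sub_left (fun t => γ t 1 * (-deriv γ t) 0) 1]
    simp
  · simp only [arclength, hd, norm_neg]
    rw [intervalIntegral.integral_comp_sub_left (fun t => ‖deriv γ t‖) 1]
    norm_num

/-! ### The potential -/

section Taylor

variable {W : Plane → ℝ}

/-- The second derivative is bounded on the ball. Two applications of the mean value inequality, to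
the derivative and then to W, give the remainder; the factor 1/2 is not needed. -/
theorem taylor_bound (hW : ContDiff ℝ 2 W) (R : ℝ) :
    ∃ C ≥ 0, ∀ x ∈ Metric.closedBall (0 : Plane) R, ∀ y ∈ Metric.closedBall (0 : Plane) R,
      |W y - W x - fderiv ℝ W x (y - x)| ≤ C * ‖y - x‖ ^ 2 := by
  have h1 : ContDiff ℝ 1 (fderiv ℝ W) := hW.fderiv_right (by norm_num)
  have h2 : Continuous (fderiv ℝ (fderiv ℝ W)) := h1.continuous_fderiv (by norm_num)
  have h3 : Continuous fun w => ‖fderiv ℝ (fderiv ℝ W) w‖ := Continuous.norm (E := Plane →L[ℝ] Plane →L[ℝ] ℝ) h2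
  obtain ⟨C, hC⟩ := (isCompact_closedBall (0 : Plane) R).bddAbove_image h3.continuousOn
  replace hC : ∀ w ∈ Metric.closedBall (0 : Plane) R, ‖fderiv ℝ (fderiv ℝ W) w‖ ≤ C :=
    fun w hw => hC (mem_image_of_mem _ hw)
  refine ⟨|C|, abs_nonneg C, fun x hx y hy => ?_⟩
  have hseg : segment ℝ x y ⊆ Metric.closedBall (0 : Plane) R :=
    (convex_closedBall (0 : Plane) R).segment_subset hx hy
  have hlip : ∀ z ∈ segment ℝ x y, ‖fderiv ℝ W z - fderiv ℝ W x‖ ≤ |C| * ‖y - x‖ := by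
    intro z hz
    have := (convex_segment x y).norm_image_sub_le_of_norm_fderiv_le
      (f := fderiv ℝ W) (C := |C|) (fun w _ => (h1.differentiable (by norm_num)) w)
      (fun w hw => (hC w (hseg hw)).trans (le_abs_self C)) (left_mem_segment ℝ x y) hz
    exact this.trans (mul_le_mul_of_nonneg_left (norm_sub_le_of_mem_segment hz) (abs_nonneg C))
  have := (convex_segment x y).norm_image_sub_le_of_norm_hasFDerivWithin_le'
    (fun z _ => ((hW.differentiable (by norm_num)) z).hasFDerivAt.hasFDerivWithinAt) hlip
    (left_mem_segment ℝ x y) (right_mem_segment ℝ x y)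
  rw [Real.norm_eq_abs] at this
  linarith [this, sq (‖y - x‖)]

theorem fderiv_eq_zero_of_zero {p : Plane} (hnn : ∀ x, 0 ≤ W x) (hp : W p = 0) :
    fderiv ℝ W p = 0 :=
  IsLocalMin.fderiv_eq_zero (Eventually.of_forall fun x => by rw [hp]; exact hnn x)

/-- A zero of a non-negative function is a critical point, so W is at most quadratic there. The
radius is arbitrary, so the bound is available along a whole compact curve as well as close to the
well. -/
theorem sqrt_le_near_zero (hW : ContDiff ℝ 2 W) (hnn : ∀ x, 0 ≤ W x) {p : Plane}
    (hp : W p = 0) (R : ℝ) :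
    ∃ C > 0, ∀ x, ‖x - p‖ ≤ R → √(W x) ≤ C * ‖x - p‖ := by
  obtain ⟨C, hC, h⟩ := taylor_bound hW (‖p‖ + |R|)
  refine ⟨√(C + 1), by positivity, fun x hx => ?_⟩
  rw [← Real.sqrt_sq (norm_nonneg (x - p)), ← Real.sqrt_mul (by positivity)]
  refine Real.sqrt_le_sqrt ?_
  have := h p (by simp) x (by
    rw [mem_closedBall_zero_iff]
    calc ‖x‖ = ‖p + (x - p)‖ := by simp
      _ ≤ _ := (norm_add_le _ _).trans (by gcongr; exact hx.trans (le_abs_self R)))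
  rw [hp, fderiv_eq_zero_of_zero hnn hp] at this
  simp only [sub_zero, zero_apply] at this
  nlinarith [le_abs_self (W x), sq_nonneg ‖x - p‖]

/-- The minimum over the unit sphere is positive by compactness, and homogeneity does the rest. -/
theorem hessian_lower_bound {B : Plane →L[ℝ] Plane →L[ℝ] ℝ} (hB : ∀ v, v ≠ 0 → 0 < B v v) :
    ∃ l > 0, ∀ v, l * ‖v‖ ^ 2 ≤ B v v := by
  have hc : Continuous fun v => B v v := B.continuous.clm_apply continuous_id
  obtain ⟨v0, hv0, hmin⟩ := (isCompact_sphere (0 : Plane) 1).exists_isMinOn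
    (NormedSpace.sphere_nonempty.2 zero_le_one) hc.continuousOn
  refine ⟨B v0 v0, hB v0 (ne_zero_of_mem_unit_sphere ⟨v0, hv0⟩), fun v => ?_⟩
  rcases eq_or_ne v 0 with rfl | hv
  · simp
  have hn : ‖v‖ ≠ 0 := norm_ne_zero_iff.2 hv
  have h1 : B v0 v0 ≤ B (‖v‖⁻¹ • v) (‖v‖⁻¹ • v) := hmin (by simp [norm_smul, hn])
  simp only [map_smul, smul_apply, smul_eq_mul] at h1
  have h2 : B v v = ‖v‖⁻¹ * (‖v‖⁻¹ * B v v) * ‖v‖ ^ 2 := by field_simp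
  rw [h2]
  gcongr

theorem le_sqrt_near_zero (hW : ContDiff ℝ 2 W) (hnn : ∀ x, 0 ≤ W x) {p : Plane}
    (hp : W p = 0) (hpos : ∀ v : Plane, v ≠ 0 → 0 < fderiv ℝ (fderiv ℝ W) p v v) :
    ∃ c > 0, ∃ r > 0, ∀ x, ‖x - p‖ ≤ r → c * ‖x - p‖ ≤ √(W x) := by
  obtain ⟨l, hl, hB⟩ := hessian_lower_bound hpos
  have h1 : ContDiff ℝ 1 (fderiv ℝ W) := hW.fderiv_right (by norm_num)
  have hd := ((h1.differentiable (by norm_num)) p).hasFDerivAt.isLittleO.bound (half_pos hl)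
  rw [Metric.eventually_nhds_iff_ball] at hd
  obtain ⟨r, hr, hd⟩ := hd
  refine ⟨√(l / 4), by positivity, r / 2, by positivity, fun x hx => ?_⟩
  rw [← Real.sqrt_sq (norm_nonneg (x - p)), ← Real.sqrt_mul (by positivity)]
  refine Real.sqrt_le_sqrt ?_
  set v := x - p with hv
  have hder : ∀ s : ℝ, HasDerivAt (fun s : ℝ => W (p + s • v) - l / 4 * ‖v‖ ^ 2 * s ^ 2)
      (fderiv ℝ W (p + s • v) v - l / 4 * ‖v‖ ^ 2 * (2 * s)) s := by
    intro s
    have e1 : HasDerivAt (fun s : ℝ => p + s • v) v s := by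
      simpa using ((hasDerivAt_id s).smul_const v).const_add p
    have e2 := ((hW.differentiable (by norm_num)) (p + s • v)).hasFDerivAt.comp_hasDerivAt s e1
    have e3 := (hasDerivAt_pow 2 s).const_mul (l / 4 * ‖v‖ ^ 2)
    refine (e2.sub e3).congr_deriv ?_
    simp
  -- The comparison is made along the ray from the well. The derivative is at least s(l - l/2 -
  -- l/2)|v|² = 0: l from the Hessian, one l/2 from its linearization error, the other from the
  -- subtracted parabola.
  have hmono : MonotoneOn (fun s : ℝ => W (p + s • v) - l / 4 * ‖v‖ ^ 2 * s ^ 2) (Icc 0 1) := by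
    refine monotoneOn_of_deriv_nonneg (convex_Icc 0 1)
      (fun s _ => (hder s).continuousAt.continuousWithinAt)
      (fun s _ => (hder s).differentiableAt.differentiableWithinAt) fun s hs => ?_
    rw [interior_Icc] at hs
    rw [(hder s).deriv]
    have hmem : p + s • v ∈ Metric.ball p r := by
      rw [mem_ball_iff_norm, add_sub_cancel_left, norm_smul, Real.norm_of_nonneg hs.1.le]
      nlinarith [hs.1, hs.2, norm_nonneg v]
    have := hd _ hmem
    rw [fderiv_eq_zero_of_zero hnn hp] at this
    simp only [sub_zero, add_sub_cancel_left, map_smul] at this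
    have h3 : |(fderiv ℝ W (p + s • v) - s • fderiv ℝ (fderiv ℝ W) p v) v|
        ≤ l / 2 * ‖s • v‖ * ‖v‖ :=
      (ContinuousLinearMap.le_opNorm _ v).trans (mul_le_mul_of_nonneg_right this (norm_nonneg v))
    rw [norm_smul, Real.norm_of_nonneg hs.1.le] at h3
    simp only [sub_apply, smul_apply, smul_eq_mul] at h3
    have h4 := mul_le_mul_of_nonneg_left (hB v) hs.1.le
    have h5 := neg_le_of_abs_le h3
    nlinarith
  have := hmono (left_mem_Icc.2 zero_le_one) (right_mem_Icc.2 zero_le_one) zero_le_one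
  simp only [zero_smul, add_zero, hp, one_smul, hv, add_sub_cancel] at this
  norm_num at this
  linarith

end Taylor

section DoubleWell

variable {W : Plane → ℝ} {pm pp : Plane}

theorem DoubleWell.continuous (h : DoubleWell W pm pp) : Continuous W := h.contDiff.continuous

theorem DoubleWell.symm (h : DoubleWell W pm pp) : DoubleWell W pp pm where
  contDiff := h.contDiff
  nonneg := h.nonneg
  ne := h.ne.symm
  zero_iff p := by rw [h.zero_iff, or_comm]
  hessian_pos v hv := (h.hessian_pos v hv).symm
  balls := by
    obtain ⟨Bm, Bp, h1, h2, h3, h4, h5, m, hm, h6⟩ := h.balls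
    exact ⟨Bp, Bm, h2, h1, h3.symm, h5, h4, m, hm, fun p hp => h6 p (by rwa [union_comm])⟩

theorem DoubleWell.zero_left (h : DoubleWell W pm pp) : W pm = 0 := (h.zero_iff pm).2 (Or.inl rfl)

theorem DoubleWell.zero_right (h : DoubleWell W pm pp) : W pp = 0 := h.symm.zero_left

theorem DoubleWell.pos (h : DoubleWell W pm pp) {x : Plane} (h1 : x ≠ pm) (h2 : x ≠ pp) :
    0 < W x :=
  (h.nonneg x).lt_of_ne fun h0 => ((h.zero_iff x).1 h0.symm).elim h1 h2

/-- Behaviour of `√W` near the wells. -/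
theorem DoubleWell.exists_bounds (h : DoubleWell W pm pp) :
    ∃ c > 0, ∃ C > 0, ∃ r > 0, ∀ p, (p = pm ∨ p = pp) → ∀ x, ‖x - p‖ ≤ r →
      c * ‖x - p‖ ≤ √(W x) ∧ √(W x) ≤ C * ‖x - p‖ := by
  obtain ⟨c1, hc1, r1, hr1, h1⟩ := le_sqrt_near_zero h.contDiff h.nonneg h.zero_left
    fun v hv => (h.hessian_pos v hv).1
  obtain ⟨c2, hc2, r2, hr2, h2⟩ := le_sqrt_near_zero h.contDiff h.nonneg h.zero_right
    fun v hv => (h.hessian_pos v hv).2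
  obtain ⟨C1, hC1, h3⟩ := sqrt_le_near_zero h.contDiff h.nonneg h.zero_left (min r1 r2)
  obtain ⟨C2, hC2, h4⟩ := sqrt_le_near_zero h.contDiff h.nonneg h.zero_right (min r1 r2)
  refine ⟨min c1 c2, lt_min hc1 hc2, max C1 C2, lt_max_of_lt_left hC1, min r1 r2,
    lt_min hr1 hr2, ?_⟩
  rintro p (rfl | rfl) x hx
  · exact ⟨(by gcongr; exact min_le_left _ _ : _ ≤ c1 * ‖x - p‖).trans
      (h1 x (hx.trans (min_le_left _ _))), (h3 x hx).trans (by gcongr; exact le_max_left _ _)⟩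
  · exact ⟨(by gcongr; exact min_le_right _ _ : _ ≤ c2 * ‖x - p‖).trans
      (h2 x (hx.trans (min_le_right _ _))), (h4 x hx).trans (by gcongr; exact le_max_right _ _)⟩

theorem IsBallAbout.subset {p : Plane} {B : Set Plane} (h : IsBallAbout p B) :
    ∃ R, B ⊆ Metric.closedBall p R := by
  obtain ⟨R, -, rfl | rfl⟩ := h
  exacts [⟨R, Metric.ball_subset_closedBall⟩, ⟨R, subset_rfl⟩]

/-- `√W` is bounded below away from the wells. -/
theorem DoubleWell.exists_lower_bound (h : DoubleWell W pm pp) {r : ℝ} (hr : 0 < r) :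
    ∃ m > 0, ∀ x, r ≤ ‖x - pm‖ → r ≤ ‖x - pp‖ → m ≤ √(W x) := by
  obtain ⟨Bm, Bp, h1, h2, -, -, -, m, hm, h3⟩ := h.balls
  obtain ⟨R1, hR1⟩ := h1.subset
  obtain ⟨R2, hR2⟩ := h2.subset
  -- Outside the two given balls the lower bound is assumed. What remains is a compact set free of
  -- zeros of W.
  set S := (Metric.closedBall pm R1 ∪ Metric.closedBall pp R2) ∩
    {x | r ≤ ‖x - pm‖ ∧ r ≤ ‖x - pp‖}
  have hS : IsCompact S := by
    refine ((isCompact_closedBall pm R1).union (isCompact_closedBall pp R2)).inter_right ?_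
    exact (isClosed_le continuous_const (continuous_id.sub continuous_const).norm).inter
      (isClosed_le continuous_const (continuous_id.sub continuous_const).norm)
  have hpos : ∀ x ∈ S, 0 < √(W x) := by
    rintro x ⟨-, hx1, hx2⟩
    refine Real.sqrt_pos.2 (h.pos ?_ ?_)
    · rintro rfl; simp at hx1; linarith
    · rintro rfl; simp at hx2; linarith
  obtain ⟨m', hm', h4⟩ := hS.exists_forall_le' h.continuous.sqrt.continuousOn hpos
  refine ⟨min m m', lt_min hm hm', fun x hx1 hx2 => ?_⟩
  by_cases hx : x ∈ Bm ∪ Bp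
  · refine (min_le_right _ _).trans (h4 x ⟨?_, hx1, hx2⟩)
    exact hx.imp (fun h => hR1 h) (fun h => hR2 h)
  · exact (min_le_left _ _).trans (h3 x hx)

end DoubleWell

/-! ### Curves near a well -/

/-- The integrand is the derivative of |γ - p|², which is absolutely continuous as a square of a
Lipschitz function. -/
theorem integral_inner_deriv {γ : ℝ → Plane} {K : NNReal} (hγ : LipschitzWith K γ) (p : Plane)
    (a b : ℝ) :
    ∫ t in a..b, 2 * inner ℝ (γ t - p) (deriv γ t) = ‖γ b - p‖ ^ 2 - ‖γ a - p‖ ^ 2 := by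
  have hρ : LipschitzWith (1 * (K + 0)) fun t => ‖γ t - p‖ :=
    lipschitzWith_one_norm.comp (hγ.sub (LipschitzWith.const p))
  have hac := (hρ.ac a b).fun_mul (hρ.ac a b)
  simp only [sq]
  rw [← hac.integral_deriv_eq_sub]
  refine intervalIntegral.integral_congr_ae ?_
  filter_upwards [hγ.ae_differentiableAt_real] with t ht _
  have := (ht.hasDerivAt.sub_const p).norm_sq
  simp only [sq] at this
  exact this.deriv.symm

/-- The density dominates c|γ - p||γ'| and hence the exact derivative of (c/2)|γ - p|². Closeness to
p is required only on the open time interval, so that T may be a first exit time. -/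
theorem well_estimate_of_mapsTo {W : Plane → ℝ} (hW : Continuous W) {p : Plane} {c r : ℝ}
    (hc : 0 < c) (hr : ∀ y, ‖y - p‖ ≤ r → c * ‖y - p‖ ≤ √(W y)) {γ : ℝ → Plane} {K : NNReal}
    (hγ : LipschitzWith K γ) (h0 : γ 0 = p) {T : ℝ} (hT : 0 ≤ T)
    (hmem : ∀ t ∈ Ioo 0 T, ‖γ t - p‖ ≤ r) :
    c / 2 * ‖γ T - p‖ ^ 2 ≤ ∫ t in (0 : ℝ)..T, √(W (γ t)) * ‖deriv γ t‖ := by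
  have h1 := integral_inner_deriv hγ p 0 T
  rw [h0, sub_self, norm_zero] at h1
  have h2 : c / 2 * ‖γ T - p‖ ^ 2 = ∫ t in (0 : ℝ)..T, c * inner ℝ (γ t - p) (deriv γ t) := by
    rw [intervalIntegral.integral_const_mul] at h1 ⊢
    linear_combination (-c / 2) * h1
  rw [h2]
  refine intervalIntegral.integral_mono_on_of_le_Ioo hT ?_
    (lip_intervalIntegrable_length hγ hW 0 T) fun t ht => ?_
  · have hcont : Continuous fun t => γ t - p := hγ.continuous.sub continuous_const
    have : (fun t => c * inner ℝ (γ t - p) (deriv γ t)) = fun t =>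
        c * (γ t - p) 0 * deriv γ t 0 + c * (γ t - p) 1 * deriv γ t 1 := by
      ext t
      simp [PiLp.inner_apply, Fin.sum_univ_two]
      ring
    rw [this]
    exact (lip_mul_coord_deriv hγ ((continuous_coord hcont 0).const_mul c).continuousOn 0).add
      (lip_mul_coord_deriv hγ ((continuous_coord hcont 1).const_mul c).continuousOn 1)
  · calc c * inner ℝ (γ t - p) (deriv γ t) ≤ c * (‖γ t - p‖ * ‖deriv γ t‖) := by
          gcongr; exact real_inner_le_norm _ _
      _ = c * ‖γ t - p‖ * ‖deriv γ t‖ := by ring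
      _ ≤ _ := by gcongr; exact hr _ (hmem t ht)

/-- Recentring the second coordinate at p costs only a boundary term. The new integrand is bounded
by |γ - p||γ'|, which the energy controls near a well. -/
theorem area_add_eq {γ : ℝ → Plane} {K : NNReal} (hγ : LipschitzWith K γ) (p : Plane) :
    area γ + p 1 * (γ 1 0 - γ 0 0) = -∫ t in (0 : ℝ)..1, (γ t - p) 1 * deriv γ t 0 := by
  have hγi := ac_intervalIntegrable_deriv (hγ.ac 0 1)
  have h1 : γ 1 0 - γ 0 0 = ∫ t in (0 : ℝ)..1, deriv γ t 0 := by
    rw [← integral_coord hγi, ac_integral_deriv (hγ.ac 0 1), PiLp.sub_apply]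
  rw [h1, ← intervalIntegral.integral_const_mul, area, neg_add_eq_sub, ← neg_sub,
    ← intervalIntegral.integral_sub (lip_intervalIntegrable_area hγ 0 1)
      ((intervalIntegrable_plane_iff.1 hγi 0).const_mul _)]
  simp only [PiLp.sub_apply, sub_mul]

/-- A curve starting at a well `p`, of small energy, stays close to `p`, and its energy controls
its area. -/
theorem HasCurve.well_estimate {W : Plane → ℝ} (hW : Continuous W) {p x : Plane} {c r e a l : ℝ}
    (hc : 0 < c) (hr0 : 0 ≤ r) (hr : ∀ y, ‖y - p‖ ≤ r → c * ‖y - p‖ ≤ √(W y))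
    (h : HasCurve W p x e a l)
    (he : e < c / 2 * r ^ 2) :
    c / 2 * ‖x - p‖ ^ 2 ≤ e ∧ c * |a + p 1 * (x 0 - p 0)| ≤ e := by
  obtain ⟨γ, ⟨K, hγ⟩, h0, rfl, rfl, rfl, -⟩ := h
  have hmono : ∀ T ∈ Icc (0 : ℝ) 1,
      ∫ t in (0 : ℝ)..T, √(W (γ t)) * ‖deriv γ t‖ ≤ degLength W γ := fun T hT =>
    intervalIntegral.integral_mono_interval le_rfl hT.1 hT.2
      (Eventually.of_forall fun t => by positivity) (lip_intervalIntegrable_length hγ hW 0 1)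
  have hcont : Continuous fun t => ‖γ t - p‖ := (hγ.continuous.sub continuous_const).norm
  -- At the first time T at distance at least r, the energy already spent would be at least (c/2)r²,
  -- more than the total.
  have hmem : ∀ t ∈ Icc (0 : ℝ) 1, ‖γ t - p‖ < r := by
    by_contra! hcon
    obtain ⟨t, ht, htr⟩ := hcon
    have hcomp : IsCompact (Icc (0 : ℝ) 1 ∩ {t | r ≤ ‖γ t - p‖}) :=
      isCompact_Icc.inter_right (isClosed_le continuous_const hcont)
    obtain ⟨T, hT, hTmin⟩ := hcomp.exists_isLeast ⟨t, ht, htr⟩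
    have := well_estimate_of_mapsTo hW hc hr hγ h0 hT.1.1 fun s hs => by
      by_contra! hs'
      exact absurd (hTmin ⟨⟨hs.1.le, hs.2.le.trans hT.1.2⟩, hs'.le⟩) (not_le.2 hs.2)
    have h3 := hmono T hT.1
    have h4 : r ^ 2 ≤ ‖γ T - p‖ ^ 2 := pow_le_pow_left₀ hr0 hT.2 2
    nlinarith
  refine ⟨well_estimate_of_mapsTo hW hc hr hγ h0 zero_le_one
    fun t ht => (hmem t (Ioo_subset_Icc_self ht)).le, ?_⟩
  have h1 := area_add_eq hγ p
  rw [h0] at h1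
  rw [h1, abs_neg, ← abs_of_pos hc, ← abs_mul, ← intervalIntegral.integral_const_mul,
    ← Real.norm_eq_abs]
  refine intervalIntegral.norm_integral_le_of_norm_le zero_le_one
    (Eventually.of_forall fun t ht => ?_) (lip_intervalIntegrable_length hγ hW 0 1)
  rw [Real.norm_eq_abs, abs_mul, abs_mul, abs_of_pos hc, ← mul_assoc]
  calc c * |(γ t - p) 1| * |deriv γ t 0| ≤ c * ‖γ t - p‖ * ‖deriv γ t‖ := by
        gcongr <;> exact abs_coord_le _ _
    _ ≤ _ := by gcongr; exact hr _ (hmem t (Ioc_subset_Icc_self ht)).le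

/-- Segments from a well. -/
theorem exists_segment_estimate {W : Plane → ℝ} {p x : Plane} {C : ℝ} (hC : 0 ≤ C)
    (hr : ∀ y, ‖y - p‖ ≤ ‖x - p‖ → √(W y) ≤ C * ‖y - p‖) (hW : Continuous W) :
    ∃ e a, HasCurve W p x e a ‖x - p‖ ∧ e ≤ C * ‖x - p‖ ^ 2 ∧
      |a + p 1 * (x 0 - p 0)| ≤ ‖x - p‖ ^ 2 := by
  refine ⟨_, _, hasCurve_segment W p x, ?_, ?_⟩
  · have : C * ‖x - p‖ ^ 2 = ∫ _ in (0 : ℝ)..1, C * ‖x - p‖ ^ 2 := by simp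
    rw [this]
    refine intervalIntegral.integral_mono_on zero_le_one ?_ intervalIntegrable_const
      fun t ht => ?_
    · refine Continuous.intervalIntegrable ?_ _ _
      exact (hW.comp (by fun_prop)).sqrt.mul continuous_const
    · have h1 : ‖p + t • (x - p) - p‖ ≤ ‖x - p‖ := by
        rw [add_sub_cancel_left, norm_smul, Real.norm_of_nonneg ht.1]
        exact mul_le_of_le_one_left (norm_nonneg _) ht.2
      calc √(W (p + t • (x - p))) * ‖x - p‖ ≤ (C * ‖x - p‖) * ‖x - p‖ := by
            gcongr; exact (hr _ h1).trans (by gcongr)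
        _ = _ := by ring
  · have h0 : |x 0 - p 0| ≤ ‖x - p‖ := abs_coord_le (x - p) 0
    have h1 : |x 1 - p 1| ≤ ‖x - p‖ := abs_coord_le (x - p) 1
    have : -(p 1 * (x 0 - p 0) + (x 1 - p 1) * (x 0 - p 0) / 2) + p 1 * (x 0 - p 0)
        = -((x 1 - p 1) * (x 0 - p 0) / 2) := by ring
    rw [this, abs_neg, abs_div, abs_mul, abs_two]
    nlinarith [mul_le_mul h1 h0 (abs_nonneg _) (norm_nonneg _), sq_nonneg ‖x - p‖]

/-! ### Variations of a curve that change the constraint value -/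

/-- A divergence free field whose flux through every curve joining the wells is `1`. -/
def fluxField (h : Plane → ℝ) (x : Plane) : Plane :=
  !₂[fderiv ℝ h x (EuclideanSpace.single 1 1), -fderiv ℝ h x (EuclideanSpace.single 0 1)]

theorem contDiff_fluxField {h : Plane → ℝ} (hh : ContDiff ℝ ∞ h) : ContDiff ℝ ∞ (fluxField h) := by
  have h1 : ContDiff ℝ ∞ (fderiv ℝ h) := hh.fderiv_right (by simp)
  rw [contDiff_euclidean]
  intro i
  fin_cases i
  · exact h1.clm_apply contDiff_const
  · exact (h1.clm_apply contDiff_const).neg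

theorem fderiv_apply_eq (L : Plane →L[ℝ] ℝ) (v : Plane) :
    L v = v 0 * L (EuclideanSpace.single 0 1) + v 1 * L (EuclideanSpace.single 1 1) := by
  have : v = v 0 • EuclideanSpace.single (0 : Fin 2) (1 : ℝ) +
      v 1 • EuclideanSpace.single (1 : Fin 2) (1 : ℝ) := by
    ext i; fin_cases i <;> simp
  conv_lhs => rw [this]
  simp

/-- The tangent line at 1 lies above the concave square root. Applied to ratios close to 1, it
yields upper bounds with the correct first order term. -/
theorem sqrt_le_half_one_add {a : ℝ} (ha : 0 ≤ a) : √a ≤ (1 + a) / 2 := by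
  rw [Real.sqrt_le_left (by linarith)]
  nlinarith [sq_nonneg (1 - a)]

/-- The product of the two quadratic upper bounds is expanded. All terms beyond first order carry
s², and |s| ≤ 1 bounds their coefficient. -/
theorem mul_expansion_le {p r s α β C M : ℝ} (hs : |s| ≤ 1) (hp : 0 ≤ p)
    (hα : |α| ≤ M) (hβ : |β| ≤ M)
    (hC : 0 ≤ C) (h1 : p ≤ 1 + s * α + C * s ^ 2) (h2 : r ≤ 1 + s * β + C * s ^ 2) (hr : 0 ≤ r) :
    p * r ≤ 1 + s * (α + β) + (M ^ 2 + 2 * C + 2 * C * M + C ^ 2) * s ^ 2 := by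
  have hM : 0 ≤ M := (abs_nonneg α).trans hα
  have h3 : p * r ≤ (1 + s * α + C * s ^ 2) * (1 + s * β + C * s ^ 2) :=
    mul_le_mul h1 h2 hr (hp.trans h1)
  have h4 : α * β ≤ M ^ 2 := by
    calc α * β ≤ |α * β| := le_abs_self _
      _ = |α| * |β| := abs_mul _ _
      _ ≤ M * M := mul_le_mul hα hβ (abs_nonneg _) hM
      _ = M ^ 2 := (sq M).symm
  have h5 : s * (α + β) ≤ 2 * M := by
    calc s * (α + β) ≤ |s * (α + β)| := le_abs_self _
      _ = |s| * |α + β| := abs_mul _ _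
      _ ≤ 1 * (M + M) := mul_le_mul hs ((abs_add_le _ _).trans (add_le_add hα hβ))
          (abs_nonneg _) zero_le_one
      _ = 2 * M := by ring
  have h6 : s ^ 2 ≤ 1 := by rw [← sq_abs]; exact pow_le_one₀ (abs_nonneg s) hs
  have h7 : (1 + s * α + C * s ^ 2) * (1 + s * β + C * s ^ 2) = 1 + s * (α + β) +
      s ^ 2 * (α * β + 2 * C + C * (s * (α + β)) + C ^ 2 * s ^ 2) := by ring
  rw [h7] at h3
  refine h3.trans ?_
  have h8 : α * β + 2 * C + C * (s * (α + β)) + C ^ 2 * s ^ 2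
      ≤ M ^ 2 + 2 * C + 2 * C * M + C ^ 2 := by
    have := mul_le_mul_of_nonneg_left h5 hC
    have := mul_le_of_le_one_right (sq_nonneg C) h6
    linarith
  linarith [mul_le_mul_of_nonneg_left h8 (sq_nonneg s)]

/-- First order expansion of the energy density under a variation, with one-sided quadratic
remainder. -/
theorem exists_density_expansion {W : Plane → ℝ} {X : Plane → Plane} {A : Set Plane} {R m : ℝ}
    (hW : ContDiff ℝ 2 W) (hnn : ∀ x, 0 ≤ W x) (hX : ContDiff ℝ 1 X)
    (hA : A ⊆ Metric.closedBall 0 R) (hm : 0 < m) (hmA : ∀ x ∈ A, m ≤ W x)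
    (hX0 : ∀ x, x ∉ A → X x = 0 ∧ fderiv ℝ X x = 0) :
    ∃ C ≥ 0, ∃ d : Plane → Plane → ℝ, Measurable (fun z : Plane × Plane => d z.1 z.2) ∧
      (∀ x v, |d x v| ≤ C * (√(W x) * ‖v‖)) ∧
      (∀ x, ‖X x‖ * ‖fderiv ℝ X x‖ ≤ C * √(W x)) ∧
      ∀ x v s, |s| ≤ 1 → √(W (x + s • X x)) * ‖v + s • fderiv ℝ X x v‖
        ≤ √(W x) * ‖v‖ + s * d x v + C * s ^ 2 * (√(W x) * ‖v‖) := by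
  have hXc : Continuous X := hX.continuous
  have hDc : Continuous (fderiv ℝ X) := hX.continuous_fderiv (by norm_num)
  have hWc : Continuous (fderiv ℝ W) := hW.continuous_fderiv (by norm_num)
  have hbd : ∀ f : Plane → ℝ, Continuous f → ∃ M ≥ 0, ∀ x ∈ A, f x ≤ M := fun f hf => by
    obtain ⟨M, hM⟩ := (isCompact_closedBall (0 : Plane) R).bddAbove_image hf.continuousOn
    exact ⟨|M|, abs_nonneg M, fun x hx =>
      (hM (mem_image_of_mem _ (hA hx))).trans (le_abs_self M)⟩
  obtain ⟨M1, hM1, h1⟩ := hbd _ hXc.norm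
  obtain ⟨M2, hM2, h2⟩ := hbd _ hDc.norm
  obtain ⟨M3, hM3, h3⟩ := hbd _ hWc.norm
  obtain ⟨T, hT, hTay⟩ := taylor_bound hW (R + M1)
  -- The logarithmic derivatives of the two factors of the density: α that of √W along X, β that of
  -- |v| along v + s DX(v). Where W vanishes, X vanishes as well, so α is 0 there; β is 0 at v = 0
  -- by the convention for division.
  set α : Plane → ℝ := fun x => fderiv ℝ W x (X x) / (2 * W x) with hα
  set β : Plane → Plane → ℝ := fun x v => inner ℝ v (fderiv ℝ X x v) / ‖v‖ ^ 2 with hβ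
  have hαb : ∀ x, |α x| ≤ M3 * M1 / (2 * m) := by
    intro x
    by_cases hx : x ∈ A
    · rw [hα]
      simp only
      rw [abs_div, abs_of_nonneg (by have := hnn x; positivity : 0 ≤ 2 * W x)]
      have : |fderiv ℝ W x (X x)| ≤ M3 * M1 := ((fderiv ℝ W x).le_opNorm _).trans
        (mul_le_mul (h3 x hx) (h1 x hx) (norm_nonneg _) hM3)
      gcongr
      exact hmA x hx
    · simp only [hα, (hX0 x hx).1, map_zero, zero_div, abs_zero]
      positivity
  have hβb : ∀ x v, |β x v| ≤ M2 := by
    intro x v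
    by_cases hx : x ∈ A
    · rw [hβ]
      simp only
      rw [abs_div, abs_of_nonneg (by positivity : 0 ≤ ‖v‖ ^ 2)]
      refine div_le_of_le_mul₀ (by positivity) hM2 ?_
      calc |inner ℝ v (fderiv ℝ X x v)| ≤ ‖v‖ * ‖fderiv ℝ X x v‖ := abs_real_inner_le_norm _ _
        _ ≤ ‖v‖ * (M2 * ‖v‖) := by
            gcongr
            exact ((fderiv ℝ X x).le_opNorm v).trans (by gcongr; exact h2 x hx)
        _ = _ := by ring
    · simp only [hβ, (hX0 x hx).2, zero_apply, inner_zero_right, zero_div, abs_zero]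
      exact hM2
  set M := M3 * M1 / (2 * m) + M2 with hM
  have hM0 : 0 ≤ M := by positivity
  set C1 := T * M1 ^ 2 / (2 * m) + M2 ^ 2 / 2 with hC1
  have hC10 : 0 ≤ C1 := by positivity
  set C2 := M ^ 2 + 2 * C1 + 2 * C1 * M + C1 ^ 2 with hC2
  have hC20 : 0 ≤ C2 := by positivity
  refine ⟨max C2 (max (M + M) (M1 * M2 / √m)), le_max_of_le_left hC20,
    fun x v => (α x + β x v) * (√(W x) * ‖v‖), ?_, fun x v => ?_, fun x => ?_,
    fun x v s hs => ?_⟩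
  · have hαm : Measurable α := by
      refine Measurable.div ?_ ?_
      · exact (hWc.clm_apply hXc).measurable
      · exact (hW.continuous.measurable).const_mul 2
    have hβm : Measurable fun z : Plane × Plane => β z.1 z.2 := by
      refine Measurable.div ?_ ?_
      · exact (continuous_snd.inner ((hDc.comp continuous_fst).clm_apply
          continuous_snd)).measurable
      · exact (continuous_snd.norm.pow 2).measurable
    refine ((hαm.comp measurable_fst).add hβm).mul ?_
    exact ((hW.continuous.comp continuous_fst).sqrt.mul continuous_snd.norm).measurable
  · rw [abs_mul, abs_of_nonneg (by positivity : 0 ≤ √(W x) * ‖v‖)]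
    gcongr
    refine (abs_add_le _ _).trans ((add_le_add ?_ ?_).trans
      ((le_max_left _ _).trans (le_max_right _ _)))
    · exact (hαb x).trans (le_add_of_nonneg_right hM2)
    · exact (hβb x v).trans (le_add_of_nonneg_left (by positivity))
  -- This bound by √W later makes the quadratic part of the area variation controllable by the
  -- energy.
  · by_cases hx : x ∈ A
    · have h4 : √m ≤ √(W x) := Real.sqrt_le_sqrt (hmA x hx)
      have h5 : 0 < √m := Real.sqrt_pos.2 hm
      calc ‖X x‖ * ‖fderiv ℝ X x‖ ≤ M1 * M2 :=
            mul_le_mul (h1 x hx) (h2 x hx) (norm_nonneg _) hM1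
        _ = M1 * M2 / √m * √m := by field_simp
        _ ≤ M1 * M2 / √m * √(W x) := by gcongr
        _ ≤ _ := by gcongr; exact (le_max_right _ _).trans (le_max_right _ _)
    · rw [(hX0 x hx).1, norm_zero, zero_mul]
      exact mul_nonneg (le_max_of_le_left hC20) (Real.sqrt_nonneg _)
  · by_cases hx : x ∈ A
    swap
    · have hd : (α x + β x v) = 0 := by simp [hα, hβ, (hX0 x hx).1, (hX0 x hx).2]
      rw [(hX0 x hx).1, (hX0 x hx).2]
      simp only [hd, smul_zero, add_zero, zero_apply, zero_mul, mul_zero]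
      have : 0 ≤ max C2 (max (M + M) (M1 * M2 / √m)) := le_max_of_le_left hC20
      have : 0 ≤ max C2 (max (M + M) (M1 * M2 / √m)) * s ^ 2 * (√(W x) * ‖v‖) := by positivity
      linarith
    rcases eq_or_ne v 0 with rfl | hv
    · simp
    have hWx : 0 < W x := hm.trans_le (hmA x hx)
    have hvn : 0 < ‖v‖ := norm_pos_iff.2 hv
    -- Both factors are written relative to their values at s = 0, so that `sqrt_le_half_one_add`
    -- applies to ratios near 1.
    have e1 : √(W (x + s • X x)) = √(W (x + s • X x) / W x) * √(W x) := by
      rw [← Real.sqrt_mul (div_nonneg (hnn _) hWx.le), div_mul_cancel₀ _ hWx.ne']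
    have e2 : ‖v + s • fderiv ℝ X x v‖
        = √(‖v + s • fderiv ℝ X x v‖ ^ 2 / ‖v‖ ^ 2) * ‖v‖ := by
      rw [← div_pow, Real.sqrt_sq (by positivity), div_mul_cancel₀ _ hvn.ne']
    have b1 : √(W (x + s • X x) / W x) ≤ 1 + s * α x + C1 * s ^ 2 := by
      refine (sqrt_le_half_one_add (div_nonneg (hnn _) hWx.le)).trans ?_
      have hxR : ‖x‖ ≤ R := by simpa using hA hx
      have hsX : ‖s • X x‖ ≤ |s| * M1 := by
        rw [norm_smul]; exact mul_le_mul_of_nonneg_left (h1 x hx) (abs_nonneg s)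
      have h4 := hTay x (by simpa using hxR.trans (le_add_of_nonneg_right hM1)) (x + s • X x) (by
        rw [mem_closedBall_zero_iff]
        refine (norm_add_le _ _).trans (add_le_add hxR (hsX.trans ?_))
        exact mul_le_of_le_one_left hM1 hs)
      rw [add_sub_cancel_left, map_smul, smul_eq_mul] at h4
      have h5 : W (x + s • X x) ≤ W x + s * fderiv ℝ W x (X x) + T * (s ^ 2 * M1 ^ 2) := by
        have h6 : ‖s • X x‖ ^ 2 ≤ s ^ 2 * M1 ^ 2 := by
          rw [← sq_abs s, ← mul_pow]; exact pow_le_pow_left₀ (norm_nonneg _) hsX 2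
        have := (le_abs_self _).trans h4
        have := mul_le_mul_of_nonneg_left h6 hT
        linarith
      have h6 : W (x + s • X x) / W x ≤ 1 + 2 * (s * α x) + T * M1 ^ 2 / m * s ^ 2 := by
        rw [div_le_iff₀ hWx]
        have h7 : T * M1 ^ 2 / m * s ^ 2 * W x ≥ T * M1 ^ 2 * s ^ 2 := by
          rw [ge_iff_le, div_mul_eq_mul_div, div_mul_eq_mul_div, le_div_iff₀ hm]
          exact mul_le_mul_of_nonneg_left (hmA x hx) (by positivity)
        have h8 : 2 * (s * α x) * W x = s * fderiv ℝ W x (X x) := by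
          rw [hα]; field_simp
        linarith
      have h9 : C1 * s ^ 2 ≥ T * M1 ^ 2 / m * s ^ 2 / 2 := by
        have h10 : T * M1 ^ 2 / m * s ^ 2 / 2 = T * M1 ^ 2 / (2 * m) * s ^ 2 := by
          field_simp
        rw [h10, hC1]
        gcongr
        exact le_add_of_nonneg_right (by positivity)
      linarith
    have b2 : √(‖v + s • fderiv ℝ X x v‖ ^ 2 / ‖v‖ ^ 2) ≤ 1 + s * β x v + C1 * s ^ 2 := by
      refine (sqrt_le_half_one_add (by positivity)).trans ?_
      have h4 : ‖v + s • fderiv ℝ X x v‖ ^ 2 / ‖v‖ ^ 2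
          ≤ 1 + 2 * (s * β x v) + M2 ^ 2 * s ^ 2 := by
        rw [div_le_iff₀ (by positivity), norm_add_sq_real, inner_smul_right, norm_smul]
        have h5 : ‖fderiv ℝ X x v‖ ≤ M2 * ‖v‖ :=
          ((fderiv ℝ X x).le_opNorm v).trans (by gcongr; exact h2 x hx)
        have h6 : (‖s‖ * ‖fderiv ℝ X x v‖) ^ 2 ≤ M2 ^ 2 * s ^ 2 * ‖v‖ ^ 2 := by
          calc (‖s‖ * ‖fderiv ℝ X x v‖) ^ 2 ≤ (‖s‖ * (M2 * ‖v‖)) ^ 2 := by gcongr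
            _ = _ := by rw [Real.norm_eq_abs, mul_pow, sq_abs]; ring
        have h8 : 2 * (s * β x v) * ‖v‖ ^ 2 = 2 * (s * inner ℝ v (fderiv ℝ X x v)) := by
          rw [hβ]; field_simp
        linarith
      have h9 : C1 * s ^ 2 ≥ M2 ^ 2 * s ^ 2 / 2 := by
        have h10 : M2 ^ 2 * s ^ 2 / 2 = M2 ^ 2 / 2 * s ^ 2 := by ring
        rw [h10, hC1]
        gcongr
        exact le_add_of_nonneg_left (by positivity)
      linarith
    have key := mul_expansion_le hs (Real.sqrt_nonneg _)
      ((hαb x).trans (le_add_of_nonneg_right hM2) : |α x| ≤ M)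
      ((hβb x v).trans (le_add_of_nonneg_left (by positivity)) : |β x v| ≤ M) hC10 b1 b2
      (Real.sqrt_nonneg _)
    have hpos : 0 ≤ √(W x) * ‖v‖ := by positivity
    calc √(W (x + s • X x)) * ‖v + s • fderiv ℝ X x v‖
        = √(W (x + s • X x) / W x) * √(‖v + s • fderiv ℝ X x v‖ ^ 2 / ‖v‖ ^ 2)
          * (√(W x) * ‖v‖) := by rw [e1]; nth_rewrite 1 [e2]; ring
      _ ≤ (1 + s * (α x + β x v) + C2 * s ^ 2) * (√(W x) * ‖v‖) := by gcongr
      _ = √(W x) * ‖v‖ + s * ((α x + β x v) * (√(W x) * ‖v‖))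
          + C2 * s ^ 2 * (√(W x) * ‖v‖) := by ring
      _ ≤ _ := by gcongr; exact le_max_left _ _

section Flow

variable {W : Plane → ℝ} {pm pp : Plane}

/-- A bump around `pp` with radii one quarter and one half of the distance of the wells. It varies
only in an annulus that stays away from both wells, so the flux field lives where √W has a positive
lower bound. -/
theorem exists_cutoff (hne : pm ≠ pp) :
    ∃ h : Plane → ℝ, ContDiff ℝ ∞ h ∧ HasCompactSupport h ∧ h pm = 0 ∧ h pp = 1 ∧
      ∃ r > 0, ∀ x, ¬ (r ≤ ‖x - pm‖ ∧ r ≤ ‖x - pp‖ ∧ ‖x‖ ≤ ‖pp‖ + 2 * r) →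
        ∃ a, h =ᶠ[𝓝 x] fun _ => a := by
  have hd : 0 < ‖pm - pp‖ := norm_pos_iff.2 (sub_ne_zero.2 hne)
  let f : ContDiffBump pp := ⟨‖pm - pp‖ / 4, ‖pm - pp‖ / 2, by positivity, by linarith⟩
  have hr1 : f.rIn = ‖pm - pp‖ / 4 := rfl
  have hr2 : f.rOut = ‖pm - pp‖ / 2 := rfl
  refine ⟨f, f.contDiff, f.hasCompactSupport, ?_, ?_, ‖pm - pp‖ / 4, by positivity, fun x hx => ?_⟩
  · exact f.zero_of_le_dist (by rw [dist_eq_norm, hr2]; linarith)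
  · exact f.one_of_mem_closedBall (by simp [f.rIn_pos.le])
  · by_cases h1 : ‖x - pp‖ < ‖pm - pp‖ / 4
    · exact ⟨1, f.eventuallyEq_one_of_mem_ball (by rwa [mem_ball_iff_norm, hr1])⟩
    · have h2 : ‖pm - pp‖ / 2 < ‖x - pp‖ := by
        by_contra! h2
        refine hx ⟨?_, not_lt.1 h1, ?_⟩
        · have : ‖pm - pp‖ ≤ ‖x - pm‖ + ‖x - pp‖ := by
            rw [norm_sub_rev x pm]
            simpa using norm_add_le (pm - x) (x - pp)
          linarith
        · have : ‖x‖ ≤ ‖pp‖ + ‖x - pp‖ := by simpa using norm_add_le pp (x - pp)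
          linarith
      refine ⟨0, ?_⟩
      have h3 : ∀ᶠ y in 𝓝 x, ‖pm - pp‖ / 2 < ‖y - pp‖ :=
        (continuous_id.sub continuous_const).norm.continuousAt.eventually
          (lt_mem_nhds (by exact h2))
      filter_upwards [h3] with y hy
      exact f.zero_of_le_dist (by rw [dist_eq_norm, hr2]; exact hy.le)

theorem fluxField_eq_zero {h : Plane → ℝ} {x : Plane} {a : ℝ} (hx : h =ᶠ[𝓝 x] fun _ => a) :
    fluxField h x = 0 ∧ fderiv ℝ (fluxField h) x = 0 := by
  have h1 : ∀ᶠ y in 𝓝 x, fluxField h y = 0 := by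
    filter_upwards [hx.eventually_nhds] with y hy
    have : fderiv ℝ h y = 0 := by
      rw [EventuallyEq.fderiv_eq (show h =ᶠ[𝓝 y] fun _ => a from hy)]; simp
    ext i
    fin_cases i <;> simp [fluxField, this]
  refine ⟨h1.self_of_nhds, ?_⟩
  have h2 : fluxField h =ᶠ[𝓝 x] fun _ => (0 : Plane) := h1
  rw [h2.fderiv_eq]
  simp

theorem hasCompactSupport_fluxField {h : Plane → ℝ} (hh : HasCompactSupport h) :
    HasCompactSupport (fluxField h) := by
  refine hh.fderiv (𝕜 := ℝ) |>.mono' ?_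
  intro x hx
  refine subset_tsupport _ fun h0 => hx ?_
  ext i
  fin_cases i <;> simp [fluxField, h0]

/-- The constraint value along a variation by a flux field. -/
theorem area_variation {h : Plane → ℝ} (hh : ContDiff ℝ ∞ h) {L : NNReal}
    (hL : LipschitzWith L (fluxField h)) {γ : ℝ → Plane} {K : NNReal} (hγ : LipschitzWith K γ)
    (h0 : fluxField h (γ 0) = 0) (h1 : fluxField h (γ 1) = 0) (s : ℝ) :
    area (fun t => γ t + s • fluxField h (γ t)) = area γ + s * (h (γ 1) - h (γ 0)) +
      (-∫ t in (0 : ℝ)..1, fluxField h (γ t) 1 * deriv (fun t => fluxField h (γ t)) t 0)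
        * s ^ 2 := by
  set X := fluxField h with hX
  set ξ : ℝ → Plane := fun t => X (γ t) with hξ
  have hξL : LipschitzWith (L * K) ξ := hL.comp hγ
  have hXi : ∀ x, X x 0 = fderiv ℝ h x (EuclideanSpace.single 1 1) ∧
      X x 1 = -fderiv ℝ h x (EuclideanSpace.single 0 1) := fun x => ⟨rfl, rfl⟩
  have hγd := hγ.ae_differentiableAt_real
  have hξd := hξL.ae_differentiableAt_real
  have e1 : area (fun t => γ t + s • ξ t) = -∫ t in (0 : ℝ)..1,
      (γ t 1 * deriv γ t 0 + s * (γ t 1 * deriv ξ t 0 + ξ t 1 * deriv γ t 0)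
        + s ^ 2 * (ξ t 1 * deriv ξ t 0)) := by
    rw [area]
    congr 1
    refine intervalIntegral.integral_congr_ae ?_
    filter_upwards [hγd, hξd] with t h2 h3 _
    have h5 : deriv (fun t => γ t + s • ξ t) t = deriv γ t + s • deriv ξ t :=
      (h2.hasDerivAt.add (h3.hasDerivAt.const_smul s)).deriv
    rw [h5]
    simp
    ring
  have ii : ∀ {u w : ℝ → Plane} {K' L' : NNReal} (_ : LipschitzWith K' u)
      (_ : LipschitzWith L' w) (i j : Fin 2),
      IntervalIntegrable (fun t => u t i * deriv w t j) volume 0 1 := fun hu hw i j =>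
    lip_mul_coord_deriv hw (continuous_coord hu.continuous i).continuousOn j
  have i1 := ii hγ hγ 1 0
  have i2 := ii hγ hξL 1 0
  have i3 := ii hξL hγ 1 0
  have i4 := ii hξL hξL 1 0
  have i5 := ii hξL hγ 0 1
  -- Integration by parts moves the derivative off the variation field; the boundary terms vanish
  -- because the field is zero at both endpoints.
  have e2 : ∫ t in (0 : ℝ)..1, γ t 1 * deriv ξ t 0 = -∫ t in (0 : ℝ)..1, ξ t 0 * deriv γ t 1 := by
    have := (ac_coord (hγ.ac 0 1) 1).integral_mul_deriv_eq_deriv_mul (ac_coord (hξL.ac 0 1) 0)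
    have hz0 : ξ 0 0 = 0 := by rw [hξ]; simp only; rw [h0]; rfl
    have hz1 : ξ 1 0 = 0 := by rw [hξ]; simp only; rw [h1]; rfl
    rw [hz0, hz1, mul_zero, mul_zero, sub_zero, zero_sub] at this
    have c1 : ∫ t in (0 : ℝ)..1, γ t 1 * deriv ξ t 0
        = ∫ t in (0 : ℝ)..1, γ t 1 * deriv (fun t => ξ t 0) t := by
      refine intervalIntegral.integral_congr_ae ?_
      filter_upwards [hξd] with t h2 _
      rw [deriv_coord h2]
    have c2 : ∫ t in (0 : ℝ)..1, ξ t 0 * deriv γ t 1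
        = ∫ t in (0 : ℝ)..1, deriv (fun t => γ t 1) t * ξ t 0 := by
      refine intervalIntegral.integral_congr_ae ?_
      filter_upwards [hγd] with t h2 _
      rw [deriv_coord h2, mul_comm]
    rw [c1, c2, this]
  -- As ξ is the rotated gradient of h, the integrand is the derivative of h ∘ γ: the flux depends
  -- only on the endpoints.
  have e3 : ∫ t in (0 : ℝ)..1, (ξ t 0 * deriv γ t 1 - ξ t 1 * deriv γ t 0)
      = h (γ 1) - h (γ 0) := by
    have hhγ : AbsolutelyContinuousOnInterval (fun t => h (γ t)) 0 1 := by
      have hs : (γ '' uIcc 0 1) ⊆ Metric.closedBall 0 (‖γ 0‖ + K) := by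
        rintro _ ⟨t, ht, rfl⟩
        rw [uIcc_of_le zero_le_one] at ht
        rw [mem_closedBall_zero_iff]
        have := hγ.norm_sub_le t 0
        rw [sub_zero, Real.norm_of_nonneg ht.1] at this
        have h6 : (K : ℝ) * t ≤ K := mul_le_of_le_one_right K.2 ht.2
        have h7 : ‖γ t‖ ≤ ‖γ 0‖ + ‖γ t - γ 0‖ := by simpa using norm_add_le (γ 0) (γ t - γ 0)
        linarith
      obtain ⟨L', hL'⟩ := (hh.of_le (by simp) : ContDiff ℝ 1 h).locallyLipschitz
        |>.locallyLipschitzOn.exists_lipschitzOnWith_of_compact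
          (isCompact_closedBall (0 : Plane) (‖γ 0‖ + K))
      exact (hL'.comp (hγ.lipschitzOnWith (s := uIcc 0 1))
        (mapsTo_iff_image_subset.2 hs)).absolutelyContinuousOnInterval
    rw [← hhγ.integral_deriv_eq_sub]
    refine intervalIntegral.integral_congr_ae ?_
    filter_upwards [hγd] with t h2 _
    have h5 := ((hh.differentiable (by simp)) (γ t)).hasFDerivAt.comp_hasDerivAt t h2.hasDerivAt
    change _ = deriv (h ∘ γ) t
    rw [h5.deriv, fderiv_apply_eq]
    simp only [hξ]
    rw [(hXi _).1, (hXi _).2]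
    ring
  rw [intervalIntegral.integral_sub i5 i3] at e3
  rw [e1, intervalIntegral.integral_add (i1.add ((i2.add i3).const_mul s)) (i4.const_mul _),
    intervalIntegral.integral_add i1 ((i2.add i3).const_mul s),
    intervalIntegral.integral_const_mul, intervalIntegral.integral_const_mul,
    intervalIntegral.integral_add i2 i3, e2, ← e3, area]
  ring

/-- Every curve between the wells admits a variation with unit rate of change of the constraint,
with uniform control of the energy. -/
theorem DoubleWell.exists_variation (hW : DoubleWell W pm pp) :
    ∃ C > 0, ∀ e a l, HasCurve W pm pp e a l → ∃ D Q : ℝ, |Q| ≤ C * e ∧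
      ∀ s : ℝ, |s| ≤ 1 → ∃ e' l', e' ≤ e + s * D + C * s ^ 2 * e ∧
        HasCurve W pm pp e' (a + s + Q * s ^ 2) l' := by
  obtain ⟨h, hh, hsupp, hpm, hpp, r, hr, hloc⟩ := exists_cutoff hW.ne
  obtain ⟨m, hm, hmW⟩ := hW.exists_lower_bound hr
  set X := fluxField h with hX
  have hX1 : ContDiff ℝ 1 X := (contDiff_fluxField hh).of_le (by simp)
  obtain ⟨L, hL⟩ := hX1.lipschitzWith_of_hasCompactSupport (hasCompactSupport_fluxField hsupp) (by norm_num)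
  have hXm : X pm = 0 := by
    obtain ⟨a, ha⟩ := hloc pm (by simp [hr])
    exact (fluxField_eq_zero ha).1
  have hXp : X pp = 0 := by
    obtain ⟨a, ha⟩ := hloc pp (by simp [hr])
    exact (fluxField_eq_zero ha).1
  obtain ⟨C, hC, d, hdm, hdb, hXb, hexp⟩ := exists_density_expansion
    (A := {x | r ≤ ‖x - pm‖ ∧ r ≤ ‖x - pp‖ ∧ ‖x‖ ≤ ‖pp‖ + 2 * r}) hW.contDiff hW.nonneg hX1
    (R := ‖pp‖ + 2 * r) (fun x hx => by simpa using hx.2.2) (pow_pos hm 2)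
    (fun x hx => by
      rw [← Real.sq_sqrt (hW.nonneg x)]
      exact pow_le_pow_left₀ hm.le (hmW x hx.1 hx.2.1) 2)
    (fun x hx => by
      obtain ⟨a, ha⟩ := hloc x hx
      exact fluxField_eq_zero ha)
  refine ⟨C + 1, by positivity, ?_⟩
  rintro e a l ⟨γ, ⟨K, hγ⟩, h0, h1, rfl, rfl, -⟩
  have hlen := lip_intervalIntegrable_length hγ hW.continuous 0 1
  have hE : 0 ≤ degLength W γ := intervalIntegral.integral_nonneg zero_le_one
    fun t _ => by positivity
  have hγd := hγ.ae_differentiableAt_real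
  have hchain : ∀ t, DifferentiableAt ℝ γ t → HasDerivAt (fun t => X (γ t))
      (fderiv ℝ X (γ t) (deriv γ t)) t := fun t ht =>
    ((hX1.differentiable (by norm_num)) (γ t)).hasFDerivAt.comp_hasDerivAt t ht.hasDerivAt
  -- D is the first variation of the energy and Q the coefficient of s² in the area. The constant C
  -- depends only on W and the field, not on the curve.
  refine ⟨∫ t in (0 : ℝ)..1, d (γ t) (deriv γ t),
    -∫ t in (0 : ℝ)..1, X (γ t) 1 * deriv (fun t => X (γ t)) t 0, ?_, fun s hs =>
    ⟨degLength W (fun t => γ t + s • X (γ t)), arclength (fun t => γ t + s • X (γ t)), ?_,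
      fun t => γ t + s • X (γ t), ⟨K + ‖s‖₊ * (L * K), ?_⟩, by simp [h0, hXm], by simp [h1, hXp],
      rfl, ?_, rfl⟩⟩
  · rw [abs_neg, degLength, ← intervalIntegral.integral_const_mul, ← Real.norm_eq_abs]
    refine intervalIntegral.norm_integral_le_of_norm_le zero_le_one ?_ (hlen.const_mul _)
    filter_upwards [hγd] with t ht _
    rw [(hchain t ht).deriv, Real.norm_eq_abs, abs_mul]
    calc |X (γ t) 1| * |fderiv ℝ X (γ t) (deriv γ t) 0|
        ≤ ‖X (γ t)‖ * (‖fderiv ℝ X (γ t)‖ * ‖deriv γ t‖) := by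
          gcongr
          · exact abs_coord_le _ _
          · exact (abs_coord_le _ _).trans ((fderiv ℝ X (γ t)).le_opNorm _)
      _ = ‖X (γ t)‖ * ‖fderiv ℝ X (γ t)‖ * ‖deriv γ t‖ := by ring
      _ ≤ C * √(W (γ t)) * ‖deriv γ t‖ :=
          mul_le_mul_of_nonneg_right (hXb _) (norm_nonneg _)
      _ ≤ (C + 1) * (√(W (γ t)) * ‖deriv γ t‖) := by
          rw [mul_assoc]; gcongr; linarith
  · have hη : LipschitzWith (K + ‖s‖₊ * (L * K)) fun t => γ t + s • X (γ t) :=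
      hγ.add ((lipschitzWith_smul s).comp (hL.comp hγ))
    have hdi : IntervalIntegrable (fun t => d (γ t) (deriv γ t)) volume 0 1 := by
      refine (hlen.const_mul C).mono_fun' ?_ (Eventually.of_forall fun t => hdb _ _)
      exact (hdm.comp (hγ.continuous.measurable.prodMk
        (measurable_deriv_plane γ))).aestronglyMeasurable
    calc degLength W (fun t => γ t + s • X (γ t))
        ≤ ∫ t in (0 : ℝ)..1, (√(W (γ t)) * ‖deriv γ t‖ + s * d (γ t) (deriv γ t)
            + C * s ^ 2 * (√(W (γ t)) * ‖deriv γ t‖)) := by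
          refine intervalIntegral.integral_mono_ae zero_le_one
            (lip_intervalIntegrable_length hη hW.continuous 0 1)
            ((hlen.add (hdi.const_mul s)).add (hlen.const_mul _)) ?_
          filter_upwards [hγd] with t ht
          have h5 : deriv (fun t => γ t + s • X (γ t)) t
              = deriv γ t + s • fderiv ℝ X (γ t) (deriv γ t) :=
            (ht.hasDerivAt.add ((hchain t ht).const_smul s)).deriv
          rw [h5]
          exact hexp _ _ s hs
      _ = degLength W γ + s * (∫ t in (0 : ℝ)..1, d (γ t) (deriv γ t))
            + C * s ^ 2 * degLength W γ := by
          rw [intervalIntegral.integral_add (hlen.add (hdi.const_mul s)) (hlen.const_mul _),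
            intervalIntegral.integral_add hlen (hdi.const_mul s),
            intervalIntegral.integral_const_mul, intervalIntegral.integral_const_mul]
          rfl
      _ ≤ _ := by gcongr; linarith
  · exact hγ.add ((lipschitzWith_smul s).comp (hL.comp hγ))
  · rw [area_variation hh hL hγ (by rw [h0]; exact hXm) (by rw [h1]; exact hXp), h0, h1, hpm, hpp]
    ring

end Flow

/-! ### Correcting the constraint value at small cost -/

/-- A perturbation of the identity attains small values near the origin. -/
theorem exists_root_of_near_id {f : ℝ → ℝ} (hf : Continuous f) {b : ℝ}
    (h : ∀ s, |s| ≤ 2 * |b| → |f s - s| ≤ |b|) : ∃ s, |s| ≤ 2 * |b| ∧ f s = b := by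
  have hb := abs_nonneg b
  have h1 := abs_le.1 (h (2 * |b|) (by rw [abs_of_nonneg (by positivity)]))
  have h2 := abs_le.1 (h (-(2 * |b|)) (by rw [abs_neg, abs_of_nonneg (by positivity)]))
  obtain ⟨s, hs, hs'⟩ := intermediate_value_Icc (by linarith : -(2 * |b|) ≤ 2 * |b|)
    hf.continuousOn (show b ∈ Icc (f (-(2 * |b|))) (f (2 * |b|)) from
      ⟨by linarith [h2.2, neg_abs_le b], by linarith [h1.1, le_abs_self b]⟩)
  exact ⟨s, abs_le.2 hs, hs'⟩

section Correction

variable {W : Plane → ℝ} {pm pp : Plane}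

/-- Nearly minimizing curves can be modified so as to change the constraint value by `b`, at an
energy cost which is at most a small multiple of `|b|`. -/
theorem DoubleWell.exists_correction (hW : DoubleWell W pm pp) {E₀ : ℝ}
    (hE : ∀ e a l, HasCurve W pm pp e a l → E₀ ≤ e) {η : ℝ} (hη : 0 < η) :
    ∃ δ > 0, ∀ e a l b, HasCurve W pm pp e a l → e ≤ E₀ + δ → |b| ≤ δ →
      ∃ e' l', e' ≤ e + η * |b| ∧ HasCurve W pm pp e' (a + b) l' := by
  obtain ⟨C, hC, hvar⟩ := hW.exists_variation
  set M := |E₀| + 1 with hM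
  have hM1 : 1 ≤ M := by linarith [abs_nonneg E₀]
  have hM0 : 0 < M := by linarith
  have hCM : 0 < C * M := mul_pos hC hM0
  -- A fixed step at which the second order energy term is at most s₁η/8; it serves to test the size
  -- of the first variation.
  set s₁ := min 1 (η / (8 * (C * M))) with hs₁
  have hs₁0 : 0 < s₁ := lt_min one_pos (by positivity)
  have hs₁1 : s₁ ≤ 1 := min_le_left _ _
  have hs₁2 : C * M * s₁ ≤ η / 8 := by
    calc C * M * s₁ ≤ C * M * (η / (8 * (C * M))) := by gcongr; exact min_le_right _ _
      _ = η / 8 := by field_simp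
  -- The four bounds serve, in this order: to keep e ≤ M and |s| ≤ 1; to solve for the area; to make
  -- |D| small; to make the quadratic cost small.
  set δ := min (1 / 2) (min (1 / (4 * (C * M))) (min (s₁ * η / 8) (η / (16 * (C * M))))) with hδ
  have hδ0 : 0 < δ := by
    refine lt_min (by norm_num) (lt_min (by positivity) (lt_min (by positivity) (by positivity)))
  have d1 : δ ≤ 1 / 2 := min_le_left _ _
  have d2 : δ ≤ 1 / (4 * (C * M)) := (min_le_right _ _).trans (min_le_left _ _)
  have d3 : δ ≤ s₁ * η / 8 :=
    (min_le_right _ _).trans ((min_le_right _ _).trans (min_le_left _ _))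
  have d4 : δ ≤ η / (16 * (C * M)) :=
    (min_le_right _ _).trans ((min_le_right _ _).trans (min_le_right _ _))
  refine ⟨δ, hδ0, fun e a l b he heδ hb => ?_⟩
  have he0 : 0 ≤ e := he.nonneg
  have heM : e ≤ M := by linarith [le_abs_self E₀]
  have hCe : C * e ≤ C * M := by gcongr
  obtain ⟨D, Q, hQ, hs⟩ := hvar e a l he
  -- Neither of the variations by s₁ and -s₁ can fall below E₀, while the curve is within δ of E₀.
  -- So the first variation D is small, although the curve need not be a critical point.
  have hD : s₁ * |D| ≤ δ + C * M * s₁ ^ 2 := by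
    have key : ∀ s : ℝ, |s| = s₁ → -(s * D) ≤ δ + C * M * s₁ ^ 2 := by
      intro s hss
      obtain ⟨e', l', he', hc'⟩ := hs s (hss.trans_le hs₁1)
      have h1 := hE _ _ _ hc'
      have h2 : C * s ^ 2 * e ≤ C * M * s₁ ^ 2 := by
        rw [← sq_abs s, hss]
        have := mul_le_mul_of_nonneg_right hCe (sq_nonneg s₁)
        linarith
      linarith
    rcases abs_cases D with ⟨h1, -⟩ | ⟨h1, -⟩ <;> rw [h1]
    · have := key (-s₁) (by rw [abs_neg, abs_of_pos hs₁0]); linarith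
    · have := key s₁ (abs_of_pos hs₁0); linarith
  have hD' : |D| ≤ η / 4 := by
    have : s₁ * |D| ≤ s₁ * (η / 4) := by
      have := mul_le_mul_of_nonneg_right hs₁2 hs₁0.le
      nlinarith
    exact le_of_mul_le_mul_left this hs₁0
  have hb1 : 4 * (C * M) * |b| ≤ 1 := by
    have := mul_le_mul_of_nonneg_left (hb.trans d2) (by positivity : 0 ≤ 4 * (C * M))
    rwa [mul_one_div, div_self (by positivity)] at this
  -- The equation s + Qs² = b has a solution with |s| ≤ 2|b|. The cost sD + Cs²e is then at most
  -- (η/2)|b| + (η/4)|b|.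
  obtain ⟨s, hsb, hsf⟩ := exists_root_of_near_id (f := fun s => s + Q * s ^ 2) (b := b)
    (by fun_prop) fun s hs => by
      rw [add_sub_cancel_left, abs_mul, abs_pow]
      calc |Q| * |s| ^ 2 ≤ (C * M) * (2 * |b|) ^ 2 := by
            gcongr; exact hQ.trans hCe
        _ = 4 * (C * M) * |b| * |b| := by ring
        _ ≤ 1 * |b| := by gcongr
        _ = |b| := one_mul _
  obtain ⟨e', l', he', hc'⟩ := hs s (by linarith)
  refine ⟨e', l', he'.trans ?_, by rwa [add_assoc, show s + Q * s ^ 2 = b from hsf] at hc'⟩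
  have h1 : s * D ≤ 2 * |b| * (η / 4) := by
    calc s * D ≤ |s| * |D| := by rw [← abs_mul]; exact le_abs_self _
      _ ≤ _ := by gcongr
  have h2 : C * s ^ 2 * e ≤ η / 4 * |b| := by
    have h3 : C * M * |b| ≤ η / 16 := by
      have := mul_le_mul_of_nonneg_left (hb.trans d4) hCM.le
      have h4 : C * M * (η / (16 * (C * M))) = η / 16 := by field_simp
      linarith
    calc C * s ^ 2 * e = C * e * |s| ^ 2 := by rw [sq_abs]; ring
      _ ≤ C * M * (2 * |b|) ^ 2 := by gcongr
      _ = 4 * (C * M * |b|) * |b| := by ring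
      _ ≤ 4 * (η / 16) * |b| := by gcongr
      _ = η / 4 * |b| := by ring
  have := mul_nonneg hη.le (abs_nonneg b)
  linarith

end Correction

/-- The part of the standing data which is symmetric under reversal of curves: the minimal energy
is `E₀`, the bounds `c`, `C` for `√W` hold at distance at most `r` of `pm`, and curves of energy
at most `E₀ + δ` can be corrected with cost factor `c / 2`. -/
structure Setup (W : Plane → ℝ) (pm pp : Plane) (E₀ c C r δ : ℝ) : Prop where
  cont : Continuous W
  c_pos : 0 < c
  C_pos : 0 < C
  r_pos : 0 < r
  δ_pos : 0 < δ
  lower : ∀ x, ‖x - pm‖ ≤ r → c * ‖x - pm‖ ≤ √(W x)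
  upper : ∀ x, ‖x - pm‖ ≤ r → √(W x) ≤ C * ‖x - pm‖
  minimal : ∀ e a l, HasCurve W pm pp e a l → E₀ ≤ e
  -- The factor `c / 2` is half the least price `c` per unit of area near the well given by
  -- `HasCurve.well_estimate`. The strict gap is what removes loops and bounds initial arcs.
  correct : ∀ e a l b, HasCurve W pm pp e a l → e ≤ E₀ + δ → |b| ≤ δ →
      ∃ e' l', e' ≤ e + c / 2 * |b| ∧ HasCurve W pm pp e' (a + b) l'

/-- Reversal of curves preserves energy and length and negates area, so facts about the final well
are instances of facts about the initial one. Here the correction factor is fixed as c/2. -/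
theorem DoubleWell.exists_setup {W : Plane → ℝ} {pm pp : Plane} (hW : DoubleWell W pm pp)
    {E₀ : ℝ} (hE : ∀ e a l, HasCurve W pm pp e a l → E₀ ≤ e) :
    ∃ c C r δ, Setup W pm pp E₀ c C r δ ∧ Setup W pp pm E₀ c C r δ := by
  obtain ⟨c, hc, C, hC, r, hr, h⟩ := hW.exists_bounds
  obtain ⟨δ, hδ, hcor⟩ := hW.exists_correction hE (half_pos hc)
  refine ⟨c, C, r, δ, ⟨hW.continuous, hc, hC, hr, hδ, fun x hx => (h pm (Or.inl rfl) x hx).1,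
    fun x hx => (h pm (Or.inl rfl) x hx).2, hE, hcor⟩,
    ⟨hW.continuous, hc, hC, hr, hδ, fun x hx => (h pp (Or.inr rfl) x hx).1,
    fun x hx => (h pp (Or.inr rfl) x hx).2, fun e a l he => hE _ _ _ he.symm,
    fun e a l b he he' hb => ?_⟩⟩
  obtain ⟨e', l', h1, h2⟩ := hcor e (-a) l (-b) he.symm he' (by rwa [abs_neg])
  exact ⟨e', l', by rwa [abs_neg] at h1, by simpa [add_comm] using h2.symm⟩

/-! ### Comparison arguments at the initial well -/

section Setup

variable {W : Plane → ℝ} {pm pp : Plane} {E₀ c C r δ : ℝ}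

/-- A loop at `pm` preceding a curve to `pp` can be removed with gain of energy. -/
theorem Setup.exists_lt_of_loop (h : Setup W pm pp E₀ c C r δ) {e₁ a₁ l₁ e₂ a₂ l₂ : ℝ}
    (h₁ : HasCurve W pm pm e₁ a₁ l₁) (h₂ : HasCurve W pm pp e₂ a₂ l₂) (hpos : 0 < e₁)
    (hle : e₁ + e₂ ≤ E₀ + δ) (hle' : e₁ + e₂ ≤ E₀ + c * δ) (hr : e₁ + e₂ < E₀ + c / 2 * r ^ 2) :
    ∃ e l, e < e₁ + e₂ ∧ HasCurve W pm pp e (a₁ + a₂) l := by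
  -- The remainder already joins the wells and costs at least E₀, so e₁ is at most the excess of the
  -- total over E₀. Hence the loop stays near the well, c|a₁| ≤ e₁, and adding a₁ to the remainder
  -- costs at most e₁/2.
  have hE := h.minimal _ _ _ h₂
  have hw := (h₁.well_estimate h.cont h.c_pos h.r_pos.le h.lower (by linarith)).2
  rw [sub_self, mul_zero, add_zero] at hw
  have hb : |a₁| ≤ δ := le_of_mul_le_mul_left (by linarith) h.c_pos
  obtain ⟨e, l, he, hc⟩ := h.correct e₂ a₂ l₂ a₁ h₂ (by linarith) hb
  exact ⟨e, l, by linarith, by rwa [add_comm]⟩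

/-- In a nearly minimizing curve, the initial part up to a point near `pm` is cheap. -/
theorem Setup.initial_cost (h : Setup W pm pp E₀ c C r δ) {x : Plane} {e₁ a₁ l₁ e₂ a₂ l₂ d : ℝ}
    (h₁ : HasCurve W pm x e₁ a₁ l₁) (h₂ : HasCurve W x pp e₂ a₂ l₂)
    (hx : ‖x - pm‖ ≤ r)
    (h3 : C * ‖x - pm‖ ^ 2 ≤ δ / 2) (h4 : C * ‖x - pm‖ ^ 2 ≤ c / 4 * r ^ 2)
    (h5 : C * ‖x - pm‖ ^ 2 ≤ c * δ / 4) (h6 : ‖x - pm‖ ^ 2 ≤ δ / 4)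
    (hle : e₁ + e₂ ≤ E₀ + δ / 2) (hle' : e₁ + e₂ ≤ E₀ + c * δ / 4)
    (hr : e₁ + e₂ < E₀ + c / 4 * r ^ 2)
    (hmin : ∀ e l, HasCurve W pm pp e (a₁ + a₂) l → e₁ + e₂ ≤ e + d) :
    e₁ ≤ (2 * C + c) * ‖x - pm‖ ^ 2 + 2 * d ∧
      c * |a₁ + pm 1 * (x 0 - pm 0)| ≤ e₁ := by
  -- The competitor replaces the initial arc by a segment and then restores the area. Since it too
  -- costs at least E₀ before the correction, e₁ is small enough for `HasCurve.well_estimate`.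
  obtain ⟨es, as, hs, hse, hsa⟩ := exists_segment_estimate h.C_pos.le
    (fun y hy => h.upper y (hy.trans hx)) h.cont
  have hE := h.minimal _ _ _ (hs.trans h.cont h₂)
  have he₁ := h₁.nonneg
  have hw := (h₁.well_estimate h.cont h.c_pos h.r_pos.le h.lower (by linarith)).2
  set k := pm 1 * (x 0 - pm 0)
  have hc := h.c_pos
  have hb : |a₁ - as| ≤ |a₁ + k| + ‖x - pm‖ ^ 2 := by
    have h7 : a₁ - as = (a₁ + k) - (as + k) := by ring
    rw [h7]
    exact (abs_sub _ _).trans (by gcongr)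
  have hb' : |a₁ - as| ≤ δ := by
    have : c * |a₁ + k| ≤ c * (δ / 2) := by linarith
    have := le_of_mul_le_mul_left this hc
    linarith [h.δ_pos]
  obtain ⟨e, l, he, hcur⟩ := h.correct _ _ _ (a₁ - as) (hs.trans h.cont h₂) (by linarith) hb'
  have := hmin e l (by convert hcur using 1; ring)
  refine ⟨?_, hw⟩
  -- The correction costs at most e₁/2 plus a multiple of |x - pm|², because c|a₁ + k| ≤ e₁. The
  -- term e₁/2 is absorbed on the left, which doubles the remaining constants.
  have h8 : c / 2 * |a₁ - as| ≤ c / 2 * (|a₁ + k| + ‖x - pm‖ ^ 2) := by gcongr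
  linarith

end Setup

/-! ### Nearly minimizing curves of bounded length -/

section Length

variable {W : Plane → ℝ} {pm pp : Plane} {E₀ c C r δ : ℝ}

/-- A curve too cheap to leave the ball around `pm` is still subject to the quadratic bound of
`HasCurve.well_estimate` at its endpoint `pp`. -/
theorem Setup.energy_lower_bound (h : Setup W pm pp E₀ c C r δ) (hne : pm ≠ pp) :
    ∃ κ > 0, ∀ e a l, HasCurve W pm pp e a l → κ ≤ e := by
  have hc := h.c_pos
  have hr := h.r_pos
  have hn : 0 < ‖pp - pm‖ := norm_pos_iff.2 (sub_ne_zero.2 hne.symm)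
  refine ⟨min (c / 2 * r ^ 2) (c / 2 * ‖pp - pm‖ ^ 2), by positivity, fun e a l he => ?_⟩
  by_contra! hlt
  have := (he.well_estimate h.cont hc hr.le h.lower (hlt.trans_le (min_le_left _ _))).1
  exact absurd (hlt.trans_le (min_le_right _ _)) (not_lt.2 this)

/-- A radius so small that segments within it are negligible. -/
theorem Setup.exists_radius (h : Setup W pm pp E₀ c C r δ) :
    ∃ ρ > 0, ρ ≤ r ∧ C * ρ ^ 2 ≤ δ / 2 ∧ C * ρ ^ 2 ≤ c / 4 * r ^ 2 ∧ C * ρ ^ 2 ≤ c * δ / 4 ∧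
      ρ ^ 2 ≤ δ / 4 := by
  have hc := h.c_pos
  have hr := h.r_pos
  have hδ := h.δ_pos
  have hC := h.C_pos
  have hcont : Tendsto (fun ρ : ℝ => C * ρ ^ 2) (𝓝[>] 0) (𝓝 0) := by
    have : Continuous fun ρ : ℝ => C * ρ ^ 2 := by fun_prop
    simpa using (this.tendsto 0).mono_left nhdsWithin_le_nhds
  have hcont' : Tendsto (fun ρ : ℝ => ρ ^ 2) (𝓝[>] 0) (𝓝 0) := by
    have : Continuous fun ρ : ℝ => ρ ^ 2 := by fun_prop
    simpa using (this.tendsto 0).mono_left nhdsWithin_le_nhds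
  have h0 : ∀ᶠ ρ : ℝ in 𝓝[>] 0, 0 < ρ := self_mem_nhdsWithin
  have h1 : ∀ᶠ ρ : ℝ in 𝓝[>] 0, ρ ≤ r :=
    nhdsWithin_le_nhds (ge_mem_nhds hr)
  have h2 := hcont.eventually (ge_mem_nhds (by positivity : 0 < δ / 2))
  have h3 := hcont.eventually (ge_mem_nhds (by positivity : 0 < c / 4 * r ^ 2))
  have h4 := hcont.eventually (ge_mem_nhds (by positivity : 0 < c * δ / 4))
  have h5 := hcont'.eventually (ge_mem_nhds (by positivity : 0 < δ / 4))
  obtain ⟨ρ, g0, g1, g2, g3, g4, g5⟩ :=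
    (h0.and (h1.and (h2.and (h3.and (h4.and h5))))).exists
  exact ⟨ρ, g0, g1, g2, g3, g4, g5⟩

/-- In a nearly minimizing curve, `√W` near `pm` is controlled by the energy already spent. -/
theorem Setup.sqrt_le (h : Setup W pm pp E₀ c C r δ) {ρ : ℝ} (hρr : ρ ≤ r)
    (h3 : C * ρ ^ 2 ≤ δ / 2) (h4 : C * ρ ^ 2 ≤ c / 4 * r ^ 2)
    (h5 : C * ρ ^ 2 ≤ c * δ / 4) (h6 : ρ ^ 2 ≤ δ / 4)
    {x : Plane} {e₁ a₁ l₁ e₂ a₂ l₂ d : ℝ}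
    (h₁ : HasCurve W pm x e₁ a₁ l₁) (h₂ : HasCurve W x pp e₂ a₂ l₂)
    (hx : ‖x - pm‖ ≤ ρ)
    (hle : e₁ + e₂ ≤ E₀ + δ / 2) (hle' : e₁ + e₂ ≤ E₀ + c * δ / 4)
    (hr : e₁ + e₂ < E₀ + c / 4 * r ^ 2)
    (hmin : ∀ e l, HasCurve W pm pp e (a₁ + a₂) l → e₁ + e₂ ≤ e + d) (hd : 4 * d ≤ e₁) :
    √e₁ ≤ √(4 * C + 2 * c) / c * √(W x) := by
  have hsq : ‖x - pm‖ ^ 2 ≤ ρ ^ 2 := pow_le_pow_left₀ (norm_nonneg _) hx 2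
  have hC := h.C_pos
  have hc := h.c_pos
  have hCsq : C * ‖x - pm‖ ^ 2 ≤ C * ρ ^ 2 := by gcongr
  have := (h.initial_cost h₁ h₂ (hx.trans hρr) (hCsq.trans h3) (hCsq.trans h4)
    (hCsq.trans h5) (hsq.trans h6) hle hle' hr hmin).1
  -- The lack of minimality enters as 2d, at most e₁/2 by `hd`, and is absorbed.
  have h7 : e₁ ≤ (4 * C + 2 * c) * ‖x - pm‖ ^ 2 := by linarith
  calc √e₁ ≤ √((4 * C + 2 * c) * ‖x - pm‖ ^ 2) := Real.sqrt_le_sqrt h7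
    _ = √(4 * C + 2 * c) / c * (c * ‖x - pm‖) := by
        rw [Real.sqrt_mul (by positivity), Real.sqrt_sq (norm_nonneg _)]
        field_simp
    _ ≤ _ := by gcongr; exact h.lower x (hx.trans hρr)

/-- With e(t) the energy spent, |γ'| = e'/√W. By `hb`, √W is at least one of m, √e/k, √(E - e)/k, so
|γ'| ≤ e'(1/m + k/√e + k/√(E - e)). The singularities of the right side are integrable in e, so its
primitive has bounded increment. -/
theorem integral_norm_deriv_le {γ : ℝ → Plane} {K : NNReal} (hγ : LipschitzWith K γ)
    (hW : Continuous W) {m k E τ τ' : ℝ} (hm : 0 < m) (hk : 0 ≤ k) (h0 : 0 ≤ τ) (h1 : τ ≤ τ')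
    (h2 : τ' ≤ 1) (hpos : 0 < ∫ s in (0 : ℝ)..τ, √(W (γ s)) * ‖deriv γ s‖)
    (hE : ∫ s in (0 : ℝ)..τ', √(W (γ s)) * ‖deriv γ s‖ < E)
    (hb : ∀ t ∈ Ioo τ τ', m ≤ √(W (γ t)) ∨
      √(∫ s in (0 : ℝ)..t, √(W (γ s)) * ‖deriv γ s‖) ≤ k * √(W (γ t)) ∨
      √(E - ∫ s in (0 : ℝ)..t, √(W (γ s)) * ‖deriv γ s‖) ≤ k * √(W (γ t))) :
    ∫ t in τ..τ', ‖deriv γ t‖ ≤ E / m + 4 * k * √E := by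
  set e : ℝ → ℝ := fun t => ∫ s in (0 : ℝ)..t, √(W (γ s)) * ‖deriv γ s‖ with he
  have hi : ∀ a b, IntervalIntegrable (fun s => √(W (γ s)) * ‖deriv γ s‖) volume a b :=
    lip_intervalIntegrable_length hγ hW
  have hmono : ∀ s t, s ≤ t → e s ≤ e t := fun s t hst => by
    rw [he, ← sub_nonneg]
    simp only
    rw [intervalIntegral.integral_interval_sub_left (hi 0 t) (hi 0 s)]
    exact intervalIntegral.integral_nonneg hst fun u _ => by positivity
  set g : ℝ → ℝ := fun t => e t / m + 2 * k * √(e t) - 2 * k * √(E - e t) with hg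
  have hgm : MonotoneOn g (uIcc τ τ') := by
    intro s _ t _ hst
    have h3 := hmono s t hst
    have h4 : √(e s) ≤ √(e t) := Real.sqrt_le_sqrt h3
    have h5 : √(E - e t) ≤ √(E - e s) := Real.sqrt_le_sqrt (by linarith)
    have h6 : e s / m ≤ e t / m := by gcongr
    have h7 := mul_le_mul_of_nonneg_left h4 hk
    have h8 := mul_le_mul_of_nonneg_left h5 hk
    simp only [hg]
    linarith
  have hae := (hi 0 1).ae_hasDerivAt_integral
  have hle : ∫ t in τ..τ', ‖deriv γ t‖ ≤ ∫ t in τ..τ', deriv g t := by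
    rw [intervalIntegral.integral_of_le h1, intervalIntegral.integral_of_le h1,
      integral_Ioc_eq_integral_Ioo, integral_Ioc_eq_integral_Ioo]
    refine setIntegral_mono_on_ae ?_ ?_ measurableSet_Ioo ?_
    · exact (lip_norm_deriv hγ τ τ').1.mono_set Ioo_subset_Ioc_self
    · exact hgm.intervalIntegrable_deriv.1.mono_set Ioo_subset_Ioc_self
    filter_upwards [hae] with t ht htm
    have hde : HasDerivAt e (√(W (γ t)) * ‖deriv γ t‖) t :=
      ht (by rw [uIcc_of_le zero_le_one]; exact ⟨h0.trans htm.1.le, htm.2.le.trans h2⟩) 0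
        (by simp)
    have p1 : 0 < e t := hpos.trans_le (hmono _ _ htm.1.le)
    have p2 : 0 < E - e t := sub_pos.2 ((hmono _ _ htm.2.le).trans_lt hE)
    have hdg : HasDerivAt g ((√(W (γ t)) * ‖deriv γ t‖) * (1 / m + k / √(e t)
        + k / √(E - e t))) t := by
      have := ((hde.div_const m).add ((hde.sqrt p1.ne').const_mul (2 * k))).sub
        (((hde.const_sub E).sqrt p2.ne').const_mul (2 * k))
      refine this.congr_deriv ?_
      field_simp
      ring
    rw [hdg.deriv]
    have hn := norm_nonneg (deriv γ t)
    have hF := Real.sqrt_nonneg (W (γ t))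
    have q1 : 0 < √(e t) := Real.sqrt_pos.2 p1
    have q2 : 0 < √(E - e t) := Real.sqrt_pos.2 p2
    have key : 1 ≤ √(W (γ t)) * (1 / m + k / √(e t) + k / √(E - e t)) := by
      have z1 : 0 ≤ √(W (γ t)) * (1 / m) := by positivity
      have z2 : 0 ≤ √(W (γ t)) * (k / √(e t)) := by positivity
      have z3 : 0 ≤ √(W (γ t)) * (k / √(E - e t)) := by positivity
      rw [mul_add, mul_add]
      rcases hb t htm with hh | hh | hh
      · have : 1 ≤ √(W (γ t)) * (1 / m) := by rw [mul_one_div, one_le_div hm]; exact hh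
        linarith
      · have : 1 ≤ √(W (γ t)) * (k / √(e t)) := by
          rw [← mul_div_assoc, one_le_div q1, mul_comm]; exact hh
        linarith
      · have : 1 ≤ √(W (γ t)) * (k / √(E - e t)) := by
          rw [← mul_div_assoc, one_le_div q2, mul_comm]; exact hh
        linarith
    nlinarith
  refine hle.trans ?_
  -- Only monotonicity of g is used: the integral of its derivative does not exceed its increment.
  have hint : ∫ t in τ..τ', deriv g t ≤ g τ' - g τ := by
    have hgg : g τ ≤ g τ' := hgm left_mem_uIcc right_mem_uIcc h1
    have := hgm.intervalIntegral_deriv_mem_uIcc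
    rw [uIcc_of_le (by linarith)] at this
    exact this.2
  refine hint.trans ?_
  have p1 := hpos.le
  have pE := p1.trans (hmono _ _ h1)
  have b1 : e τ' / m ≤ E / m := by gcongr
  have b2 : √(e τ') ≤ √E := Real.sqrt_le_sqrt hE.le
  have b3 : √(E - e τ) ≤ √E := Real.sqrt_le_sqrt (by simp only [he]; linarith)
  have b4 : 0 ≤ e τ / m := div_nonneg p1 hm.le
  have b5 : 0 ≤ k * √(e τ) := by positivity
  have b6 : 0 ≤ k * √(E - e τ') := by positivity
  have b7 := mul_le_mul_of_nonneg_left b2 hk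
  have b8 := mul_le_mul_of_nonneg_left b3 hk
  simp only [hg]
  linarith

/-- Replacing the initial part of a curve by a segment, when this part is cheap. -/
theorem Setup.replace_initial (h : Setup W pm pp E₀ c C r δ) {x : Plane} {e a l : ℝ}
    (h₁ : HasCurve W pm x e a l) (he : e < c / 2 * r ^ 2) :
    ∃ e' a' l', HasCurve W pm x e' a' l' ∧ l' ≤ r ∧ e' ≤ 2 * C / c * e ∧ |a' - a| ≤ 3 / c * e := by
  have hc := h.c_pos
  obtain ⟨h2, h3⟩ := h₁.well_estimate h.cont hc h.r_pos.le h.lower he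
  have h4 : ‖x - pm‖ ^ 2 ≤ 2 / c * e := by
    rw [div_mul_eq_mul_div, le_div_iff₀ hc]; linarith
  have hx : ‖x - pm‖ ≤ r := by
    refine le_of_sq_le_sq ?_ h.r_pos.le
    have : c / 2 * ‖x - pm‖ ^ 2 ≤ c / 2 * r ^ 2 := h2.trans he.le
    exact le_of_mul_le_mul_left this (by positivity)
  obtain ⟨es, as, hs, hse, hsa⟩ := exists_segment_estimate h.C_pos.le
    (fun y hy => h.upper y (hy.trans hx)) h.cont
  refine ⟨es, as, _, hs, hx, hse.trans ?_, ?_⟩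
  · calc C * ‖x - pm‖ ^ 2 ≤ C * (2 / c * e) := by gcongr; exact h.C_pos.le
      _ = 2 * C / c * e := by ring
  · have h5 : |a + pm 1 * (x 0 - pm 0)| ≤ 1 / c * e := by
      rw [div_mul_eq_mul_div, le_div_iff₀ hc]; linarith
    have h6 : as - a = (as + pm 1 * (x 0 - pm 0)) - (a + pm 1 * (x 0 - pm 0)) := by ring
    rw [h6]
    refine (abs_sub _ _).trans ?_
    have : 3 / c * e = 2 / c * e + 1 / c * e := by ring
    linarith

end Length

section BoundedLength

variable {W : Plane → ℝ} {pm pp : Plane} {E₀ c C r δ : ℝ}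

/-- Nearly minimizing curves for the constrained problem can be replaced by curves of bounded
length, with an error proportional to the lack of minimality. -/
theorem Setup.exists_bounded_length (S : Setup W pm pp E₀ c C r δ) (S' : Setup W pp pm E₀ c C r δ)
    (hne : pm ≠ pp)
    (hlow : ∀ ρ > 0, ∃ m > 0, ∀ x, ρ ≤ ‖x - pm‖ → ρ ≤ ‖x - pp‖ → m ≤ √(W x)) :
    ∃ κ > 0, ∃ L B d₀, 0 < d₀ ∧ ∀ A m, m ≤ E₀ + κ →
      (∀ e l, HasCurve W pm pp e A l → m ≤ e) →
      ∀ d, 0 < d → d ≤ d₀ → ∀ e l, HasCurve W pm pp e A l → e ≤ m + d →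
        ∃ e' a' l', HasCurve W pm pp e' a' l' ∧ l' ≤ L ∧ e' ≤ e + B * d ∧ |a' - A| ≤ B * d := by
  obtain ⟨E₁, hE₁, hE₁'⟩ := S.energy_lower_bound hne
  obtain ⟨ρ, hρ, hρr, q1, q2, q3, q4⟩ := S.exists_radius
  obtain ⟨m₁, hm₁, hm₁'⟩ := hlow ρ hρ
  have hc := S.c_pos
  have hC := S.C_pos
  have hr := S.r_pos
  have hδ := S.δ_pos
  set κ := min (δ / 4) (min (c * δ / 8) (c / 16 * r ^ 2)) with hκ
  have hκ0 : 0 < κ := by positivity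
  have k1 : κ ≤ δ / 4 := min_le_left _ _
  have k2 : κ ≤ c * δ / 8 := (min_le_right _ _).trans (min_le_left _ _)
  have k3 : κ ≤ c / 16 * r ^ 2 := (min_le_right _ _).trans (min_le_right _ _)
  set d₀ := min κ (min (E₁ / 16) (c / 16 * r ^ 2)) with hd₀
  have hd₀0 : 0 < d₀ := by positivity
  have z1 : d₀ ≤ κ := min_le_left _ _
  have z2 : d₀ ≤ E₁ / 16 := (min_le_right _ _).trans (min_le_left _ _)
  have z3 : d₀ ≤ c / 16 * r ^ 2 := (min_le_right _ _).trans (min_le_right _ _)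
  set k := √(4 * C + 2 * c) / c with hk
  have hk0 : 0 ≤ k := by positivity
  set M := |E₀| + 2 * κ with hM
  have hrr : 0 < c * r ^ 2 := by positivity
  -- The length is that of the middle piece plus two segments of length at most r. In the error
  -- constant, 16C/c is twice 2C/c · 4 for the energies of the segments, and 24/c is twice 3/c · 4
  -- for their areas.
  refine ⟨κ, hκ0, M / m₁ + 4 * k * √M + 2 * r, 16 * C / c + 24 / c, d₀, hd₀0, ?_⟩
  intro A m hmE hmin d hd hdd e l he hem
  have heE : e ≤ E₀ + 2 * κ := by linarith
  have heM : e ≤ M := by linarith [le_abs_self E₀]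
  have hed : 8 * d < e := by have := hE₁' e A l he; linarith
  have g1 : e ≤ E₀ + δ / 2 := by linarith
  have g2 : e ≤ E₀ + c * δ / 4 := by linarith
  have g3 : e < E₀ + c / 4 * r ^ 2 := by linarith
  obtain ⟨γ, ⟨K, hγ⟩, h0, h1, hγe, hγa, hγl⟩ := he
  set f : ℝ → ℝ := fun s => √(W (γ s)) * ‖deriv γ s‖ with hf
  set F : ℝ → ℝ := fun t => ∫ s in (0 : ℝ)..t, f s with hF
  have hi : ∀ a b, IntervalIntegrable f volume a b := lip_intervalIntegrable_length hγ S.cont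
  have hia : ∀ a b, IntervalIntegrable (fun t => γ t 1 * deriv γ t 0) volume a b :=
    lip_intervalIntegrable_area hγ
  have hF1 : F 1 = e := hγe
  have hF0 : F 0 = 0 := intervalIntegral.integral_same
  have hFc : ContinuousOn F (Icc 0 1) := (intervalIntegral.continuous_primitive hi 0).continuousOn
  have hFs : ∀ s t, F t - F s = ∫ u in s..t, f u := fun s t => by
    rw [hF]
    simp only
    rw [intervalIntegral.integral_interval_sub_left (hi 0 t) (hi 0 s)]
  have hFm : ∀ s t, s ≤ t → F s ≤ F t := fun s t hst => by
    rw [← sub_nonneg, hFs]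
    exact intervalIntegral.integral_nonneg hst fun u _ => by simp only [hf]; positivity
  -- the pieces of the curve before and after a given time
  have hbef : ∀ t ∈ Icc (0 : ℝ) 1, HasCurve W pm (γ t) (F t)
      (-∫ τ in (0 : ℝ)..t, γ τ 1 * deriv γ τ 0) (∫ τ in (0 : ℝ)..t, ‖deriv γ τ‖) := fun t ht => by
    have := hasCurve_sub (W := W) hγ 0 t ht.1
    rwa [h0] at this
  have haft : ∀ t ∈ Icc (0 : ℝ) 1, HasCurve W (γ t) pp (e - F t)
      (-∫ τ in t..1, γ τ 1 * deriv γ τ 0) (∫ τ in t..1, ‖deriv γ τ‖) := fun t ht => by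
    have := hasCurve_sub (W := W) hγ t 1 ht.2
    rwa [h1, ← hFs, hF1] at this
  have hsum : ∀ t, (-∫ τ in (0 : ℝ)..t, γ τ 1 * deriv γ τ 0)
      + (-∫ τ in t..1, γ τ 1 * deriv γ τ 0) = A := fun t => by
    rw [← hγa, area, ← intervalIntegral.integral_add_adjacent_intervals (hia 0 t) (hia t 1)]
    ring
  -- The curve is cut where energy 4d has been spent and where 4d is still to be spent. In between,
  -- `Setup.sqrt_le` applies at either well and bounds the length; the two ends may be arbitrarily
  -- long, but they are cheap and are replaced by segments.
  obtain ⟨τ, hτ, hFτ⟩ := intermediate_value_Icc zero_le_one hFc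
    (show 4 * d ∈ Icc (F 0) (F 1) by rw [hF0, hF1]; constructor <;> linarith)
  obtain ⟨τ', hτ', hFτ'⟩ := intermediate_value_Icc zero_le_one hFc
    (show e - 4 * d ∈ Icc (F 0) (F 1) by rw [hF0, hF1]; constructor <;> linarith)
  have hττ' : τ ≤ τ' := by
    by_contra! hlt
    have := hFm τ' τ hlt.le
    linarith
  have hlen : ∫ t in τ..τ', ‖deriv γ t‖ ≤ e / m₁ + 4 * k * √e := by
    refine integral_norm_deriv_le hγ S.cont hm₁ hk0 hτ.1 hττ' hτ'.2 ?_ ?_ fun t ht => ?_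
    · change 0 < F τ; linarith
    · change F τ' < e; linarith
    have htI : t ∈ Icc (0 : ℝ) 1 := ⟨hτ.1.trans ht.1.le, ht.2.le.trans hτ'.2⟩
    have b1 : 4 * d ≤ F t := hFτ ▸ hFm τ t ht.1.le
    have b2 : 4 * d ≤ e - F t := by have := hFm t τ' ht.2.le; linarith
    by_cases hx1 : ‖γ t - pm‖ ≤ ρ
    · right; left
      refine S.sqrt_le hρr q1 q2 q3 q4 (hbef t htI) (haft t htI) hx1
        (by linarith) (by linarith) (by linarith) (fun e' l' he' => ?_) b1
      rw [hsum] at he'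
      have := hmin _ _ he'
      linarith
    by_cases hx2 : ‖γ t - pp‖ ≤ ρ
    · right; right
      refine S'.sqrt_le hρr q1 q2 q3 q4 (haft t htI).symm (hbef t htI).symm hx2
        (by linarith) (by linarith) (by linarith) (fun e' l' he' => ?_) b2
      have h3 := he'.symm
      rw [← neg_add, neg_neg, add_comm, hsum] at h3
      have := hmin _ _ h3
      linarith
    · left
      exact hm₁' _ (not_le.1 hx1).le (not_le.1 hx2).le
  have hr4 : 4 * d < c / 2 * r ^ 2 := by linarith
  obtain ⟨e₁, a₁, l₁, w1, w2, w3, w4⟩ := S.replace_initial (hbef τ hτ) (by rwa [hFτ])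
  obtain ⟨e₂, a₂, l₂, v1, v2, v3, v4⟩ := S'.replace_initial (haft τ' hτ').symm
    (by rw [hFτ']; linarith)
  refine ⟨_, _, _, (w1.trans S.cont (hasCurve_sub hγ τ τ' hττ')).trans S.cont v1.symm, ?_, ?_, ?_⟩
  · have b1 : e / m₁ ≤ M / m₁ := by gcongr
    have b2 : 4 * k * √e ≤ 4 * k * √M := by gcongr
    linarith
  · change e₁ + (∫ u in τ..τ', f u) + e₂ ≤ _
    rw [← hFs, hFτ, hFτ']
    rw [hFτ] at w3
    rw [hFτ'] at v3
    have : 0 < 24 / c * d := by positivity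
    have e1 : 2 * C / c * (4 * d) + 2 * C / c * (e - (e - 4 * d)) = 16 * C / c * d := by ring
    linarith
  · have e0 : a₁ + -(∫ u in τ..τ', γ u 1 * deriv γ u 0) + -a₂ - A
        = (a₁ - -(∫ u in (0 : ℝ)..τ, γ u 1 * deriv γ u 0))
          - (a₂ - -(-(∫ u in τ'..1, γ u 1 * deriv γ u 0))) := by
      have h3 := intervalIntegral.integral_add_adjacent_intervals (hia 0 τ) (hia τ τ')
      have h4 := hsum τ'
      rw [← h3] at h4
      linarith
    rw [e0]
    refine (abs_sub _ _).trans ((add_le_add w4 v4).trans ?_)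
    rw [hFτ, hFτ']
    have : 0 ≤ 16 * C / c * d := by positivity
    have e1 : 3 / c * (4 * d) + 3 / c * (e - (e - 4 * d)) = 24 / c * d := by ring
    linarith

end BoundedLength

/-! ### Parametrization with constant speed -/

/-- A monotone primitive on `[0,1]` transports the measure with the corresponding density to
Lebesgue measure. -/
theorem map_primitive_withDensity {ρ s : ℝ → ℝ} (hρ0 : ∀ t, 0 ≤ ρ t)
    (hi : ∀ a b, IntervalIntegrable ρ volume a b) (hs : ∀ t, s t = ∫ u in (0 : ℝ)..t, ρ u)
    (h1 : s 1 = 1) :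
    ((volume.restrict (Ioc (0 : ℝ) 1)).withDensity fun t => ENNReal.ofReal (ρ t)).map s
      = volume.restrict (Ioc (0 : ℝ) 1) := by
  have hsc : Continuous s := by
    rw [show s = fun t => ∫ u in (0 : ℝ)..t, ρ u from funext hs]
    exact intervalIntegral.continuous_primitive hi 0
  have hs0 : s 0 = 0 := by rw [hs, intervalIntegral.integral_same]
  have hsm : Monotone s := fun a b hab => by
    rw [← sub_nonneg, hs, hs, intervalIntegral.integral_interval_sub_left (hi 0 b) (hi 0 a)]
    exact intervalIntegral.integral_nonneg hab fun u _ => hρ0 u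
  have hlin : ∀ T, 0 ≤ T → ∫⁻ t in Ioc 0 T, ENNReal.ofReal (ρ t) = ENNReal.ofReal (s T) :=
    fun T hT => by
    rw [hs, intervalIntegral.integral_of_le hT,
      ofReal_integral_eq_lintegral_ofReal (hi 0 T).1 (Eventually.of_forall fun t => hρ0 t)]
  have : IsFiniteMeasure ((volume.restrict (Ioc (0 : ℝ) 1)).withDensity
      fun t => ENNReal.ofReal (ρ t)) :=
    isFiniteMeasure_withDensity (by rw [hlin 1 zero_le_one]; exact ENNReal.ofReal_ne_top)
  refine Measure.ext_of_Iic _ _ fun a => ?_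
  rw [Measure.map_apply hsc.measurable measurableSet_Iic,
    withDensity_apply _ (hsc.measurable measurableSet_Iic),
    Measure.restrict_restrict (hsc.measurable measurableSet_Iic),
    Measure.restrict_apply measurableSet_Iic]
  rcases lt_or_ge a 0 with ha | ha
  · have e1 : s ⁻¹' Iic a ∩ Ioc 0 1 = ∅ := by
      ext t
      simp only [mem_inter_iff, mem_preimage, mem_Iic, mem_Ioc, mem_empty_iff_false, iff_false]
      rintro ⟨h2, h3, -⟩
      have := hsm h3.le
      linarith
    have e2 : Iic a ∩ Ioc (0 : ℝ) 1 = ∅ := by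
      ext t
      simp only [mem_inter_iff, mem_Iic, mem_Ioc, mem_empty_iff_false, iff_false]
      rintro ⟨h2, h3, -⟩
      linarith
    rw [e1, e2]
    simp
  -- Since s may be constant on intervals, the last time T with s ≤ a is taken; then the preimage is
  -- exactly `Ioc 0 T`.
  · have hcomp : IsCompact (Icc (0 : ℝ) 1 ∩ s ⁻¹' Iic a) :=
      isCompact_Icc.inter_right (isClosed_Iic.preimage hsc)
    obtain ⟨T, hT, hTmax⟩ := hcomp.exists_isGreatest
      ⟨0, ⟨le_rfl, zero_le_one⟩, by simpa [hs0] using ha⟩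
    have hsT : s T = min a 1 := by
      refine le_antisymm (le_min hT.2 (h1 ▸ hsm hT.1.2)) ?_
      obtain ⟨t, ht, hst⟩ := intermediate_value_Icc zero_le_one hsc.continuousOn
        (show min a 1 ∈ Icc (s 0) (s 1) by
          rw [hs0, h1]; exact ⟨le_min ha zero_le_one, min_le_right _ _⟩)
      rw [← hst]
      exact hsm (hTmax ⟨ht, by rw [mem_preimage, mem_Iic, hst]; exact min_le_left _ _⟩)
    have e1 : s ⁻¹' Iic a ∩ Ioc 0 1 = Ioc 0 T := by
      ext t
      simp only [mem_inter_iff, mem_preimage, mem_Iic, mem_Ioc]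
      constructor
      · rintro ⟨h2, h3, h4⟩
        exact ⟨h3, hTmax ⟨⟨h3.le, h4⟩, h2⟩⟩
      · rintro ⟨h2, h3⟩
        exact ⟨(hsm h3).trans hT.2, h2, h3.trans hT.1.2⟩
    have e2 : Iic a ∩ Ioc (0 : ℝ) 1 = Ioc 0 (min a 1) := by
      ext t
      simp only [mem_inter_iff, mem_Iic, mem_Ioc, le_min_iff]
      tauto
    rw [e1, hlin T hT.1.1, e2, hsT, Real.volume_Ioc, sub_zero]

/-- Parametrization of a curve with constant speed. -/
theorem HasCurve.exists_constantSpeed {W : Plane → ℝ} (hW : Continuous W) {p q : Plane}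
    {e a l : ℝ} (h : HasCurve W p q e a l) (hl : 0 < l) :
    ∃ γ : ℝ → Plane, LipschitzWith l.toNNReal γ ∧ γ 0 = p ∧ γ 1 = q ∧ degLength W γ = e ∧
      area γ = a ∧ arclength γ = l ∧
      ∀ᵐ t ∂(volume.restrict (Icc (0 : ℝ) 1)), ‖deriv γ t‖ = l := by
  obtain ⟨η, ⟨K, hη⟩, h0, h1, hηe, hηa, hηl⟩ := h
  set ρ : ℝ → ℝ := fun t => ‖deriv η t‖ / l with hρ
  have hρm : Measurable ρ := (measurable_deriv_plane η).norm.div_const l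
  have hρ0 : ∀ t, 0 ≤ ρ t := fun t => by positivity
  have hi : ∀ a b, IntervalIntegrable ρ volume a b := fun a b => (lip_norm_deriv hη a b).div_const l
  set s : ℝ → ℝ := fun t => ∫ u in (0 : ℝ)..t, ρ u with hs
  have hsc : Continuous s := intervalIntegral.continuous_primitive hi 0
  have hs0 : s 0 = 0 := intervalIntegral.integral_same
  have hs1 : s 1 = 1 := by
    simp only [hs, hρ]
    rw [intervalIntegral.integral_div]
    exact (congrArg (· / l) hηl).trans (div_self hl.ne')
  have hsub : ∀ u v, s v - s u = ∫ t in u..v, ρ t := fun u v =>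
    intervalIntegral.integral_interval_sub_left (hi 0 v) (hi 0 u)
  have hsm : Monotone s := fun u v huv => by
    rw [← sub_nonneg, hsub]
    exact intervalIntegral.integral_nonneg huv fun t _ => hρ0 t
  -- The curve is a Lipschitz function of its normalized arclength s. So any right inverse of s
  -- defines the same new curve, even though s need not be injective.
  have hdist : ∀ u v, dist (η u) (η v) ≤ l * dist (s u) (s v) := by
    have key : ∀ u v, u ≤ v → dist (η u) (η v) ≤ l * dist (s u) (s v) := fun u v huv => by
      rw [dist_comm, dist_eq_norm, dist_comm, Real.dist_eq, abs_of_nonneg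
        (sub_nonneg.2 (hsm huv)), hsub, ← intervalIntegral.integral_const_mul]
      refine (lip_dist_le_integral hη huv).trans_eq ?_
      refine intervalIntegral.integral_congr fun t _ => ?_
      simp only [hρ]
      field_simp
    intro u v
    rcases le_total u v with huv | huv
    · exact key u v huv
    · rw [dist_comm, dist_comm (s u)]; exact key v u huv
  have hsurj : ∀ x ∈ Icc (0 : ℝ) 1, ∃ t ∈ Icc (0 : ℝ) 1, s t = x := fun x hx =>
    intermediate_value_Icc zero_le_one hsc.continuousOn (by rwa [hs0, hs1])
  choose! σ hσ hsσ using hsurj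
  have hlip : LipschitzOnWith l.toNNReal (fun x => η (σ x)) (Icc 0 1) :=
    LipschitzOnWith.of_dist_le_mul fun x hx y hy => by
      have := hdist (σ x) (σ y)
      rwa [hsσ x hx, hsσ y hy, ← Real.coe_toNNReal l hl.le] at this
  obtain ⟨γ, hγ, heq⟩ := exists_lipschitz_extension hlip
  have hmaps : ∀ t ∈ Icc (0 : ℝ) 1, s t ∈ Icc (0 : ℝ) 1 := fun t ht =>
    ⟨hs0 ▸ hsm ht.1, hs1 ▸ hsm ht.2⟩
  have hγs : ∀ t ∈ Icc (0 : ℝ) 1, γ (s t) = η t := fun t ht => by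
    rw [← heq (hmaps t ht), ← dist_le_zero]
    have := hdist (σ (s t)) t
    rwa [hsσ _ (hmaps t ht), dist_self, mul_zero] at this
  have hmap := map_primitive_withDensity hρ0 hi (fun _ => rfl) hs1
  have hρe : Measurable fun t => ENNReal.ofReal (ρ t) := hρm.ennreal_ofReal
  -- Pulled back along s, null sets are null only for the measure ρ dt; hence the restriction to ρ ≠
  -- 0. Where ρ = 0 the curve is stationary, and the chain rule below holds trivially.
  have hpull : ∀ {P : ℝ → Prop}, (∀ᵐ x ∂(volume.restrict (Ioc (0 : ℝ) 1)), P x) →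
      ∀ᵐ t ∂(volume.restrict (Ioc (0 : ℝ) 1)), ρ t ≠ 0 → P (s t) := fun {P} hP => by
    rw [← hmap] at hP
    have := ae_of_ae_map hsc.aemeasurable hP
    rw [ae_withDensity_iff hρe] at this
    filter_upwards [this] with t ht hne
    exact ht (ENNReal.ofReal_pos.2 ((hρ0 t).lt_of_ne hne.symm)).ne'
  -- the chain rule
  have hchain : ∀ᵐ t ∂(volume.restrict (Ioc (0 : ℝ) 1)), deriv η t = ρ t • deriv γ (s t) := by
    have e1 := hpull (ae_restrict_of_ae hγ.ae_differentiableAt_real)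
    have e2 : ∀ᵐ t ∂(volume.restrict (Ioc (0 : ℝ) 1)), HasDerivAt s (ρ t) t := by
      rw [ae_restrict_iff' measurableSet_Ioc]
      filter_upwards [(hi 0 1).ae_hasDerivAt_integral] with t ht htm
      exact ht (by rw [uIcc_of_le zero_le_one]; exact Ioc_subset_Icc_self htm) 0 (by simp)
    have e3 : ∀ᵐ t ∂(volume.restrict (Ioc (0 : ℝ) 1)), t ∈ Ioo (0 : ℝ) 1 := by
      rw [← restrict_Ioo_eq_restrict_Ioc]
      exact ae_restrict_mem measurableSet_Ioo
    filter_upwards [e1, e2, e3] with t h2 h3 h4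
    by_cases h5 : ρ t = 0
    · have : ‖deriv η t‖ = 0 := by
        simpa [hρ, hl.ne'] using h5
      rw [h5, zero_smul, norm_eq_zero.1 this]
    · have h6 : HasDerivAt (γ ∘ s) (ρ t • deriv γ (s t)) t := (h2 h5).hasDerivAt.scomp t h3
      have h7 : η =ᶠ[𝓝 t] γ ∘ s := by
        filter_upwards [Ioo_mem_nhds h4.1 h4.2] with u hu
        exact (hγs u (Ioo_subset_Icc_self hu)).symm
      exact (h6.congr_of_eventuallyEq h7).deriv
  have hint : ∀ g : ℝ → ℝ, Measurable g →
      ∫ x in (0 : ℝ)..1, g x = ∫ t in (0 : ℝ)..1, ρ t * g (s t) := fun g hg => by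
    rw [intervalIntegral.integral_of_le zero_le_one, intervalIntegral.integral_of_le zero_le_one]
    conv_lhs => rw [← hmap]
    rw [integral_map hsc.aemeasurable hg.aestronglyMeasurable,
      integral_withDensity_eq_integral_toReal_smul hρe
        (Eventually.of_forall fun _ => ENNReal.ofReal_lt_top)]
    simp only [ENNReal.toReal_ofReal (hρ0 _), smul_eq_mul]
  have hfin : ∀ᵐ x ∂(volume.restrict (Ioc (0 : ℝ) 1)), ‖deriv γ x‖ = l := by
    rw [← hmap]
    have hmeas : MeasurableSet {x | ‖deriv γ x‖ = l} :=
      measurableSet_eq_fun (measurable_deriv_plane γ).norm measurable_const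
    rw [ae_map_iff hsc.aemeasurable hmeas, ae_withDensity_iff hρe]
    filter_upwards [hchain] with t ht hne
    have hpos : 0 < ρ t := by
      by_contra hcon
      exact hne (ENNReal.ofReal_of_nonpos (not_lt.1 hcon))
    have h2 : ‖deriv η t‖ = ρ t * ‖deriv γ (s t)‖ := by
      rw [ht, norm_smul, Real.norm_of_nonneg hpos.le]
    have h3 : ‖deriv η t‖ = ρ t * l := by simp only [hρ]; field_simp
    exact mul_left_cancel₀ hpos.ne' (h2.symm.trans h3)
  have hcongr : ∀ {f g : ℝ → ℝ}, (∀ᵐ t ∂(volume.restrict (Ioc (0 : ℝ) 1)), t ∈ Ioc (0 : ℝ) 1 →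
      f t = g t) → ∫ t in (0 : ℝ)..1, f t = ∫ t in (0 : ℝ)..1, g t := fun {f g} hfg => by
    rw [intervalIntegral.integral_of_le zero_le_one, intervalIntegral.integral_of_le zero_le_one]
    refine integral_congr_ae ?_
    filter_upwards [hfg, ae_restrict_mem measurableSet_Ioc] with t h2 h3 using h2 h3
  refine ⟨γ, hγ, ?_, ?_, ?_, ?_, ?_, ?_⟩
  · rw [← hs0, hγs 0 (by simp), h0]
  · rw [← hs1, hγs 1 (by simp), h1]
  · rw [← hηe, degLength, hint (fun x => √(W (γ x)) * ‖deriv γ x‖)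
      ((hW.comp hγ.continuous).sqrt.measurable.mul (measurable_deriv_plane γ).norm)]
    refine hcongr ?_
    filter_upwards [hchain] with t ht htm
    rw [ht, norm_smul, Real.norm_of_nonneg (hρ0 t), hγs t (Ioc_subset_Icc_self htm)]
    ring
  · rw [← hηa, area, hint (fun x => γ x 1 * deriv γ x 0)
      ((continuous_coord hγ.continuous 1).measurable.mul
        ((EuclideanSpace.proj (𝕜 := ℝ) 0).continuous.measurable.comp (measurable_deriv_plane γ)))]
    congr 1
    refine hcongr ?_
    filter_upwards [hchain] with t ht htm
    rw [ht, PiLp.smul_apply, smul_eq_mul, hγs t (Ioc_subset_Icc_self htm)]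
    ring
  · rw [arclength]
    have : ∫ t in (0 : ℝ)..1, ‖deriv γ t‖ = ∫ _ in (0 : ℝ)..1, l :=
      hcongr (hfin.mono fun t ht _ => ht)
    rw [this]
    simp
  · rwa [← Measure.restrict_congr_set Ioc_ae_eq_Icc]

/-! ### Compactness -/

/-- Density of continuous functions in L¹ combined with Weierstrass approximation. Polynomials are
convenient because they can be integrated by parts. -/
theorem exists_polynomial_integral_sub_le {ψ : ℝ → ℝ} (hψ : IntervalIntegrable ψ volume 0 1)
    {ε : ℝ} (hε : 0 < ε) :
    ∃ P : Polynomial ℝ, ∫ t in (0 : ℝ)..1, ‖ψ t - P.eval t‖ ≤ ε := by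
  obtain ⟨g, -, hg, hgc, hgi⟩ := hψ.1.exists_hasCompactSupport_integral_sub_le (half_pos hε)
  obtain ⟨P, hP⟩ := exists_polynomial_near_of_continuousOn 0 1 g hgc.continuousOn _ (half_pos hε)
  have hPc : Continuous fun t => P.eval t := P.continuous
  refine ⟨P, ?_⟩
  have i1 : IntervalIntegrable (fun t => ‖ψ t - g t‖) volume 0 1 :=
    (hψ.sub (hgc.intervalIntegrable 0 1)).norm
  calc ∫ t in (0 : ℝ)..1, ‖ψ t - P.eval t‖
      ≤ ∫ t in (0 : ℝ)..1, (‖ψ t - g t‖ + ε / 2) := by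
        refine intervalIntegral.integral_mono_on zero_le_one
          (hψ.sub (hPc.intervalIntegrable 0 1)).norm (i1.add intervalIntegrable_const)
          fun t ht => ?_
        have h1 : ψ t - P.eval t = (ψ t - g t) - (P.eval t - g t) := by ring
        rw [h1]
        exact (norm_sub_le _ _).trans (by gcongr; exact (hP t ht).le)
    _ = (∫ t in (0 : ℝ)..1, ‖ψ t - g t‖) + ε / 2 := by
        rw [intervalIntegral.integral_add i1 intervalIntegrable_const]
        simp
    _ ≤ ε / 2 + ε / 2 := by
        gcongr
        rwa [intervalIntegral.integral_of_le zero_le_one]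
    _ = ε := add_halves ε

/-- Derivatives of uniformly Lipschitz functions converging uniformly to zero converge weakly to
zero. -/
theorem tendsto_integral_mul_deriv {ι : Type*} {F : Filter ι} {w : ι → ℝ → ℝ} {K : NNReal}
    (hw : ∀ n, LipschitzWith K (w n))
    (h0 : ∀ ε > 0, ∀ᶠ n in F, ∀ t ∈ Icc (0 : ℝ) 1, |w n t| ≤ ε)
    {ψ : ℝ → ℝ} (hψ : IntervalIntegrable ψ volume 0 1) :
    Tendsto (fun n => ∫ t in (0 : ℝ)..1, ψ t * deriv (w n) t) F (𝓝 0) := by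
  rw [Metric.tendsto_nhds]
  intro ε hε
  set δ := ε / (2 * (K + 1)) with hδ
  have hδ0 : 0 < δ := by positivity
  obtain ⟨P, hP⟩ := exists_polynomial_integral_sub_le hψ hδ0
  have hPc : Continuous fun t => P.eval t := P.continuous
  set Q := ‖P.eval 1‖ + ‖P.eval 0‖ + ∫ t in (0 : ℝ)..1, ‖(Polynomial.derivative P).eval t‖ with hQ
  have hQ0 : 0 ≤ Q := by
    have : 0 ≤ ∫ t in (0 : ℝ)..1, ‖(Polynomial.derivative P).eval t‖ :=
      intervalIntegral.integral_nonneg zero_le_one fun t _ => norm_nonneg _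
    positivity
  have hPd : Continuous fun t => (Polynomial.derivative P).eval t :=
    (Polynomial.derivative P).continuous
  filter_upwards [h0 (ε / (4 * (Q + 1))) (by positivity)] with n hn
  rw [dist_zero_right]
  have hwm : AEStronglyMeasurable (deriv (w n)) volume := (measurable_deriv _).aestronglyMeasurable
  have hwb : ∀ t, ‖deriv (w n) t‖ ≤ K := fun t => norm_deriv_le_of_lipschitz (hw n)
  have hwi : IntervalIntegrable (deriv (w n)) volume 0 1 :=
    intervalIntegrable_of_bound hwm fun t _ => hwb t
  have j2 : IntervalIntegrable (fun t => P.eval t * deriv (w n) t) volume 0 1 :=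
    hwi.continuousOn_mul hPc.continuousOn
  have hprod : ∀ {f : ℝ → ℝ}, IntervalIntegrable f volume 0 1 →
      IntervalIntegrable (fun t => f t * deriv (w n) t) volume 0 1 := fun {f} hf =>
    ⟨hf.1.mul_bdd (c := K) hwm.restrict (Eventually.of_forall hwb),
      hf.2.mul_bdd (c := K) hwm.restrict (Eventually.of_forall hwb)⟩
  have j1 : IntervalIntegrable (fun t => (ψ t - P.eval t) * deriv (w n) t) volume 0 1 :=
    hprod (hψ.sub (hPc.intervalIntegrable 0 1))
  -- The first part is small by the uniform bound K on the derivatives, the second after integration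
  -- by parts by the uniform smallness of `w n`.
  have e1 : ∫ t in (0 : ℝ)..1, ψ t * deriv (w n) t
      = (∫ t in (0 : ℝ)..1, (ψ t - P.eval t) * deriv (w n) t)
        + ∫ t in (0 : ℝ)..1, P.eval t * deriv (w n) t := by
    rw [← intervalIntegral.integral_add j1 j2]
    exact intervalIntegral.integral_congr fun t _ => by ring
  have b1 : ‖∫ t in (0 : ℝ)..1, (ψ t - P.eval t) * deriv (w n) t‖ ≤ K * δ := by
    refine (intervalIntegral.norm_integral_le_of_norm_le zero_le_one
      (g := fun t => K * ‖ψ t - P.eval t‖) (Eventually.of_forall fun t _ => ?_)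
      ((hψ.sub (hPc.intervalIntegrable 0 1)).norm.const_mul _)).trans ?_
    · rw [norm_mul, mul_comm]
      exact mul_le_mul_of_nonneg_right (hwb t) (norm_nonneg _)
    · rw [intervalIntegral.integral_const_mul]
      gcongr
  have hPac : AbsolutelyContinuousOnInterval (fun t => P.eval t) 0 1 :=
    ((Polynomial.contDiff_aeval P 1).contDiffOn).absolutelyContinuousOnInterval
  have hb0 := hn 0 (by simp)
  have hb1 := hn 1 (by simp)
  set τ := ε / (4 * (Q + 1)) with hτ
  have b2 : ‖∫ t in (0 : ℝ)..1, P.eval t * deriv (w n) t‖ ≤ Q * τ := by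
    rw [hPac.integral_mul_deriv_eq_deriv_mul ((hw n).ac 0 1)]
    have b3 : ‖∫ t in (0 : ℝ)..1, deriv (fun t => P.eval t) t * w n t‖
        ≤ (∫ t in (0 : ℝ)..1, ‖(Polynomial.derivative P).eval t‖) * τ := by
      rw [← intervalIntegral.integral_mul_const]
      refine intervalIntegral.norm_integral_le_of_norm_le zero_le_one
        (Eventually.of_forall fun t ht => ?_) ((hPd.norm.intervalIntegrable _ _).mul_const _)
      rw [Polynomial.deriv, norm_mul]
      gcongr
      exact hn t (Ioc_subset_Icc_self ht)
    refine (norm_sub_le _ _).trans ?_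
    have b4 : ‖P.eval 1 * w n 1 - P.eval 0 * w n 0‖ ≤ ‖P.eval 1‖ * τ + ‖P.eval 0‖ * τ := by
      refine (norm_sub_le _ _).trans ?_
      rw [norm_mul, norm_mul]
      gcongr <;> assumption
    rw [hQ]
    linarith
  have c1 : K * δ ≤ ε / 2 := by
    rw [hδ, mul_div_assoc', div_le_div_iff₀ (by positivity) two_pos]
    nlinarith
  have c2 : Q * τ < ε / 2 := by
    rw [hτ, mul_div_assoc', div_lt_div_iff₀ (by positivity) two_pos]
    nlinarith
  rw [e1]
  exact (norm_add_le _ _).trans_lt (by linarith)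

/-- Uniformly Lipschitz functions that converge pointwise converge uniformly on `[0,1]`. -/
theorem eventually_forall_norm_sub_le {ι : Type*} {F : Filter ι} {γ : ι → ℝ → Plane}
    {g : ℝ → Plane} {K : NNReal} (hγ : ∀ n, LipschitzWith K (γ n)) (hg : LipschitzWith K g)
    (h : ∀ t, Tendsto (fun n => γ n t) F (𝓝 (g t))) {ε : ℝ} (hε : 0 < ε) :
    ∀ᶠ n in F, ∀ t ∈ Icc (0 : ℝ) 1, ‖γ n t - g t‖ ≤ ε := by
  obtain ⟨s, -, hs, hcov⟩ := (isCompact_Icc (a := (0 : ℝ)) (b := 1)).finite_cover_balls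
    (show 0 < ε / (4 * (K + 1)) by positivity)
  have : ∀ᶠ n in F, ∀ x ∈ s, dist (γ n x) (g x) < ε / 2 := by
    rw [Filter.eventually_all_finite hs]
    exact fun x _ => Metric.tendsto_nhds.1 (h x) _ (half_pos hε)
  filter_upwards [this] with n hn t ht
  obtain ⟨x, hx, htx⟩ := mem_iUnion₂.1 (hcov ht)
  rw [Metric.mem_ball] at htx
  have h1 := (hγ n).dist_le_mul t x
  have h2 := hg.dist_le_mul x t
  rw [dist_comm x t] at h2
  have h3 : K * dist t x ≤ ε / 4 := by
    calc K * dist t x ≤ K * (ε / (4 * (K + 1))) := by gcongr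
      _ ≤ ε / 4 := by
        rw [mul_div_assoc', div_le_div_iff₀ (by positivity) (by norm_num)]
        nlinarith
  rw [← dist_eq_norm]
  calc dist (γ n t) (g t) ≤ dist (γ n t) (γ n x) + dist (γ n x) (g x) + dist (g x) (g t) :=
        dist_triangle4 _ _ _ _
    _ ≤ ε / 4 + ε / 2 + ε / 4 := by
        gcongr
        exacts [h1.trans h3, (hn x hx).le, h2.trans h3]
    _ = ε := by ring

/-- Sequences of uniformly Lipschitz curves have limit curves. -/
theorem exists_limit_curve {γ : ℕ → ℝ → Plane} {K : NNReal} {p : Plane}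
    (hγ : ∀ n, LipschitzWith K (γ n)) (h0 : ∀ n, γ n 0 = p) :
    ∃ g : ℝ → Plane, LipschitzWith K g ∧
      ∀ t, Tendsto (fun n => γ n t) (hyperfilter ℕ) (𝓝 (g t)) := by
  have hb : ∀ n t, γ n t ∈ Metric.closedBall p (K * |t|) := fun n t => by
    have := (hγ n).dist_le_mul t 0
    rwa [h0, dist_zero_right, Real.norm_eq_abs] at this
  -- Along an ultrafilter every bounded sequence converges, so no diagonal subsequence has to be
  -- extracted.
  have hlim : ∀ t, ∃ x, Tendsto (fun n => γ n t) (hyperfilter ℕ) (𝓝 x) := fun t => by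
    obtain ⟨x, -, hx⟩ := (isCompact_closedBall p (K * |t|)).ultrafilter_le_nhds
      ((hyperfilter ℕ).map fun n => γ n t)
      (by
        rw [le_principal_iff, Ultrafilter.mem_coe, Ultrafilter.mem_map]
        exact Filter.univ_mem' fun n => hb n t)
    exact ⟨x, hx⟩
  choose g hg using hlim
  refine ⟨g, LipschitzWith.of_dist_le_mul fun x y => ?_, hg⟩
  exact le_of_tendsto ((hg x).dist (hg y)) (Eventually.of_forall fun n => (hγ n).dist_le_mul x y)

/-- Compactness of curves of bounded length and lower semicontinuity of the energy. -/
theorem exists_hasCurve_of_tendsto {W : Plane → ℝ} (hW : Continuous W) {p q : Plane}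
    {γ : ℕ → ℝ → Plane} {K : NNReal} (hγ : ∀ n, LipschitzWith K (γ n)) (h0 : ∀ n, γ n 0 = p)
    (h1 : ∀ n, γ n 1 = q) {m A : ℝ} {u : ℕ → ℝ} (hu : Tendsto u atTop (𝓝 m))
    (hγu : ∀ n, degLength W (γ n) ≤ u n) (hA : Tendsto (fun n => area (γ n)) atTop (𝓝 A)) :
    ∃ e l, e ≤ m ∧ HasCurve W p q e A l := by
  obtain ⟨g, hg, hlim⟩ := exists_limit_curve hγ h0
  have hle : (hyperfilter ℕ : Filter ℕ) ≤ atTop := by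
    rw [← Nat.cofinite_eq_atTop]; exact hyperfilter_le_cofinite
  set F : Filter ℕ := (hyperfilter ℕ : Filter ℕ) with hF
  have hunif : ∀ ε > 0, ∀ᶠ n in F, ∀ t ∈ Icc (0 : ℝ) 1, ‖γ n t - g t‖ ≤ ε := fun ε hε =>
    eventually_forall_norm_sub_le hγ hg hlim hε
  have hγd := fun n => (hγ n).ae_differentiableAt_real
  have hgd := hg.ae_differentiableAt_real
  -- weak convergence of the derivatives
  have hweak : ∀ (i : Fin 2) (ψ : ℝ → ℝ), IntervalIntegrable ψ volume 0 1 →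
      Tendsto (fun n => ∫ t in (0 : ℝ)..1, ψ t * (deriv (γ n) t i - deriv g t i)) F (𝓝 0) := by
    intro i ψ hψ
    have hw : ∀ n, LipschitzWith (1 * (K + K)) fun t => (γ n t - g t) i := fun n =>
      (LipschitzWith.of_dist_le_mul fun x y => by
        rw [NNReal.coe_one, one_mul, dist_eq_norm, dist_eq_norm]
        exact abs_coord_le (x - y) i : LipschitzWith 1 fun x : Plane => x i).comp ((hγ n).sub hg)
    refine (tendsto_integral_mul_deriv hw (fun ε hε => ?_) hψ).congr fun n => ?_
    · filter_upwards [hunif ε hε] with n hn t ht using (abs_coord_le _ i).trans (hn t ht)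
    · refine intervalIntegral.integral_congr_ae ?_
      filter_upwards [hγd n, hgd] with t h2 h3 _
      have h5 := deriv_coord (h2.sub h3) i
      have : deriv (fun t => γ n t - g t) t = deriv (γ n) t - deriv g t :=
        (h2.hasDerivAt.sub h3.hasDerivAt).deriv
      change _ = deriv (fun t => γ n t - g t) t i at h5
      rw [this] at h5
      exact congrArg (ψ t * ·) h5
  have hFne : F.NeBot := inferInstanceAs (hyperfilter ℕ : Filter ℕ).NeBot
  -- the constraint
  have hareag : Tendsto (fun n => area (γ n)) F (𝓝 (area g)) := by
    -- The difference of the areas splits into a term treated by weak convergence of the derivatives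
    -- and one treated by uniform convergence of the curves.
    have hz1 := hweak 0 (fun t => g t 1) ((continuous_coord hg.continuous 1).intervalIntegrable 0 1)
    have hz2 : Tendsto (fun n => ∫ t in (0 : ℝ)..1, (γ n t - g t) 1 * deriv (γ n) t 0) F (𝓝 0) := by
      rw [Metric.tendsto_nhds]
      intro ε hε
      filter_upwards [hunif (ε / (2 * (K + 1))) (by positivity)] with n hn
      rw [dist_zero_right]
      have := intervalIntegral.norm_integral_le_of_norm_le_const
        (C := ε / (2 * (K + 1)) * K) (a := 0) (b := 1)
        (f := fun t => (γ n t - g t) 1 * deriv (γ n) t 0) fun t ht => by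
          rw [uIoc_of_le zero_le_one] at ht
          rw [norm_mul]
          exact mul_le_mul ((abs_coord_le _ 1).trans (hn t (Ioc_subset_Icc_self ht)))
            (lip_coord_deriv_le (hγ n) 0 t) (norm_nonneg _) (by positivity)
      refine this.trans_lt ?_
      rw [sub_zero, abs_one, mul_one, div_mul_eq_mul_div, div_lt_iff₀ (by positivity)]
      nlinarith [K.2]
    have hz := (hz1.add hz2).neg.add_const (area g)
    rw [add_zero, neg_zero, zero_add] at hz
    refine hz.congr fun n => ?_
    have i1 : IntervalIntegrable (fun t => g t 1 * (deriv (γ n) t 0 - deriv g t 0)) volume 0 1 := by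
      simp only [mul_sub]
      exact (lip_mul_coord_deriv (hγ n) (continuous_coord hg.continuous 1).continuousOn 0).sub
        (lip_mul_coord_deriv hg (continuous_coord hg.continuous 1).continuousOn 0)
    have i2 : IntervalIntegrable (fun t => (γ n t - g t) 1 * deriv (γ n) t 0) volume 0 1 :=
      lip_mul_coord_deriv (hγ n) (continuous_coord
        ((hγ n).continuous.sub hg.continuous) 1).continuousOn 0
    have i3 := lip_intervalIntegrable_area hg 0 1
    rw [area, area, ← neg_add, ← intervalIntegral.integral_add i1 i2,
      ← intervalIntegral.integral_add (i1.add i2) i3]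
    congr 1
    refine intervalIntegral.integral_congr fun t _ => ?_
    simp only [PiLp.sub_apply]
    ring
  have hAg : area g = A := tendsto_nhds_unique hareag (hA.mono_left hle)
  -- lower semicontinuity
  set S : ℝ → ℝ := fun t => √(W (g t)) with hS
  have hSc : Continuous S := (hW.comp hg.continuous).sqrt
  -- The weighted unit tangent of the limit curve. Pairing it with g' gives the energy of g, and
  -- pairing it with γₙ' gives at most √W(g)|γₙ'|. Division by 0 yields 0 where g' = 0, which is
  -- harmless.
  set ψ : Fin 2 → ℝ → ℝ := fun i t => S t * (deriv g t i / ‖deriv g t‖) with hψ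
  have hψi : ∀ i, IntervalIntegrable (ψ i) volume 0 1 := fun i => by
    refine intervalIntegrable_mul_of_bound hSc.continuousOn
      (((EuclideanSpace.proj (𝕜 := ℝ) i).continuous.measurable.comp
        (measurable_deriv_plane g)).div (measurable_deriv_plane g).norm).aestronglyMeasurable
      (C := 1) fun t => ?_
    rw [norm_div, norm_norm]
    exact div_le_one_of_le₀ (abs_coord_le _ i) (norm_nonneg _)
  have hlsc : ∀ ε > 0, degLength W g ≤ m + ε := by
    intro ε hε
    have hw2 := ((hweak 0 (ψ 0) (hψi 0)).add (hweak 1 (ψ 1) (hψi 1)))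
    rw [add_zero] at hw2
    have e1 := (Metric.tendsto_nhds.1 hw2) (ε / 3) (by positivity)
    have e2 := (Metric.tendsto_nhds.1 (hu.mono_left hle)) (ε / 3) (by positivity)
    -- uniform convergence of the weights
    have e3 : ∀ᶠ n in F, ∀ t ∈ Icc (0 : ℝ) 1, |√(W (γ n t)) - S t| ≤ ε / (3 * (K + 1)) := by
      have hKc : IsCompact (Metric.closedBall p (K + 1)) := isCompact_closedBall p (K + 1)
      have huc := hKc.uniformContinuousOn_of_continuous hW.sqrt.continuousOn
      rw [Metric.uniformContinuousOn_iff_le] at huc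
      obtain ⟨δ, hδ, hδ'⟩ := huc (ε / (3 * (K + 1))) (by positivity)
      filter_upwards [hunif δ hδ] with n hn t ht
      have hball : ∀ f : ℝ → Plane, LipschitzWith K f → f 0 = p →
          f t ∈ Metric.closedBall p (K + 1) := fun f hf hf0 => by
        have := hf.dist_le_mul t 0
        rw [hf0, dist_zero_right, Real.norm_of_nonneg ht.1] at this
        have h4 : K * t ≤ K := mul_le_of_le_one_right K.2 ht.2
        exact Metric.mem_closedBall.2 (by linarith)
      have hg0 : g 0 = p := tendsto_nhds_unique (hlim 0) (by simp only [h0]; exact tendsto_const_nhds)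
      exact hδ' _ (hball _ (hγ n) (h0 n)) _ (hball _ hg hg0) (by rw [dist_eq_norm]; exact hn t ht)
    obtain ⟨n, h3, h4, h5⟩ := (e1.and (e2.and e3)).exists
    rw [dist_zero_right] at h3
    have i1 : ∀ i, IntervalIntegrable (fun t => ψ i t * deriv (γ n) t i) volume 0 1 := fun i =>
      ⟨(hψi i).1.mul_bdd (c := K) (aesm_deriv_coord _ i).restrict
          (Eventually.of_forall fun t => lip_coord_deriv_le (hγ n) i t),
        (hψi i).2.mul_bdd (c := K) (aesm_deriv_coord _ i).restrict
          (Eventually.of_forall fun t => lip_coord_deriv_le (hγ n) i t)⟩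
    have i2 : ∀ i, IntervalIntegrable (fun t => ψ i t * deriv g t i) volume 0 1 := fun i =>
      ⟨(hψi i).1.mul_bdd (c := K) (aesm_deriv_coord _ i).restrict
          (Eventually.of_forall fun t => lip_coord_deriv_le hg i t),
        (hψi i).2.mul_bdd (c := K) (aesm_deriv_coord _ i).restrict
          (Eventually.of_forall fun t => lip_coord_deriv_le hg i t)⟩
    have hsplit : ∀ i, ∫ t in (0 : ℝ)..1, ψ i t * (deriv (γ n) t i - deriv g t i)
        = (∫ t in (0 : ℝ)..1, ψ i t * deriv (γ n) t i) - ∫ t in (0 : ℝ)..1, ψ i t * deriv g t i :=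
      fun i => by
        rw [← intervalIntegral.integral_sub (i1 i) (i2 i)]
        exact intervalIntegral.integral_congr fun t _ => by ring
    have hdg : degLength W g = (∫ t in (0 : ℝ)..1, ψ 0 t * deriv g t 0)
        + ∫ t in (0 : ℝ)..1, ψ 1 t * deriv g t 1 := by
      rw [← intervalIntegral.integral_add (i2 0) (i2 1), degLength]
      refine intervalIntegral.integral_congr fun t _ => ?_
      simp only [hψ, hS]
      rcases eq_or_ne (‖deriv g t‖) 0 with hz | hz
      · simp [hz]
      · have : ‖deriv g t‖ ^ 2 = deriv g t 0 ^ 2 + deriv g t 1 ^ 2 := by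
          rw [EuclideanSpace.real_norm_sq_eq, Fin.sum_univ_two]
        field_simp
        rw [this]
    have hub : (∫ t in (0 : ℝ)..1, ψ 0 t * deriv (γ n) t 0)
        + ∫ t in (0 : ℝ)..1, ψ 1 t * deriv (γ n) t 1 ≤ degLength W (γ n) + ε / 3 := by
      have hi3 := lip_intervalIntegrable_length (hγ n) hW 0 1
      rw [← intervalIntegral.integral_add (i1 0) (i1 1)]
      calc ∫ t in (0 : ℝ)..1, (ψ 0 t * deriv (γ n) t 0 + ψ 1 t * deriv (γ n) t 1)
          ≤ ∫ t in (0 : ℝ)..1, (√(W (γ n t)) * ‖deriv (γ n) t‖ + ε / 3) := by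
            refine intervalIntegral.integral_mono_on zero_le_one ((i1 0).add (i1 1))
              (hi3.add intervalIntegrable_const) fun t ht => ?_
            have k1 : ψ 0 t * deriv (γ n) t 0 + ψ 1 t * deriv (γ n) t 1
                = S t * (inner ℝ (deriv g t) (deriv (γ n) t) / ‖deriv g t‖) := by
              simp only [hψ, PiLp.inner_apply, Fin.sum_univ_two, RCLike.inner_apply,
                conj_trivial]
              ring
            have k2 : inner ℝ (deriv g t) (deriv (γ n) t) / ‖deriv g t‖ ≤ ‖deriv (γ n) t‖ :=
              div_le_of_le_mul₀ (norm_nonneg _) (norm_nonneg _)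
                ((real_inner_le_norm _ _).trans_eq (mul_comm _ _))
            have k3 : S t ≤ √(W (γ n t)) + ε / (3 * (K + 1)) := by
              have := neg_le_of_abs_le (h5 t ht); linarith
            have k4 : ε / (3 * (K + 1)) * K ≤ ε / 3 := by
              rw [div_mul_eq_mul_div, div_le_div_iff₀ (by positivity) (by norm_num)]
              nlinarith [K.2]
            have hSt : 0 ≤ S t := Real.sqrt_nonneg _
            rw [k1]
            calc S t * (inner ℝ (deriv g t) (deriv (γ n) t) / ‖deriv g t‖)
                ≤ S t * ‖deriv (γ n) t‖ := by gcongr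
              _ ≤ (√(W (γ n t)) + ε / (3 * (K + 1))) * ‖deriv (γ n) t‖ := by gcongr
              _ = √(W (γ n t)) * ‖deriv (γ n) t‖ + ε / (3 * (K + 1)) * ‖deriv (γ n) t‖ := by ring
              _ ≤ √(W (γ n t)) * ‖deriv (γ n) t‖ + ε / (3 * (K + 1)) * K := by
                  gcongr; exact lip_norm_deriv_le (hγ n) t
              _ ≤ _ := by gcongr
        _ = degLength W (γ n) + ε / 3 := by
            rw [intervalIntegral.integral_add hi3 intervalIntegrable_const]
            simp [degLength]
    rw [hsplit, hsplit] at h3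
    have h6 := neg_le_of_abs_le h3.le
    rw [Real.dist_eq] at h4
    have h7 := le_of_abs_le h4.le
    have h8 := hγu n
    linarith
  refine ⟨degLength W g, arclength g, le_of_forall_pos_le_add hlsc, g, ⟨K, hg⟩, ?_, ?_, rfl, hAg,
    rfl⟩
  · exact tendsto_nhds_unique (hlim 0) (by simp only [h0]; exact tendsto_const_nhds)
  · exact tendsto_nhds_unique (hlim 1) (by simp only [h1]; exact tendsto_const_nhds)

/-! ### Minimizers of the constrained problem -/

section Minimizers

variable {W : Plane → ℝ} {pm pp : Plane} {E₀ c C r δ : ℝ}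

theorem HasCurve.length_pos {p q : Plane} {e a l : ℝ} (h : HasCurve W p q e a l) (hne : p ≠ q) :
    0 < l := by
  obtain ⟨γ, ⟨K, hγ⟩, rfl, rfl, -, -, rfl⟩ := h
  exact (norm_pos_iff.2 (sub_ne_zero.2 hne.symm)).trans_le
    (lip_dist_le_integral hγ zero_le_one)

/-- A minimizer exists as soon as there is a curve of nearly minimal energy. -/
theorem exists_minimizer (hW : Continuous W) (hne : pm ≠ pp) {A L B d₀ κ : ℝ} (hd₀ : 0 < d₀)
    (hbd : ∀ m, m ≤ E₀ + κ → (∀ e l, HasCurve W pm pp e A l → m ≤ e) →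
      ∀ d, 0 < d → d ≤ d₀ → ∀ e l, HasCurve W pm pp e A l → e ≤ m + d →
        ∃ e' a' l', HasCurve W pm pp e' a' l' ∧ l' ≤ L ∧ e' ≤ e + B * d ∧ |a' - A| ≤ B * d)
    {e₀ l₀ : ℝ} (he₀ : HasCurve W pm pp e₀ A l₀) (hle : e₀ ≤ E₀ + κ) :
    ∃ e l, HasCurve W pm pp e A l ∧ ∀ e' l', HasCurve W pm pp e' A l' → e ≤ e' := by
  set S : Set ℝ := {e | ∃ l, HasCurve W pm pp e A l} with hS
  have hSb : BddBelow S := ⟨0, by rintro e ⟨l, h⟩; exact h.nonneg⟩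
  have hSn : S.Nonempty := ⟨e₀, l₀, he₀⟩
  set m := sInf S with hm
  have hmin : ∀ e l, HasCurve W pm pp e A l → m ≤ e := fun e l h => csInf_le hSb ⟨l, h⟩
  -- A minimizing sequence of uniformly bounded length, hence uniformly Lipschitz at constant speed.
  -- Its members have area A only up to an error tending to 0; the limit has area exactly A.
  have hstep : ∀ n : ℕ, ∃ γ : ℝ → Plane, LipschitzWith L.toNNReal γ ∧ γ 0 = pm ∧ γ 1 = pp ∧
      degLength W γ ≤ m + (1 + B) * (d₀ * (1 / ((n : ℝ) + 1))) ∧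
      |area γ - A| ≤ B * (d₀ * (1 / ((n : ℝ) + 1))) := by
    intro n
    set d := d₀ * (1 / ((n : ℝ) + 1)) with hd
    have hdpos : 0 < d := by positivity
    have hd1 : d ≤ d₀ := by
      refine mul_le_of_le_one_right hd₀.le ?_
      rw [div_le_one (by positivity)]
      linarith [(Nat.cast_nonneg n : (0 : ℝ) ≤ n)]
    obtain ⟨e, ⟨l, he⟩, hem⟩ := exists_lt_of_csInf_lt hSn (show sInf S < m + d by linarith)
    obtain ⟨e', a', l', hc, hl, he', ha'⟩ :=
      hbd m ((hmin _ _ he₀).trans hle) hmin d hdpos hd1 e l he hem.le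
    obtain ⟨γ, hγ, g0, g1, ge, ga, -, -⟩ := hc.exists_constantSpeed hW (hc.length_pos hne)
    exact ⟨γ, hγ.weaken (Real.toNNReal_le_toNNReal hl), g0, g1, by rw [ge]; linarith,
      by rw [ga]; exact ha'⟩
  choose γ hγ g0 g1 ge ga using hstep
  have hlim : Tendsto (fun n : ℕ => d₀ * (1 / ((n : ℝ) + 1))) atTop (𝓝 0) := by
    simpa using tendsto_one_div_add_atTop_nhds_zero_nat.const_mul d₀
  obtain ⟨e, l, he, hc⟩ := exists_hasCurve_of_tendsto hW hγ g0 g1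
    (u := fun n => m + (1 + B) * (d₀ * (1 / ((n : ℝ) + 1)))) (m := m) (A := A)
    (by simpa using (hlim.const_mul (1 + B)).const_add m) ge (by
      rw [tendsto_iff_norm_sub_tendsto_zero]
      exact squeeze_zero (fun n => norm_nonneg _) ga (by simpa using hlim.const_mul B))
  exact ⟨e, l, hc, fun e' l' h' => he.trans (hmin _ _ h')⟩

/-- A curve of zero energy starting at a well is constant. -/
theorem Setup.eq_of_energy_zero (S : Setup W pm pp E₀ c C r δ) {η : ℝ → Plane} {K : NNReal}
    (hη : LipschitzWith K η) {s t : ℝ} (hs : η s = pm)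
    (h0 : ∫ u in s..t, √(W (η u)) * ‖deriv η u‖ ≤ 0) : ∀ u ∈ Icc s t, η u = pm := by
  intro u hu
  have h1 := hasCurve_sub (W := W) hη s u hu.1
  rw [hs] at h1
  have h2 : ∫ τ in s..u, √(W (η τ)) * ‖deriv η τ‖ ≤ 0 :=
    (intervalIntegral.integral_mono_interval le_rfl hu.1 hu.2
      (Eventually.of_forall fun t => by positivity)
      (lip_intervalIntegrable_length hη S.cont s t)).trans h0
  have hc := S.c_pos
  have hr := S.r_pos
  have h3 := (h1.well_estimate S.cont hc hr.le S.lower (h2.trans_lt (by positivity))).1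
  have h4 : ‖η u - pm‖ ^ 2 ≤ 0 := by
    by_contra! hcon
    have : 0 < c / 2 * ‖η u - pm‖ ^ 2 := by positivity
    linarith
  have h5 : ‖η u - pm‖ = 0 := pow_eq_zero_iff two_ne_zero |>.1 (le_antisymm h4 (sq_nonneg _))
  exact sub_eq_zero.1 (norm_eq_zero.1 h5)

/-- Curves with constant positive speed spend energy after leaving a well. -/
theorem Setup.energy_pos (S : Setup W pm pp E₀ c C r δ) {η : ℝ → Plane} {K : NNReal}
    (hη : LipschitzWith K η) {s t l : ℝ} (hst : s < t) (hs : η s = pm) (hl : 0 < l)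
    (hsp : ∀ᵐ u : ℝ, u ∈ Ioo s t → ‖deriv η u‖ = l) :
    0 < ∫ u in s..t, √(W (η u)) * ‖deriv η u‖ := by
  by_contra! h0
  have hconst := S.eq_of_energy_zero hη hs h0
  have hd : ∀ u ∈ Ioo s t, deriv η u = 0 := fun u hu => by
    have : EqOn η (fun _ => pm) (Ioo s t) := fun v hv => hconst v (Ioo_subset_Icc_self hv)
    rw [deriv_eq_of_eqOn_Ioo this hu]
    simp
  have hfalse : ∀ᵐ u : ℝ, u ∉ Ioo s t := by
    filter_upwards [hsp] with u hu hmem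
    have := hu hmem
    rw [hd u hmem, norm_zero] at this
    exact hl.ne this
  have : volume (Ioo s t) = 0 := by
    exact measure_eq_zero_iff_ae_notMem.2 hfalse
  rw [Real.volume_Ioo, ENNReal.ofReal_eq_zero] at this
  linarith

end Minimizers

/-- For constraint values near that of an unconstrained minimizer, there are minimizers; they
have no bubbles and are stable under small changes of the constraint. -/
theorem DoubleWell.exists_threshold {W : Plane → ℝ} {pm pp : Plane} (hW : DoubleWell W pm pp)
    {γ₀ : ℝ → Plane} (hγ₀ : γ₀ ∈ curves pm pp) (hmin : IsMinOn (degLength W) (curves pm pp) γ₀) :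
    ∃ ε₀ > 0, ∀ A, |A - area γ₀| < ε₀ →
      (∃ γ ∈ areaCurves pm pp A, IsMinOn (degLength W) (areaCurves pm pp A) γ ∧
        ConstantSpeed γ) ∧
      ∀ γ ∈ areaCurves pm pp A, IsMinOn (degLength W) (areaCurves pm pp A) γ →
        (ConstantSpeed γ → ∀ t ∈ Ioo (0 : ℝ) 1, γ t ≠ pm ∧ γ t ≠ pp) ∧
        ∃ k ≥ 0, ∃ δ > 0, ∀ e a l, HasCurve W pm pp e a l → |a - A| ≤ δ →
          degLength W γ ≤ e + k * |a - A| := by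
  set E₀ := degLength W γ₀ with hE₀
  have hE : ∀ e a l, HasCurve W pm pp e a l → E₀ ≤ e := fun e a l h => by
    obtain ⟨γ, hγ, rfl⟩ := exists_curve_of_hasCurve h
    exact hmin hγ.1
  obtain ⟨c, C, r, δ, S, S'⟩ := hW.exists_setup hE
  obtain ⟨κ, hκ, L, B, d₀, hd₀, hbd⟩ := S.exists_bounded_length S' hW.ne
    fun ρ hρ => hW.exists_lower_bound hρ
  have hc := S.c_pos
  have hr := S.r_pos
  have hδ := S.δ_pos
  set β := min (min κ δ) (min (c * δ) (c / 4 * r ^ 2)) with hβ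
  have hβ0 : 0 < β := by positivity
  have b1 : β ≤ κ := (min_le_left _ _).trans (min_le_left _ _)
  have b2 : β ≤ δ := (min_le_left _ _).trans (min_le_right _ _)
  have b3 : β ≤ c * δ := (min_le_right _ _).trans (min_le_left _ _)
  have b4 : β ≤ c / 4 * r ^ 2 := (min_le_right _ _).trans (min_le_right _ _)
  refine ⟨min δ (β / c), by positivity, fun A hA => ?_⟩
  have hA1 : |A - area γ₀| ≤ δ := hA.le.trans (min_le_left _ _)
  have hA2 : c / 2 * |A - area γ₀| ≤ β := by
    have := hA.le.trans (min_le_right _ _)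
    rw [le_div_iff₀ hc] at this
    linarith [mul_nonneg hc.le (abs_nonneg (A - area γ₀))]
  -- a competitor obtained from the unconstrained minimizer
  obtain ⟨e₀, l₀, he₀, hc₀⟩ := S.correct _ _ _ (A - area γ₀) (hasCurve_of_mem W hγ₀)
    (by linarith) hA1
  rw [add_sub_cancel] at hc₀
  have he₀β : e₀ ≤ E₀ + β := by linarith
  refine ⟨?_, fun γ hγ hγmin => ?_⟩
  · obtain ⟨e, l, hec, hemin⟩ := exists_minimizer hW.continuous hW.ne hd₀ (hbd A) hc₀
      (he₀β.trans (by linarith))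
    obtain ⟨γ, hγ, g0, g1, ge, ga, gl, gs⟩ :=
      hec.exists_constantSpeed hW.continuous (hec.length_pos hW.ne)
    refine ⟨γ, ⟨⟨⟨_, hγ.lipschitzOnWith⟩, g0, g1⟩, ga⟩, fun η hη => ?_, ?_⟩
    · have := hasCurve_of_mem W hη.1
      rw [hη.2] at this
      simp only [mem_ofPred_eq]
      rw [ge]
      exact hemin _ _ this
    · rw [ConstantSpeed, gl]; exact gs
  have hmin' : ∀ e l, HasCurve W pm pp e A l → degLength W γ ≤ e := fun e l h => by
    obtain ⟨η, hη, rfl⟩ := exists_curve_of_hasCurve h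
    exact hγmin hη
  have hγβ : degLength W γ ≤ E₀ + β := (hmin' _ _ hc₀).trans he₀β
  refine ⟨fun hsp t ht => ?_, c / 2, by positivity, δ, hδ, fun e a l he ha => ?_⟩
  · obtain ⟨⟨⟨K, hK⟩, g0, g1⟩, ga⟩ := hγ
    obtain ⟨η, hη, heq⟩ := exists_lipschitz_extension hK
    have hl : 0 < arclength γ :=
      (hasCurve_of_mem W ⟨⟨K, hK⟩, g0, g1⟩).length_pos hW.ne
    have hspη : ∀ u v, 0 ≤ u → v ≤ 1 →
        ∀ᵐ x : ℝ, x ∈ Ioo u v → ‖deriv η x‖ = arclength γ := fun u v hu hv => by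
      have := (ae_restrict_iff' measurableSet_Icc).1 hsp
      filter_upwards [this] with x hx hxm
      rw [← deriv_eq_of_eqOn_Ioo (heq.mono Ioo_subset_Icc_self)
        (⟨hu.trans_lt hxm.1, hxm.2.trans_le hv⟩ : x ∈ Ioo (0 : ℝ) 1)]
      exact hx ⟨hu.trans hxm.1.le, hxm.2.le.trans hv⟩
    have q0 : η 0 = pm := by rw [← heq (by simp), g0]
    have q1 : η 1 = pp := by rw [← heq (by simp), g1]
    have h₁ := hasCurve_sub (W := W) hη 0 t ht.1.le
    have h₂ := hasCurve_sub (W := W) hη t 1 ht.2.le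
    rw [q0] at h₁
    rw [q1] at h₂
    have hsum : (∫ u in (0 : ℝ)..t, √(W (η u)) * ‖deriv η u‖)
        + (∫ u in t..1, √(W (η u)) * ‖deriv η u‖) = degLength W γ := by
      rw [degLength_congr W heq, degLength]
      exact intervalIntegral.integral_add_adjacent_intervals
        (lip_intervalIntegrable_length hη hW.continuous 0 t)
        (lip_intervalIntegrable_length hη hW.continuous t 1)
    have hasum : (-∫ u in (0 : ℝ)..t, η u 1 * deriv η u 0)
        + (-∫ u in t..1, η u 1 * deriv η u 0) = A := by
      rw [← ga, area_congr heq, area, ← neg_add,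
        intervalIntegral.integral_add_adjacent_intervals
        (lip_intervalIntegrable_area hη 0 t) (lip_intervalIntegrable_area hη t 1)]
    rw [heq (Ioo_subset_Icc_self ht)]
    refine ⟨fun hpm => ?_, fun hpp => ?_⟩
    -- The part before t is a loop at `pm`; it has positive energy because the speed is constant and
    -- nonzero. Removing it contradicts minimality.
    · rw [hpm] at h₁ h₂
      obtain ⟨e, l, hlt, hcur⟩ := S.exists_lt_of_loop h₁ h₂
        (S.energy_pos hη ht.1 q0 hl (hspη 0 t le_rfl ht.2.le)) (by linarith) (by linarith)
        (by have : 0 < c * r ^ 2 := by positivity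
            linarith)
      rw [hasum] at hcur
      have := hmin' _ _ hcur
      linarith
    -- The part after t is a loop at `pp`, which the reversed setup treats as an initial loop.
    · rw [hpp] at h₁ h₂
      obtain ⟨e, l, hlt, hcur⟩ := S'.exists_lt_of_loop h₂.symm h₁.symm
        (S'.energy_pos hη ht.2 hpp hl (hspη t 1 ht.1.le le_rfl)) (by linarith) (by linarith)
        (by have : 0 < c * r ^ 2 := by positivity
            linarith)
      have hcur' := hcur.symm
      rw [← neg_add, neg_neg, add_comm, hasum] at hcur'
      have := hmin' _ _ hcur'
      linarith
  -- Stability: a curve of nearly minimal energy can be corrected to area A at cost (c/2)|a - A|.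
  -- Any other curve already costs more than E₀ + δ, hence more than the minimizer.
  · by_cases heδ : e ≤ E₀ + δ
    · obtain ⟨e', l', he', hc'⟩ := S.correct e a l (A - a) he heδ (by rwa [abs_sub_comm])
      rw [add_sub_cancel] at hc'
      rw [abs_sub_comm a A]
      exact (hmin' _ _ hc').trans he'
    · have : 0 ≤ c / 2 * |a - A| := by positivity
      linarith

/-! ### Change of the time variable -/

/-- A primitive of a density which is at least `c / (1 - t)` is unbounded near `1`. -/
theorem exists_le_of_deriv_lower_bound {y f : ℝ → ℝ} {c : ℝ} (hc : 0 < c)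
    (hy : ∀ t ∈ Ioo (0 : ℝ) 1, HasDerivAt y (f t) t)
    (hf : ∀ t ∈ Ioo (0 : ℝ) 1, c ≤ (1 - t) * f t) (M : ℝ) : ∃ t ∈ Ioo (0 : ℝ) 1, M ≤ y t := by
  have hd : ∀ t ∈ Ioo (0 : ℝ) 1,
      HasDerivAt (fun t => y t + c * Real.log (1 - t)) (f t + c * (-1 / (1 - t))) t := fun t ht =>
    (hy t ht).add ((((hasDerivAt_id t).const_sub 1).log (by have := ht.2; simp; linarith)).const_mul
      c)
  -- The lower bound on f says that y grows at least as fast as -c log(1 - t), which is unbounded.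
  have hmono : MonotoneOn (fun t => y t + c * Real.log (1 - t)) (Ioo 0 1) := by
    refine monotoneOn_of_deriv_nonneg (convex_Ioo 0 1)
      (fun t ht => (hd t ht).continuousAt.continuousWithinAt)
      (fun t ht => ((hd t (interior_subset ht)).differentiableAt.differentiableWithinAt)) ?_
    intro t ht
    have ht' := interior_subset ht
    rw [(hd t ht').deriv]
    have h1 : 0 < 1 - t := by linarith [ht'.2]
    have : c * (-1 / (1 - t)) = -(c / (1 - t)) := by ring
    rw [this]
    have := (div_le_iff₀ h1).2 ((hf t ht').trans_eq (mul_comm _ _))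
    linarith
  set D := y (1 / 2) + c * Real.log (1 - 1 / 2)
  set N := max 1 ((M - D) / c)
  have hN1 : 1 ≤ N := le_max_left _ _
  have hN2 : M - D ≤ c * N := by
    rw [← div_le_iff₀' hc]
    exact le_max_right _ _
  have he : Real.exp (-N) ≤ 1 / 2 := by
    refine (Real.exp_le_exp.2 (neg_le_neg hN1)).trans ?_
    rw [Real.exp_neg, one_div]
    exact inv_anti₀ two_pos (by linarith [Real.exp_one_gt_d9])
  have he' := Real.exp_pos (-N)
  have hmem : 1 - Real.exp (-N) ∈ Ioo (0 : ℝ) 1 := ⟨by linarith, by linarith⟩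
  refine ⟨_, hmem, ?_⟩
  have := hmono (show (1 / 2 : ℝ) ∈ Ioo (0 : ℝ) 1 by norm_num) hmem (by linarith)
  simp only [sub_sub_cancel, Real.log_exp] at this
  have : D ≤ y (1 - Real.exp (-N)) + c * -N := this
  linarith

/-- A positive density on `(0,1)` with non-integrable singularities at both ends defines a change
of variables between `(0,1)` and the line. -/
theorem exists_time_change {y f : ℝ → ℝ} {c : ℝ} (hc : 0 < c)
    (hy : ∀ t ∈ Ioo (0 : ℝ) 1, HasDerivAt y (f t) t)
    (hf0 : ∀ t ∈ Ioo (0 : ℝ) 1, c ≤ t * f t)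
    (hf1 : ∀ t ∈ Ioo (0 : ℝ) 1, c ≤ (1 - t) * f t) :
    BijOn y (Ioo 0 1) univ ∧ ∃ T : ℝ → ℝ, T = Function.invFunOn y (Ioo 0 1) ∧
      (∀ v, T v ∈ Ioo (0 : ℝ) 1) ∧ (∀ v, y (T v) = v) ∧ StrictMono T ∧ range T = Ioo 0 1 ∧
      (∀ v, HasDerivAt T (f (T v))⁻¹ v) ∧ Tendsto T atTop (𝓝 1) ∧ Tendsto T atBot (𝓝 0) := by
  have hfpos : ∀ t ∈ Ioo (0 : ℝ) 1, 0 < f t := fun t ht =>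
    pos_of_mul_pos_right (hc.trans_le (hf0 t ht)) ht.1.le
  have hcont : ContinuousOn y (Ioo 0 1) := fun t ht =>
    (hy t ht).continuousAt.continuousWithinAt
  have hmono : StrictMonoOn y (Ioo 0 1) := by
    refine strictMonoOn_of_deriv_pos (convex_Ioo 0 1) hcont fun t ht => ?_
    rw [(hy t (interior_subset ht)).deriv]
    exact hfpos t (interior_subset ht)
  have hsurj : SurjOn y (Ioo 0 1) univ := by
    intro v _
    obtain ⟨t₁, ht₁, h₁⟩ := exists_le_of_deriv_lower_bound hc hy hf1 v
    -- The reflection t ↦ 1 - t reduces unboundedness from below near 0 to the statement near 1.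
    obtain ⟨t₀, ht₀, h₀⟩ := exists_le_of_deriv_lower_bound (y := fun t => -y (1 - t))
      (f := fun t => f (1 - t)) hc (fun t ht => by
        have hm : 1 - t ∈ Ioo (0 : ℝ) 1 := ⟨by linarith [ht.2], by linarith [ht.1]⟩
        exact ((hy (1 - t) hm).comp_const_sub 1 t).neg.congr_deriv (neg_neg _))
      (fun t ht => by simpa using hf0 (1 - t) ⟨by linarith [ht.2], by linarith [ht.1]⟩) (-v)
    have ht₀' : 1 - t₀ ∈ Ioo (0 : ℝ) 1 := ⟨by linarith [ht₀.2], by linarith [ht₀.1]⟩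
    exact (isPreconnected_Ioo.image _ hcont).Icc_subset (mem_image_of_mem y ht₀')
      (mem_image_of_mem y ht₁) ⟨by linarith, h₁⟩
  refine ⟨⟨mapsTo_univ _ _, hmono.injOn, hsurj⟩, _, rfl, ?_⟩
  set T := Function.invFunOn y (Ioo 0 1)
  have hT : ∀ v, T v ∈ Ioo (0 : ℝ) 1 := fun v => Function.invFunOn_mem (hsurj (mem_univ v))
  have hyT : ∀ v, y (T v) = v := fun v => Function.invFunOn_eq (hsurj (mem_univ v))
  have hTy : ∀ t ∈ Ioo (0 : ℝ) 1, T (y t) = t := fun t ht => hmono.injOn (hT _) ht (hyT _)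
  have hTmono : StrictMono T := fun a b hab => by
    rw [← hmono.lt_iff_lt (hT a) (hT b), hyT, hyT]
    exact hab
  have hrange : range T = Ioo 0 1 :=
    Subset.antisymm (range_subset_iff.2 hT) fun t ht => ⟨y t, hTy t ht⟩
  have hTc : ∀ v, ContinuousAt T v := fun v => by
    refine (hTmono.strictMonoOn univ).continuousAt_of_image_mem_nhds univ_mem ?_
    rw [image_univ, hrange]
    exact Ioo_mem_nhds (hT v).1 (hT v).2
  refine ⟨hT, hyT, hTmono, hrange, fun v => (hy _ (hT v)).of_local_left_inverse (hTc v)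
    (hfpos _ (hT v)).ne' (Eventually.of_forall hyT), ?_, ?_⟩
  · exact tendsto_atTop_isLUB hTmono.monotone (hrange ▸ isLUB_Ioo zero_lt_one)
  · exact tendsto_atBot_isGLB hTmono.monotone (hrange ▸ isGLB_Ioo zero_lt_one)

/-- A change of variables from the line to `(0,1)`, with bounded continuous derivative, along
which null sets pull back to null sets. -/
structure TimeChange (T g : ℝ → ℝ) : Prop where
  mem : ∀ v, T v ∈ Ioo (0 : ℝ) 1
  mono : StrictMono T
  range_eq : range T = Ioo 0 1
  hasDerivAt : ∀ v, HasDerivAt T (g v) v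
  pos : ∀ v, 0 < g v
  bounded : ∃ K, ∀ v, g v ≤ K
  tendsto_atTop : Tendsto T atTop (𝓝 1)
  tendsto_atBot : Tendsto T atBot (𝓝 0)
  ae_comp : ∀ p : ℝ → Prop, (∀ᵐ t, t ∈ Ioo (0 : ℝ) 1 → p t) → ∀ᵐ v, p (T v)

/-- The reparametrization by `|U'| = √2 √W(U)` of a curve of constant speed without bubbles. -/
theorem exists_reparam {W : Plane → ℝ} {pm pp : Plane} (hW : DoubleWell W pm pp)
    {γ : ℝ → Plane} (hγ : γ ∈ curves pm pp) (hs : ConstantSpeed γ)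
    (hno : ∀ t ∈ Ioo (0 : ℝ) 1, γ t ≠ pm ∧ γ t ≠ pp) :
    BijOn (newParam W γ) (Ioo 0 1) univ ∧ ∃ η : ℝ → Plane, ∃ K : NNReal, ∃ T : ℝ → ℝ, ∃ L > 0,
      LipschitzWith K η ∧ EqOn γ η (Icc 0 1) ∧ reparam W γ = η ∘ T ∧
      (∀ᵐ t, t ∈ Ioo (0 : ℝ) 1 → ‖deriv η t‖ = L) ∧
      TimeChange T (fun v => √2 * √(W (η (T v))) / L) := by
  obtain ⟨⟨K, hK⟩, h0, h1⟩ := id hγ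
  obtain ⟨η, hη, heq⟩ := exists_lipschitz_extension hK
  have hη0 : η 0 = pm := by rw [← heq (by simp), h0]
  have hη1 : η 1 = pp := by rw [← heq (by simp), h1]
  set L := arclength γ with hL
  have hLpos : 0 < L := (hasCurve_of_mem W hγ).length_pos hW.ne
  have hsp : ∀ᵐ t, t ∈ Ioo (0 : ℝ) 1 → ‖deriv η t‖ = L := by
    have := (ae_restrict_iff' measurableSet_Icc).1 hs
    filter_upwards [this] with t ht ht'
    rw [hL, ← ht (Ioo_subset_Icc_self ht'),
      deriv_eq_of_eqOn_Ioo (heq.mono Ioo_subset_Icc_self) ht']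
  have hWpos : ∀ t ∈ Ioo (0 : ℝ) 1, 0 < √(W (η t)) := fun t ht => by
    rw [← heq (Ioo_subset_Icc_self ht)]
    exact Real.sqrt_pos.2 (hW.pos (hno t ht).1 (hno t ht).2)
  set f : ℝ → ℝ := fun t => 1 / √2 * (L / √(W (η t))) with hf
  have hfcont : ContinuousOn f (Ioo 0 1) := fun t ht =>
    (ContinuousAt.const_mul (continuousAt_const.div
      ((hW.continuous.comp hη.continuous).sqrt.continuousAt) (hWpos t ht).ne') _).continuousWithinAt
  have hy : ∀ t ∈ Ioo (0 : ℝ) 1, HasDerivAt (newParam W γ) (f t) t := by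
    intro t ht
    have hsub : ∀ s ∈ Ioo (0 : ℝ) 1, uIcc (1 / 2) s ⊆ Ioo 0 1 := fun s hs =>
      ordConnected_Ioo.uIcc_subset (by norm_num) hs
    have hc' : ContinuousOn (fun t => L / √(W (η t))) (Ioo 0 1) := fun t ht =>
      (continuousAt_const.div
      ((hW.continuous.comp hη.continuous).sqrt.continuousAt) (hWpos t ht).ne').continuousWithinAt
    have hEq : newParam W γ =ᶠ[𝓝 t]
        fun t => 1 / √2 * ∫ τ in (1 / 2 : ℝ)..t, L / √(W (η τ)) := by
      filter_upwards [Ioo_mem_nhds ht.1 ht.2] with s hs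
      rw [newParam]
      congr 1
      refine intervalIntegral.integral_congr_ae ?_
      filter_upwards [hsp] with x hx hx'
      have hx'' := hsub s hs (uIoc_subset_uIcc hx')
      rw [deriv_eq_of_eqOn_Ioo (heq.mono Ioo_subset_Icc_self) hx'', hx hx'',
        heq (Ioo_subset_Icc_self hx'')]
    refine HasDerivAt.congr_of_eventuallyEq ?_ hEq
    refine HasDerivAt.const_mul _ (intervalIntegral.integral_hasDerivAt_right
      ((hc'.mono (hsub t ht)).intervalIntegrable) ?_ (hc'.continuousAt (Ioo_mem_nhds ht.1 ht.2)))
    exact hc'.stronglyMeasurableAtFilter isOpen_Ioo t ht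
  obtain ⟨R, hR⟩ : ∃ R, ∀ t ∈ Icc (0 : ℝ) 1, ‖η t - pm‖ ≤ R ∧ ‖η t - pp‖ ≤ R := by
    refine ⟨K, fun t ht => ⟨?_, ?_⟩⟩
    · rw [← hη0, ← dist_eq_norm]
      refine (hη.dist_le_mul _ _).trans (mul_le_of_le_one_right K.2 ?_)
      rw [Real.dist_eq, sub_zero, abs_of_nonneg ht.1]
      exact ht.2
    · rw [← hη1, ← dist_eq_norm]
      refine (hη.dist_le_mul _ _).trans (mul_le_of_le_one_right K.2 ?_)
      rw [Real.dist_eq, abs_of_nonpos (by linarith [ht.2])]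
      linarith [ht.1]
  -- Since η is Lipschitz and √W is at most linear in the distance to a well, √W(η t) is at most C t
  -- and at most C(1 - t). Thus dy/dt has non-integrable singularities at both ends, and y covers
  -- the line.
  obtain ⟨C₀, hC₀, hb₀⟩ := sqrt_le_near_zero hW.contDiff hW.nonneg hW.zero_left R
  obtain ⟨C₁, hC₁, hb₁⟩ := sqrt_le_near_zero hW.contDiff hW.nonneg hW.zero_right R
  have hs2 : 0 < √2 := by positivity
  set C := (C₀ + C₁) * (K + 1)
  have hCpos : 0 < C := by positivity
  have hup0 : ∀ t ∈ Ioo (0 : ℝ) 1, √(W (η t)) ≤ C * t := fun t ht => by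
    have ht' := Ioo_subset_Icc_self ht
    have h2 : ‖η t - pm‖ ≤ K * t := by
      rw [← hη0, ← dist_eq_norm]
      refine (hη.dist_le_mul _ _).trans_eq ?_
      rw [Real.dist_eq, sub_zero, abs_of_pos ht.1]
    calc √(W (η t)) ≤ C₀ * ‖η t - pm‖ := hb₀ _ (hR t ht').1
      _ ≤ C₀ * (K * t) := by gcongr
      _ = (C₀ * K) * t := by ring
      _ ≤ C * t := mul_le_mul_of_nonneg_right
        (mul_le_mul (by linarith) (by linarith) K.2 (by linarith)) ht.1.le
  have hup1 : ∀ t ∈ Ioo (0 : ℝ) 1, √(W (η t)) ≤ C * (1 - t) := fun t ht => by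
    have ht' := Ioo_subset_Icc_self ht
    have h2 : ‖η t - pp‖ ≤ K * (1 - t) := by
      rw [← hη1, ← dist_eq_norm]
      refine (hη.dist_le_mul _ _).trans_eq ?_
      rw [Real.dist_eq, abs_of_neg (by linarith [ht.2])]
      ring
    calc √(W (η t)) ≤ C₁ * ‖η t - pp‖ := hb₁ _ (hR t ht').2
      _ ≤ C₁ * (K * (1 - t)) := by gcongr
      _ = (C₁ * K) * (1 - t) := by ring
      _ ≤ C * (1 - t) := mul_le_mul_of_nonneg_right
        (mul_le_mul (by linarith) (by linarith) K.2 (by linarith)) (by linarith [ht.2])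
  have hlow : ∀ t ∈ Ioo (0 : ℝ) 1, ∀ x, √(W (η t)) ≤ C * x → 1 / √2 * (L / C) ≤ x * f t := by
    intro t ht x hx
    have hp := hWpos t ht
    have : L / C ≤ x * (L / √(W (η t))) := by
      rw [mul_div_assoc', div_le_div_iff₀ hCpos hp]
      nlinarith
    calc 1 / √2 * (L / C) ≤ 1 / √2 * (x * (L / √(W (η t)))) := by gcongr
      _ = x * f t := by rw [hf]; ring
  obtain ⟨hbij, T, hT, hmem, hyT, hmono, hrange, hder, htop, hbot⟩ := exists_time_change
    (c := 1 / √2 * (L / C)) (by positivity) hy (fun t ht => hlow t ht t (hup0 t ht))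
    (fun t ht => hlow t ht (1 - t) (hup1 t ht))
  refine ⟨hbij, η, K, T, L, hLpos, hη, heq, ?_, hsp, ?_⟩
  · ext1 v
    rw [reparam, ← hT, heq (Ioo_subset_Icc_self (hmem v))]
    rfl
  refine ⟨hmem, hmono, hrange, fun v => ?_, fun v => ?_, ⟨√2 * C / L, fun v => ?_⟩, htop, hbot, ?_⟩
  · convert hder v using 1
    rw [hf]
    have := (hWpos _ (hmem v)).ne'
    field_simp
  · have := hWpos _ (hmem v)
    positivity
  · have h2 := hup0 _ (hmem v)
    have : √(W (η (T v))) ≤ C := h2.trans (mul_le_of_le_one_right hCpos.le (hmem v).2.le)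
    gcongr
  · intro p hp
    rw [ae_iff] at hp ⊢
    -- The preimage of a null set under T is contained in its image under the differentiable
    -- function `newParam W γ`, and differentiable images of null sets are null.
    have hsub : {v | ¬ p (T v)} ⊆ newParam W γ '' {t | ¬ (t ∈ Ioo (0 : ℝ) 1 → p t)} := fun v hv =>
      ⟨T v, fun h => hv (h (hmem v)), hyT v⟩
    refine measure_mono_null hsub
      (addHaar_image_eq_zero_of_differentiableOn_of_addHaar_eq_zero volume ?_ hp)
    intro t ht
    have ht' : t ∈ Ioo (0 : ℝ) 1 := by
      by_contra h
      exact ht fun h' => absurd h' h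
    exact (hy t ht').differentiableAt.differentiableWithinAt

/-! ### The reparametrized curve -/

theorem TimeChange.exists_lipschitz {T g : ℝ → ℝ} (hT : TimeChange T g) :
    ∃ K, LipschitzWith K T := by
  obtain ⟨K, hK⟩ := hT.bounded
  refine ⟨K.toNNReal, lipschitzWith_of_nnnorm_deriv_le
    (fun v => (hT.hasDerivAt v).differentiableAt) fun v => ?_⟩
  rw [(hT.hasDerivAt v).deriv, ← NNReal.coe_le_coe, coe_nnnorm, Real.norm_of_nonneg (hT.pos v).le]
  exact (hK v).trans (Real.le_coe_toNNReal K)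

theorem TimeChange.integral_comp {T g : ℝ → ℝ} (hT : TimeChange T g) (h : ℝ → ℝ) {a b : ℝ}
    (hab : a ≤ b) : ∫ v in a..b, g v * h (T v) = ∫ t in T a..T b, h t := by
  rw [intervalIntegral.integral_of_le hab, intervalIntegral.integral_of_le (hT.mono.monotone hab),
    ← integral_Icc_eq_integral_Ioc, ← integral_Icc_eq_integral_Ioc]
  exact integral_Icc_deriv_smul_of_deriv_nonneg
    (fun v _ => (hT.hasDerivAt v).continuousAt.continuousWithinAt)
    (fun v _ => hT.hasDerivAt v) (fun v _ => (hT.pos v).le) hab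

theorem TimeChange.lintegral_comp {T g : ℝ → ℝ} (hT : TimeChange T g) (h : ℝ → ℝ≥0∞) :
    ∫⁻ v, ENNReal.ofReal (g v) * h (T v) = ∫⁻ t in Ioo 0 1, h t := by
  rw [← hT.range_eq, ← image_univ, lintegral_image_eq_lintegral_deriv_mul_of_monotoneOn
    MeasurableSet.univ (fun v _ => (hT.hasDerivAt v).hasDerivWithinAt)
    (hT.mono.monotone.monotoneOn _), Measure.restrict_univ]

section Reparam

variable {W : Plane → ℝ} {pm pp : Plane} {η : ℝ → Plane} {K : NNReal} {T : ℝ → ℝ} {L : ℝ}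

/-- Differentiability of η fails only on a null set of times, which T pulls back to a null set;
elsewhere the chain rule applies. -/
theorem TimeChange.ae_deriv {g : ℝ → ℝ} (hT : TimeChange T g) (hη : LipschitzWith K η)
    (hsp : ∀ᵐ t, t ∈ Ioo (0 : ℝ) 1 → ‖deriv η t‖ = L) :
    ∀ᵐ v, deriv (η ∘ T) v = g v • deriv η (T v) ∧ ‖deriv η (T v)‖ = L := by
  have h := hT.ae_comp (fun t => DifferentiableAt ℝ η t ∧ ‖deriv η t‖ = L) (by
    filter_upwards [hsp, hη.ae_differentiableAt_real] with t h1 h2 ht using ⟨h2, h1 ht⟩)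
  filter_upwards [h] with v hv
  exact ⟨(hv.1.hasDerivAt.scomp v (hT.hasDerivAt v)).deriv, hv.2⟩

theorem TimeChange.ae_norm_deriv (hT : TimeChange T (fun v => √2 * √(W (η (T v))) / L))
    (hη : LipschitzWith K η) (hL : 0 < L)
    (hsp : ∀ᵐ t, t ∈ Ioo (0 : ℝ) 1 → ‖deriv η t‖ = L) :
    ∀ᵐ v, ‖deriv (η ∘ T) v‖ = √2 * √(W ((η ∘ T) v)) := by
  filter_upwards [hT.ae_deriv hη hsp] with v hv
  rw [hv.1, norm_smul, Real.norm_of_nonneg (hT.pos v).le, hv.2, Function.comp_apply]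
  field_simp

/-- Over a finite interval the integral equals that of η between the times T a and T b, which tend
to 0 and 1. Continuity of the primitive gives the improper integral, without integrability on the
line. -/
theorem TimeChange.hasLineArea {g : ℝ → ℝ} (hT : TimeChange T g) (hη : LipschitzWith K η)
    (hsp : ∀ᵐ t, t ∈ Ioo (0 : ℝ) 1 → ‖deriv η t‖ = L) : HasLineArea (η ∘ T) (area η) := by
  have hcont : Continuous fun t => ∫ τ in (0 : ℝ)..t, η τ 1 * deriv η τ 0 :=
    intervalIntegral.continuous_primitive (lip_intervalIntegrable_area hη) 0
  have hint := lip_intervalIntegrable_area hη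
  have h1 : Tendsto (fun q : ℝ × ℝ => -((∫ τ in (0 : ℝ)..T q.2, η τ 1 * deriv η τ 0) -
      ∫ τ in (0 : ℝ)..T q.1, η τ 1 * deriv η τ 0)) (atBot ×ˢ atTop)
      (𝓝 (-((∫ τ in (0 : ℝ)..1, η τ 1 * deriv η τ 0) -
        ∫ τ in (0 : ℝ)..0, η τ 1 * deriv η τ 0))) :=
    (((hcont.tendsto 1).comp (hT.tendsto_atTop.comp tendsto_snd)).sub
      ((hcont.tendsto 0).comp (hT.tendsto_atBot.comp tendsto_fst))).neg
  rw [intervalIntegral.integral_same, sub_zero] at h1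
  refine h1.congr' ?_
  have hle : ∀ᶠ q : ℝ × ℝ in atBot ×ˢ atTop, q.1 ≤ q.2 := by
    filter_upwards [(eventually_le_atBot (0 : ℝ)).prod_mk (eventually_ge_atTop (0 : ℝ))] with q hq
    exact hq.1.trans hq.2
  filter_upwards [hle] with q hq
  rw [intervalIntegral.integral_interval_sub_left (hint _ _) (hint _ _),
    ← hT.integral_comp (fun τ => η τ 1 * deriv η τ 0) hq]
  congr 1
  refine intervalIntegral.integral_congr_ae ?_
  filter_upwards [hT.ae_deriv hη hsp] with v hv _
  rw [hv.1, PiLp.smul_apply, smul_eq_mul, Function.comp_apply]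
  ring

/-- With |U'| = √2 √W(U), the arithmetic-geometric inequality |U'|²/2 + W ≥ √2 √W |U'| is an
equality, and the right side is invariant under reparametrization. -/
theorem TimeChange.energy_eq (hW : DoubleWell W pm pp)
    (hT : TimeChange T (fun v => √2 * √(W (η (T v))) / L))
    (hη : LipschitzWith K η) (hL : 0 < L)
    (hsp : ∀ᵐ t, t ∈ Ioo (0 : ℝ) 1 → ‖deriv η t‖ = L) :
    energy W (η ∘ T) = ENNReal.ofReal (√2 * degLength W η) := by
  have h2 : (√2) ^ 2 = 2 := Real.sq_sqrt (by norm_num)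
  have h1 : energy W (η ∘ T) = ∫⁻ v, ENNReal.ofReal (√2 * √(W (η (T v))) / L) *
      ENNReal.ofReal (√2 * (√(W (η (T v))) * ‖deriv η (T v)‖)) := by
    refine lintegral_congr_ae ?_
    filter_upwards [hT.ae_norm_deriv hη hL hsp, hT.ae_deriv hη hsp] with v hv hv'
    rw [hv, hv'.2, ← ENNReal.ofReal_mul (hT.pos v).le, Function.comp_apply]
    congr 1
    have h3 : √(W (η (T v))) ^ 2 = W (η (T v)) := Real.sq_sqrt (hW.nonneg _)
    field_simp
    rw [h2, h3]
    ring
  rw [h1, hT.lintegral_comp (fun t => ENNReal.ofReal (√2 * (√(W (η t)) * ‖deriv η t‖))),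
    degLength, ← intervalIntegral.integral_const_mul, intervalIntegral.integral_of_le zero_le_one,
    integral_Ioc_eq_integral_Ioo, ← ofReal_integral_eq_lintegral_ofReal]
  · have := (lip_intervalIntegrable_length hη hW.continuous 0 1).const_mul √2
    rw [intervalIntegrable_iff_integrableOn_Ioo_of_le zero_le_one] at this
    exact this
  · exact Eventually.of_forall fun t => by positivity

theorem exists_smooth_transition (pm pp : Plane) : ∃ g : ℝ → Plane, ContDiff ℝ ∞ g ∧
    (∀ y, 1 ≤ y → g y = pp) ∧ ∀ y, y ≤ 0 → g y = pm := by
  refine ⟨fun y => pm + Real.smoothTransition y • (pp - pm), ?_, fun y hy => ?_, fun y hy => ?_⟩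
  · exact contDiff_const.add (Real.smoothTransition.contDiff.smul contDiff_const)
  · simp [Real.smoothTransition.one_of_one_le hy]
  · simp [Real.smoothTransition.zero_of_nonpos hy]

theorem deriv_eq_zero_of_transition {g : ℝ → Plane} (h1 : ∀ y, 1 ≤ y → g y = pp)
    (h0 : ∀ y, y ≤ 0 → g y = pm) {y : ℝ} (hy : y ∉ Icc (0 : ℝ) 1) : deriv g y = 0 := by
  rcases lt_or_ge y 0 with h | h
  · have : g =ᶠ[𝓝 y] fun _ => pm := by
      filter_upwards [Iio_mem_nhds h] with z hz using h0 z (le_of_lt hz)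
    rw [this.deriv_eq, deriv_const]
  · have h' : 1 < y := not_le.1 fun h' => hy ⟨h, h'⟩
    have : g =ᶠ[𝓝 y] fun _ => pp := by
      filter_upwards [Ioi_mem_nhds h'] with z hz using h1 z (le_of_lt hz)
    rw [this.deriv_eq, deriv_const]

/-- A Lipschitz curve connecting the wells with finite potential and kinetic energy lies in
`g + H¹`. -/
theorem memH1_sub_of_integrable (hW : DoubleWell W pm pp) {u : ℝ → Plane} (hu : LipschitzWith K u)
    (hp : Tendsto u atTop (𝓝 pp)) (hm : Tendsto u atBot (𝓝 pm))
    (hint : Integrable fun y => W (u y)) (hint' : Integrable fun y => ‖deriv u y‖ ^ 2) {g : ℝ → Plane}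
    (hg : ContDiff ℝ ∞ g) (h1 : ∀ y, 1 ≤ y → g y = pp) (h0 : ∀ y, y ≤ 0 → g y = pm) :
    MemH1 (u - g) := by
  have hgc : HasCompactSupport (deriv g) := HasCompactSupport.of_support_subset_isCompact
    isCompact_Icc fun y hy => by
      by_contra h
      exact hy (deriv_eq_zero_of_transition h1 h0 h)
  have hgd : Continuous (deriv g) := hg.continuous_deriv (by simp)
  obtain ⟨C, hC⟩ := hgc.exists_bound_of_continuous hgd
  have hgl : LipschitzWith C.toNNReal g := lipschitzWith_of_nnnorm_deriv_le
    (hg.differentiable (by simp)) fun y => by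
      rw [← NNReal.coe_le_coe, coe_nnnorm]
      exact (hC y).trans (Real.le_coe_toNNReal C)
  have hcont : Continuous (u - g) := (hu.sub hgl).continuous
  refine ⟨fun a b => (hu.sub hgl).ac a b, ?_, ?_⟩
  · rw [memLp_two_iff_integrable_sq_norm hcont.aestronglyMeasurable]
    obtain ⟨c, hc, C', -, r, hr, hb⟩ := hW.exists_bounds
    -- Near infinity the integrable potential dominates the squared distance to the well; the
    -- remaining interval is compact.
    have hnear : ∀ p, (p = pm ∨ p = pp) → ∀ x, ‖x - p‖ ≤ r → ‖x - p‖ ^ 2 ≤ (c ^ 2)⁻¹ * W x := by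
      intro p hp x hx
      have h3 := (hb p hp x hx).1
      have h4 := pow_le_pow_left₀ (by positivity) h3 2
      rw [Real.sq_sqrt (hW.nonneg _), mul_pow] at h4
      rwa [← div_eq_inv_mul, le_div_iff₀' (by positivity)]
    have hsmall : ∀ p, ∀ x : Plane, x ∈ Metric.ball p r → ‖x - p‖ ≤ r := fun p x hx => by
      rw [← dist_eq_norm]
      exact (Metric.mem_ball.1 hx).le
    obtain ⟨b, hb'⟩ := eventually_atTop.1 (hp.eventually (Metric.ball_mem_nhds pp hr))
    obtain ⟨a, ha'⟩ := eventually_atBot.1 (hm.eventually (Metric.ball_mem_nhds pm hr))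
    have hi : Integrable (indicator (Icc (min a 0) (max b 1)) fun y => ‖(u - g) y‖ ^ 2) :=
      (integrable_indicator_iff measurableSet_Icc).2
        ((hcont.norm.pow 2).continuousOn.integrableOn_compact isCompact_Icc)
    refine ((hint.const_mul (c ^ 2)⁻¹).add hi).mono'
      (hcont.norm.pow 2).aestronglyMeasurable (Eventually.of_forall fun y => ?_)
    rw [Real.norm_of_nonneg (by positivity), Pi.add_apply]
    have hWy := hW.nonneg (u y)
    by_cases hy : y ∈ Icc (min a 0) (max b 1)
    · rw [indicator_of_mem hy]
      exact le_add_of_nonneg_left (by positivity)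
    rw [indicator_of_notMem hy, add_zero, Pi.sub_apply]
    rcases lt_or_ge y (min a 0) with h | h
    · rw [h0 y (h.le.trans (min_le_right _ _))]
      exact hnear pm (Or.inl rfl) _ (hsmall _ _ (ha' y (h.le.trans (min_le_left _ _))))
    · have h' : max b 1 < y := not_le.1 fun h' => hy ⟨h, h'⟩
      rw [h1 y ((le_max_right _ _).trans h'.le)]
      exact hnear pp (Or.inr rfl) _ (hsmall _ _ (hb' y ((le_max_left _ _).trans h'.le)))
  · have hd : deriv (u - g) =ᵐ[volume] deriv u - deriv g := by
      filter_upwards [hu.ae_differentiableAt_real] with y hy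
      rw [deriv_sub hy (hg.differentiable (by simp) y), Pi.sub_apply]
    refine MemLp.ae_eq hd.symm (MemLp.sub ?_ (hgd.memLp_of_hasCompactSupport hgc))
    exact (memLp_two_iff_integrable_sq_norm
      (measurable_deriv_plane u).aestronglyMeasurable).2 hint'

/-- The energy is finite, so W(U) is integrable, and then so is |U'|² = 2W(U). -/
theorem TimeChange.mem_lineClass (hW : DoubleWell W pm pp)
    (hT : TimeChange T (fun v => √2 * √(W (η (T v))) / L))
    (hη : LipschitzWith K η) (hη0 : η 0 = pm) (hη1 : η 1 = pp) (hL : 0 < L)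
    (hsp : ∀ᵐ t, t ∈ Ioo (0 : ℝ) 1 → ‖deriv η t‖ = L) :
    η ∘ T ∈ lineClass pm pp (area η) := by
  obtain ⟨g, hg, h1, h0⟩ := exists_smooth_transition pm pp
  obtain ⟨K', hK'⟩ := hT.exists_lipschitz
  have hu : LipschitzWith (K * K') (η ∘ T) := hη.comp hK'
  have htop : Tendsto (η ∘ T) atTop (𝓝 pp) := by
    rw [← hη1]
    exact (hη.continuous.tendsto 1).comp hT.tendsto_atTop
  have hbot : Tendsto (η ∘ T) atBot (𝓝 pm) := by
    rw [← hη0]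
    exact (hη.continuous.tendsto 0).comp hT.tendsto_atBot
  have hd := hT.ae_norm_deriv hη hL hsp
  have hWU : Integrable fun y => W ((η ∘ T) y) := by
    have hc : Continuous fun y => W ((η ∘ T) y) := hW.continuous.comp hu.continuous
    refine ⟨hc.aestronglyMeasurable, ?_⟩
    rw [hasFiniteIntegral_iff_ofReal (Eventually.of_forall fun y => hW.nonneg _)]
    refine lt_of_le_of_lt (b := energy W (η ∘ T))
      (lintegral_mono fun y => ENNReal.ofReal_le_ofReal ?_) ?_
    · exact le_add_of_nonneg_left (by positivity)
    · rw [hT.energy_eq hW hη hL hsp]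
      exact ENNReal.ofReal_lt_top
  refine ⟨⟨g, hg, eventually_atTop.2 ⟨1, h1⟩, eventually_atBot.2 ⟨0, h0⟩,
    memH1_sub_of_integrable hW hu htop hbot hWU ?_ hg h1 h0⟩, hT.hasLineArea hη hsp⟩
  refine (hWU.const_mul 2).congr ?_
  filter_upwards [hd] with y hy
  rw [hy, mul_pow, Real.sq_sqrt (by norm_num), Real.sq_sqrt (hW.nonneg _)]

end Reparam

/-! ### The energy on the line bounds the degenerate length -/

/-- Close to a well, there are connections of small energy and area. -/
theorem exists_small_segment {W : Plane → ℝ} (hW : ContDiff ℝ 2 W) (hnn : ∀ x, 0 ≤ W x) {p : Plane}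
    (hp : W p = 0) {ε : ℝ} (hε : 0 < ε) :
    ∃ ρ > 0, ∀ x : Plane, ‖x - p‖ < ρ → ∃ e a l, HasCurve W p x e a l ∧ e < ε ∧ |a| < ε := by
  obtain ⟨C, hC, hb⟩ := sqrt_le_near_zero hW hnn hp 1
  set D := C + 1 + |p 1| with hD
  have hDpos : 0 < D := by positivity
  refine ⟨min 1 (ε / D), by positivity, fun x hx => ?_⟩
  have hx1 : ‖x - p‖ ≤ 1 := hx.le.trans (min_le_left _ _)
  have hx2 : D * ‖x - p‖ < ε := (lt_div_iff₀' hDpos).1 (hx.trans_le (min_le_right _ _))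
  obtain ⟨e, a, h, he, ha⟩ := exists_segment_estimate hC.le
    (fun y hy => hb y (hy.trans hx1)) hW.continuous
  have hn := norm_nonneg (x - p)
  have hsq : ‖x - p‖ ^ 2 ≤ ‖x - p‖ := by nlinarith
  refine ⟨e, a, _, h, ?_, ?_⟩
  · refine lt_of_le_of_lt ?_ hx2
    calc e ≤ C * ‖x - p‖ := he.trans (by gcongr)
      _ ≤ D * ‖x - p‖ := by
        gcongr
        linarith [abs_nonneg (p 1)]
  · refine lt_of_le_of_lt ?_ hx2
    have h3 : |p 1 * (x 0 - p 0)| ≤ |p 1| * ‖x - p‖ := by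
      rw [abs_mul]
      gcongr
      exact abs_coord_le (x - p) 0
    calc |a| = |(a + p 1 * (x 0 - p 0)) - p 1 * (x 0 - p 0)| := by rw [add_sub_cancel_right]
      _ ≤ ‖x - p‖ + |p 1| * ‖x - p‖ := (abs_sub _ _).trans (add_le_add (ha.trans hsq) h3)
      _ = (1 + |p 1|) * ‖x - p‖ := by ring
      _ ≤ D * ‖x - p‖ := by
        gcongr
        linarith

/-- Approximation of absolutely continuous curves by Lipschitz curves. -/
theorem exists_hasCurve_near {W : Plane → ℝ} (hW : Continuous W) {u : ℝ → Plane} {a b : ℝ}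
    (hab : a ≤ b) (hu : AbsolutelyContinuousOnInterval u a b) {ε : ℝ} (hε : 0 < ε) :
    ∃ q e α l, HasCurve W (u a) q e α l ∧ ‖q - u b‖ < ε ∧
      |e - ∫ t in a..b, √(W (u t)) * ‖deriv u t‖| < ε ∧
      |α - -∫ t in a..b, u t 1 * deriv u t 0| < ε := by
  have hi := ac_intervalIntegrable_deriv hu
  -- The derivative is cut off at height n and integrated from u(a), which gives n-Lipschitz curves.
  -- Energies and areas converge by dominated convergence; the endpoint moves slightly.
  set v : ℕ → ℝ → Plane := fun n => indicator {t | ‖deriv u t‖ ≤ n} (deriv u) with hv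
  have hmeas : ∀ n, Measurable (v n) := fun n =>
    (measurable_deriv_plane u).indicator (measurableSet_le (measurable_deriv_plane u).norm
      measurable_const)
  have hvn : ∀ n t, ‖v n t‖ ≤ n := fun n t => by
    by_cases h : ‖deriv u t‖ ≤ n
    · rw [hv]
      simp only
      rwa [indicator_of_mem (show t ∈ {t | ‖deriv u t‖ ≤ n} from h)]
    · rw [hv]
      simp only
      rw [indicator_of_notMem (show t ∉ {t | ‖deriv u t‖ ≤ n} from h), norm_zero]
      positivity
  have hvu : ∀ n t, ‖v n t‖ ≤ ‖deriv u t‖ := fun n t => norm_indicator_le_norm_self _ _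
  have hlim : ∀ t, Tendsto (fun n => v n t) atTop (𝓝 (deriv u t)) := fun t => by
    refine tendsto_const_nhds.congr' ?_
    filter_upwards [eventually_ge_atTop ⌈‖deriv u t‖⌉₊] with n hn
    rw [hv]
    simp only
    have hmem : t ∈ {t | ‖deriv u t‖ ≤ n} := (Nat.le_ceil _).trans (Nat.cast_le.2 hn)
    rw [indicator_of_mem hmem]
  have hvi : ∀ n s t, IntervalIntegrable (v n) volume s t := fun n s t =>
    intervalIntegrable_of_bound (hmeas n).aestronglyMeasurable fun t _ => hvn n t
  set w : ℕ → ℝ → Plane := fun n t => u a + ∫ τ in a..t, v n τ with hw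
  have hwl : ∀ n : ℕ, LipschitzWith (n : NNReal) (w n) := fun n => by
    refine LipschitzWith.of_dist_le_mul fun s t => ?_
    rw [dist_eq_norm, hw]
    simp only
    rw [add_sub_add_left_eq_sub, intervalIntegral.integral_interval_sub_left (hvi _ _ _)
      (hvi _ _ _), Real.dist_eq]
    exact intervalIntegral.norm_integral_le_of_norm_le_const fun τ _ => hvn n τ
  have hwd : ∀ n, ∀ᵐ t, deriv (w n) t = v n t := fun n => by
    have hloc : LocallyIntegrable (v n) := fun x =>
      ⟨Icc (x - 1) (x + 1), Icc_mem_nhds (by linarith) (by linarith), by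
        have := hvi n (x - 1) (x + 1)
        rwa [intervalIntegrable_iff_integrableOn_Icc_of_le (by linarith)] at this⟩
    filter_upwards [LocallyIntegrable.ae_hasDerivAt_integral hloc] with t ht
    exact ((ht a).const_add (u a)).deriv
  have hsub : ∀ t ∈ Icc a b, uIcc a t ⊆ uIcc a b := fun t ht =>
    uIcc_subset_uIcc_left (by rwa [uIcc_of_le hab])
  have hwu : ∀ t ∈ Icc a b, Tendsto (fun n => w n t) atTop (𝓝 (u t)) := fun t ht => by
    have h1 : u t = u a + ∫ τ in a..t, deriv u τ := by
      rw [ac_integral_deriv (hu.mono (hsub t ht))]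
      abel
    rw [h1]
    refine Tendsto.const_add _ (intervalIntegral.tendsto_integral_filter_of_dominated_convergence
      (fun τ => ‖deriv u τ‖) (Eventually.of_forall fun n => (hmeas n).aestronglyMeasurable)
      (Eventually.of_forall fun n => Eventually.of_forall fun τ _ => hvu n τ)
      (hi.mono_set (hsub t ht)).norm (Eventually.of_forall fun τ _ => hlim τ))
  set R := ‖u a‖ + ∫ τ in a..b, ‖deriv u τ‖ with hR
  have hwR : ∀ n, ∀ t ∈ Icc a b, w n t ∈ Metric.closedBall (0 : Plane) R := fun n t ht => by
    rw [mem_closedBall_zero_iff]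
    refine (norm_add_le _ _).trans (add_le_add_right ?_ _)
    refine (intervalIntegral.norm_integral_le_integral_norm ht.1).trans ?_
    calc ∫ τ in a..t, ‖v n τ‖ ≤ ∫ τ in a..t, ‖deriv u τ‖ :=
          intervalIntegral.integral_mono_on ht.1 (hvi _ _ _).norm (hi.mono_set (hsub t ht)).norm
            fun τ _ => hvu n τ
      _ ≤ ∫ τ in a..b, ‖deriv u τ‖ := by
          rw [← intervalIntegral.integral_add_adjacent_intervals (hi.mono_set (hsub t ht)).norm
            (hi.mono_set (uIcc_subset_uIcc_right (by rwa [uIcc_of_le hab]))).norm]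
          exact le_add_of_nonneg_right
            (intervalIntegral.integral_nonneg ht.2 fun τ _ => norm_nonneg _)
  obtain ⟨M, hM⟩ := (isCompact_closedBall (0 : Plane) R).exists_bound_of_continuousOn
    hW.sqrt.continuousOn
  have hmem : ∀ t ∈ uIoc a b, t ∈ Icc a b := fun t ht => by
    rw [uIoc_of_le hab] at ht
    exact Ioc_subset_Icc_self ht
  have hE : Tendsto (fun n => ∫ t in a..b, √(W (w n t)) * ‖deriv (w n) t‖) atTop
      (𝓝 (∫ t in a..b, √(W (u t)) * ‖deriv u t‖)) := by
    refine intervalIntegral.tendsto_integral_filter_of_dominated_convergence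
      (fun τ => M * ‖deriv u τ‖) (Eventually.of_forall fun n => ?_)
      (Eventually.of_forall fun n => ?_) (hi.norm.const_mul M) ?_
    · exact ((hW.comp (hwl n).continuous).sqrt.aestronglyMeasurable.mul
        (aesm_norm_deriv (w n))).restrict
    · filter_upwards [hwd n] with t ht htm
      rw [norm_mul, norm_norm, ht]
      exact mul_le_mul (hM _ (hwR n t (hmem t htm))) (hvu n t) (norm_nonneg _)
        ((norm_nonneg _).trans (hM _ (hwR n t (hmem t htm))))
    · filter_upwards [ae_all_iff.2 hwd] with t ht htm
      simp only [ht]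
      exact ((hW.sqrt.tendsto _).comp (hwu t (hmem t htm))).mul (hlim t).norm
  have hA : Tendsto (fun n => ∫ t in a..b, w n t 1 * deriv (w n) t 0) atTop
      (𝓝 (∫ t in a..b, u t 1 * deriv u t 0)) := by
    refine intervalIntegral.tendsto_integral_filter_of_dominated_convergence
      (fun τ => R * ‖deriv u τ‖) (Eventually.of_forall fun n => ?_)
      (Eventually.of_forall fun n => ?_) (hi.norm.const_mul R) ?_
    · exact ((continuous_coord (hwl n).continuous 1).aestronglyMeasurable.mul
        (aesm_deriv_coord (w n) 0)).restrict
    · filter_upwards [hwd n] with t ht htm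
      rw [norm_mul, ht]
      have h3 := mem_closedBall_zero_iff.1 (hwR n t (hmem t htm))
      exact mul_le_mul ((abs_coord_le _ _).trans h3) ((abs_coord_le _ _).trans (hvu n t))
        (norm_nonneg _) ((norm_nonneg _).trans h3)
    · filter_upwards [ae_all_iff.2 hwd] with t ht htm
      simp only [ht]
      exact (((EuclideanSpace.proj (𝕜 := ℝ) (1 : Fin 2)).continuous.tendsto _).comp
        (hwu t (hmem t htm))).mul
        (((EuclideanSpace.proj (𝕜 := ℝ) (0 : Fin 2)).continuous.tendsto _).comp (hlim t))
  have hend := hwu b (right_mem_Icc.2 hab)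
  obtain ⟨n, hn1, hn2, hn3⟩ := ((Metric.tendsto_nhds.1 hend ε hε).and
    ((Metric.tendsto_nhds.1 hE ε hε).and (Metric.tendsto_nhds.1 hA.neg ε hε))).exists
  have hwa : w n a = u a := by simp [hw]
  refine ⟨w n b, _, _, _, hwa ▸ hasCurve_sub (W := W) (hwl n) a b hab, ?_, hn2, hn3⟩
  rwa [← dist_eq_norm]

/-- A square integrable function is frequently small at infinity. -/
theorem frequently_small {v : ℝ → Plane} (hv : MemLp v 2) {ρ : ℝ} (hρ : 0 < ρ) :
    (∃ᶠ y in atTop, ‖v y‖ < ρ) ∧ ∃ᶠ y in atBot, ‖v y‖ < ρ := by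
  have hfin : volume {y | ρ ≤ ‖v y‖} < ⊤ := by
    have := (hv.integrable_norm_pow two_ne_zero).measure_norm_ge_lt_top
      (show 0 < ρ ^ 2 by positivity)
    refine lt_of_le_of_lt (measure_mono fun y hy => ?_) this
    change ρ ^ 2 ≤ ‖‖v y‖ ^ _‖
    rw [Real.norm_of_nonneg (by positivity)]
    exact pow_le_pow_left₀ hρ.le hy 2
  constructor
  · intro h
    obtain ⟨b, hb⟩ := eventually_atTop.1 h
    have : Ici b ⊆ {y | ρ ≤ ‖v y‖} := fun y hy => not_lt.1 (hb y hy)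
    exact absurd ((measure_mono this).trans_lt hfin) (by simp)
  · intro h
    obtain ⟨b, hb⟩ := eventually_atBot.1 h
    have : Iic b ⊆ {y | ρ ≤ ‖v y‖} := fun y hy => not_lt.1 (hb y hy)
    exact absurd ((measure_mono this).trans_lt hfin) (by simp)

theorem smooth_ac {g : ℝ → Plane} (hg : ContDiff ℝ ∞ g) (a b : ℝ) :
    AbsolutelyContinuousOnInterval g a b := by
  obtain ⟨K, hK⟩ := (hg.of_le (by simp) : ContDiff ℝ 1 g).locallyLipschitz.locallyLipschitzOn
    (s := uIcc a b) |>.exists_lipschitzOnWith_of_compact isCompact_uIcc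
  exact hK.absolutelyContinuousOnInterval

theorem ac_of_mem_lineClass {pm pp : Plane} {A : ℝ} {u : ℝ → Plane} (hu : u ∈ lineClass pm pp A)
    (a b : ℝ) : AbsolutelyContinuousOnInterval u a b := by
  obtain ⟨⟨g, hg, -, -, hac, -, -⟩, -⟩ := hu
  simpa using (hac a b).add (smooth_ac hg a b)

theorem continuous_of_ac {u : ℝ → Plane} (hu : ∀ a b, AbsolutelyContinuousOnInterval u a b) :
    Continuous u := continuous_iff_continuousAt.2 fun x =>
  (hu (x - 1) (x + 1)).continuousOn.continuousAt (by
    rw [uIcc_of_le (by linarith)]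
    exact Icc_mem_nhds (by linarith) (by linarith))

/-- If perturbing the constraint does not lower the degenerate length below `E` to zeroth order,
then `√2 E` bounds the energy in the line class from below. -/
theorem DoubleWell.le_energy {W : Plane → ℝ} {pm pp : Plane} (hW : DoubleWell W pm pp) {A E k δ : ℝ}
    (hk : 0 ≤ k) (hδ : 0 < δ)
    (hstab : ∀ e a l, HasCurve W pm pp e a l → |a - A| ≤ δ → E ≤ e + k * |a - A|)
    {u : ℝ → Plane} (hu : u ∈ lineClass pm pp A) : ENNReal.ofReal (√2 * E) ≤ energy W u := by
  by_cases htop : energy W u = ⊤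
  · rw [htop]
    exact le_top
  have hac := ac_of_mem_lineClass hu
  have hc := continuous_of_ac hac
  obtain ⟨⟨g, hg, hgp, hgm, -, hL2, -⟩, harea⟩ := hu
  set h : ℝ → ℝ := fun y => 1 / 2 * ‖deriv u y‖ ^ 2 + W (u y) with hh
  have hnn : ∀ y, 0 ≤ h y := fun y => add_nonneg (by positivity) (hW.nonneg _)
  have hmeas : AEStronglyMeasurable h volume :=
    (((aesm_norm_deriv u).pow 2).const_mul _).add (hW.continuous.comp hc).aestronglyMeasurable
  have hint : Integrable h := ⟨hmeas, by
    rw [hasFiniteIntegral_iff_ofReal (Eventually.of_forall hnn)]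
    exact lt_top_iff_ne_top.2 htop⟩
  have hen : energy W u = ENNReal.ofReal (∫ y, h y) :=
    (ofReal_integral_eq_lintegral_ofReal hint (Eventually.of_forall hnn)).symm
  rw [hen]
  refine ENNReal.ofReal_le_ofReal (le_of_forall_pos_le_add fun ε hε => ?_)
  set κ := √2 * (3 + 4 * k) with hκ
  have hκpos : 0 < κ := by positivity
  set ε' := min (δ / 4) (ε / κ) with hε'
  have hε'pos : 0 < ε' := by positivity
  have h4 : 4 * ε' ≤ δ := by linarith [min_le_left (δ / 4) (ε / κ)]
  have h5 : κ * ε' ≤ ε := (le_div_iff₀' hκpos).1 (min_le_right _ _)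
  obtain ⟨ρm, hρm, hsm⟩ := exists_small_segment hW.contDiff hW.nonneg hW.zero_left hε'pos
  obtain ⟨ρp, hρp, hsp⟩ := exists_small_segment hW.contDiff hW.nonneg hW.zero_right hε'pos
  -- u is truncated at times a and b at which it is close to the wells and the truncated area is
  -- close to A. The result is replaced by a Lipschitz curve and closed up by short segments.
  obtain ⟨P, hP, Q, hQ, hPQ⟩ := (eventually_prod_iff.1 (Metric.tendsto_nhds.1 harea ε' hε'pos))
  obtain ⟨a, ham, ⟨haP, ha0⟩, hga⟩ := ((frequently_small hL2 hρm).2.and_eventually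
    ((hP.and (eventually_le_atBot (0 : ℝ))).and hgm)).exists
  -- Half of the radius is left for the displacement of the endpoint by the Lipschitz approximation.
  obtain ⟨b, hbm, ⟨hbQ, hb0⟩, hgb⟩ := ((frequently_small hL2 (half_pos hρp)).1.and_eventually
    ((hQ.and (eventually_ge_atTop (0 : ℝ))).and hgp)).exists
  rw [Pi.sub_apply, hga] at ham
  rw [Pi.sub_apply, hgb] at hbm
  have hab : a ≤ b := ha0.trans hb0
  obtain ⟨q, e, α, l, hcur, hq, he, hα⟩ := exists_hasCurve_near hW.continuous hab (hac a b)
    (show 0 < min ε' (ρp / 2) by positivity)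
  have hqp : ‖q - pp‖ < ρp := by
    calc ‖q - pp‖ = ‖(q - u b) + (u b - pp)‖ := by rw [sub_add_sub_cancel]
      _ < ρp / 2 + ρp / 2 :=
        (norm_add_le _ _).trans_lt (add_lt_add (hq.trans_le (min_le_right _ _)) hbm)
      _ = ρp := add_halves _
  obtain ⟨e₁, a₁, l₁, hc₁, he₁, ha₁⟩ := hsm (u a) ham
  obtain ⟨e₂, a₂, l₂, hc₂, he₂, ha₂⟩ := hsp q hqp
  have hall := (hc₁.trans hW.continuous hcur).trans hW.continuous hc₂.symm
  have hPQ' := hPQ haP hbQ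
  rw [Real.dist_eq] at hPQ'
  have hα' := hα.trans_le (min_le_left _ _)
  have he' := he.trans_le (min_le_left _ _)
  -- One ε' each for the truncation, the approximation and the two segments. The constraint is met
  -- only approximately, which is why the stability hypothesis is needed.
  have hdiff : |a₁ + α + -a₂ - A| ≤ 4 * ε' := by
    have e1 := abs_lt.1 hPQ'
    have e2 := abs_lt.1 hα'
    have e3 := abs_lt.1 ha₁
    have e4 := abs_lt.1 ha₂
    simp only at e1
    rw [abs_le]
    constructor <;> linarith
  have hfin := hstab _ _ _ hall (hdiff.trans h4)
  set I := ∫ t in a..b, √(W (u t)) * ‖deriv u t‖ with hI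
  have hle : E ≤ I + (3 + 4 * k) * ε' := by
    have := mul_le_mul_of_nonneg_left hdiff hk
    have := (abs_lt.1 he').2
    linarith
  have h2 : (√2) ^ 2 = 2 := Real.sq_sqrt (by norm_num)
  have hIi : IntervalIntegrable (fun t => √(W (u t)) * ‖deriv u t‖) volume a b :=
    (ac_intervalIntegrable_deriv (hac a b)).norm.continuousOn_mul
      (hW.continuous.comp hc).sqrt.continuousOn
  have hIle : √2 * I ≤ ∫ y, h y := by
    calc √2 * I = ∫ t in a..b, √2 * (√(W (u t)) * ‖deriv u t‖) :=
          (intervalIntegral.integral_const_mul _ _).symm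
      _ ≤ ∫ t in a..b, h t := by
          refine intervalIntegral.integral_mono_on hab (hIi.const_mul _) hint.intervalIntegrable
            fun t _ => ?_
          have h6 : √(W (u t)) ^ 2 = W (u t) := Real.sq_sqrt (hW.nonneg _)
          have h7 := sq_nonneg (√2 * √(W (u t)) - ‖deriv u t‖)
          have h8 : (√2 * √(W (u t)) - ‖deriv u t‖) ^ 2 = 2 * W (u t) -
              2 * (√2 * (√(W (u t)) * ‖deriv u t‖)) + ‖deriv u t‖ ^ 2 := by
            rw [sub_sq, mul_pow, h2, h6]
            ring
          rw [hh]
          linarith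
      _ ≤ ∫ y, h y := by
          rw [intervalIntegral.integral_of_le hab]
          exact setIntegral_le_integral hint (Eventually.of_forall hnn)
  calc √2 * E ≤ √2 * (I + (3 + 4 * k) * ε') := by gcongr
    _ = √2 * I + κ * ε' := by rw [hκ]; ring
    _ ≤ (∫ y, h y) + ε := add_le_add hIle h5

/-! ### Compactly supported Lipschitz test functions -/

/-- Lipschitz functions vanishing outside `(-n, n)`. -/
structure IsTest (n : ℝ) (φ : ℝ → Plane) : Prop where
  lipschitz : ∃ K, LipschitzWith K φ
  zero : ∀ t, t ∉ Ioo (-n) n → φ t = 0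

namespace IsTest

variable {n m : ℝ} {φ ψ : ℝ → Plane}

theorem mono (h : IsTest n φ) (hnm : n ≤ m) : IsTest m φ :=
  ⟨h.lipschitz, fun t ht => h.zero t fun ht' => ht ⟨by linarith [ht'.1], ht'.2.trans_le hnm⟩⟩

theorem add_smul (h : IsTest n φ) (h' : IsTest n ψ) (s τ : ℝ) :
    IsTest n (s • φ + τ • ψ) := by
  obtain ⟨⟨K, hK⟩, h0⟩ := h
  obtain ⟨⟨L, hL⟩, h0'⟩ := h'
  refine ⟨⟨‖s‖₊ * K + ‖τ‖₊ * L, ?_⟩, fun t ht => by simp [h0 t ht, h0' t ht]⟩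
  exact ((lipschitzWith_smul s).comp hK).add ((lipschitzWith_smul τ).comp hL)

theorem deriv_zero (h : IsTest n φ) {t : ℝ} (ht : t ∉ Icc (-n) n) : deriv φ t = 0 := by
  have : φ =ᶠ[𝓝 t] fun _ => 0 := by
    filter_upwards [isClosed_Icc.isOpen_compl.mem_nhds ht] with y hy using
      h.zero y fun hy' => hy (Ioo_subset_Icc_self hy')
  rw [this.deriv_eq, deriv_const]

theorem zero' (h : IsTest n φ) {t : ℝ} (ht : t ∉ Icc (-n) n) : φ t = 0 :=
  h.zero t fun ht' => ht (Ioo_subset_Icc_self ht')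

theorem exists_bound (h : IsTest n φ) :
    ∃ B > 0, ∀ t, ‖φ t‖ ≤ B ∧ ‖deriv φ t‖ ≤ B := by
  obtain ⟨K, hK⟩ := h.lipschitz
  have hb : HasCompactSupport φ := HasCompactSupport.of_support_subset_isCompact
    (isCompact_Icc (a := -n) (b := n)) fun y hy => by
      by_contra h'
      exact hy (h.zero' h')
  obtain ⟨C, hC⟩ := hb.exists_bound_of_continuous hK.continuous
  refine ⟨max C K + 1, ?_, fun t => ⟨?_, ?_⟩⟩
  · exact add_pos_of_nonneg_of_pos (K.2.trans (le_max_right _ _)) one_pos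
  · exact (hC t).trans ((le_max_left _ _).trans (by linarith))
  · exact (lip_norm_deriv_le hK t).trans ((le_max_right _ _).trans (by linarith))

theorem ae_deriv_add_smul (h : IsTest n φ) (h' : IsTest n ψ) (s τ : ℝ) :
    ∀ᵐ t, deriv (s • φ + τ • ψ) t = s • deriv φ t + τ • deriv ψ t := by
  obtain ⟨K, hK⟩ := h.lipschitz
  obtain ⟨L, hL⟩ := h'.lipschitz
  filter_upwards [hK.ae_differentiableAt_real, hL.ae_differentiableAt_real] with t h1 h2
  exact ((h1.hasDerivAt.const_smul s).add (h2.hasDerivAt.const_smul τ)).deriv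

/-- Integrability of functions vanishing outside a compact interval. -/
theorem integrable_of_bound {E : Type*} [NormedAddCommGroup E] {f : ℝ → E} {g : ℝ → ℝ}
    (hf : AEStronglyMeasurable f volume) (h0 : ∀ t, t ∉ Icc (-n) n → f t = 0)
    (hg : LocallyIntegrable g) (hfg : ∀ t ∈ Icc (-n) n, ‖f t‖ ≤ g t) : Integrable f := by
  rw [← integrableOn_iff_integrable_of_support_subset (s := Icc (-n) n) fun t ht => by
    by_contra h
    exact ht (h0 t h)]
  refine Integrable.mono' (hg.integrableOn_isCompact isCompact_Icc) hf.restrict ?_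
  rw [ae_restrict_iff' measurableSet_Icc]
  exact Eventually.of_forall hfg

theorem integrable_inner_deriv (h : IsTest n φ) {G : ℝ → Plane} (hG : LocallyIntegrable G) :
    Integrable fun t => inner ℝ (G t) (deriv φ t) := by
  obtain ⟨B, hB, hb⟩ := h.exists_bound
  refine integrable_of_bound (n := n) (g := fun t => ‖G t‖ * B)
    (hG.aestronglyMeasurable.inner (measurable_deriv_plane φ).aestronglyMeasurable)
    (fun t ht => by rw [h.deriv_zero ht, inner_zero_right]) ?_
    fun t _ => (norm_inner_le_norm _ _).trans (by gcongr; exact (hb t).2)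
  intro x
  obtain ⟨u, hu, hi⟩ := hG x
  exact ⟨u, hu, hi.norm.mul_const B⟩

theorem integrable_inner (h : IsTest n φ) {G : ℝ → Plane} (hG : LocallyIntegrable G) :
    Integrable fun t => inner ℝ (G t) (φ t) := by
  obtain ⟨B, hB, hb⟩ := h.exists_bound
  obtain ⟨K, hK⟩ := h.lipschitz
  refine integrable_of_bound (n := n) (g := fun t => ‖G t‖ * B)
    (hG.aestronglyMeasurable.inner hK.continuous.aestronglyMeasurable)
    (fun t ht => by rw [h.zero' ht, inner_zero_right]) ?_
    fun t _ => (norm_inner_le_norm _ _).trans (by gcongr; exact (hb t).1)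
  intro x
  obtain ⟨u, hu, hi⟩ := hG x
  exact ⟨u, hu, hi.norm.mul_const B⟩

theorem integral_inner_add_smul (h : IsTest n φ) (h' : IsTest n ψ) {G : ℝ → Plane}
    (hG : LocallyIntegrable G) (s τ : ℝ) :
    ∫ t, inner ℝ (G t) (deriv (s • φ + τ • ψ) t) =
      s * (∫ t, inner ℝ (G t) (deriv φ t)) + τ * ∫ t, inner ℝ (G t) (deriv ψ t) := by
  rw [← integral_const_mul, ← integral_const_mul, ← integral_add
    ((h.integrable_inner_deriv hG).const_mul s) ((h'.integrable_inner_deriv hG).const_mul τ)]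
  refine integral_congr_ae ?_
  filter_upwards [h.ae_deriv_add_smul h' s τ] with t ht
  rw [ht, inner_add_right, inner_smul_right, inner_smul_right]

theorem integral_eq_interval {E : Type*} [NormedAddCommGroup E] [NormedSpace ℝ E] {f : ℝ → E}
    (h0 : ∀ t, t ∉ Icc (-n) n → f t = 0) {a b : ℝ} (ha : a < -n) (hb : n ≤ b) :
    ∫ t, f t = ∫ t in a..b, f t :=
  (intervalIntegral.integral_eq_integral_of_support_subset fun t ht => by
    have : t ∈ Icc (-n) n := by
      by_contra h
      exact ht (h0 t h)
    exact ⟨ha.trans_le this.1, this.2.trans hb⟩).symm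

/-- Integration by parts against test functions. -/
theorem integral_deriv_inner (h : IsTest n φ) {F : ℝ → Plane}
    (hF : ∀ a b, AbsolutelyContinuousOnInterval F a b) :
    ∫ t, inner ℝ (deriv F t) (φ t) = -∫ t, inner ℝ (F t) (deriv φ t) := by
  obtain ⟨K, hK⟩ := h.lipschitz
  set N := |n| + 1
  have hn := le_abs_self n
  have hn' := neg_abs_le n
  have hN0 : φ N = 0 := h.zero N fun h' => by linarith [h'.2]
  have hN0' : φ (-N) = 0 := h.zero (-N) fun h' => by linarith [h'.1]
  rw [integral_eq_interval (a := -N) (b := N) (n := n)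
      (fun t ht => by rw [h.zero' ht, inner_zero_right]) (by linarith) (by linarith),
    integral_eq_interval (a := -N) (b := N) (n := n)
      (fun t ht => by rw [h.deriv_zero ht, inner_zero_right]) (by linarith) (by linarith)]
  have hφ := hK.ac (-N) N
  have key : ∀ i : Fin 2, ∫ t in (-N)..N, deriv F t i * φ t i =
      -∫ t in (-N)..N, F t i * deriv φ t i := fun i => by
    have h1 := (ac_coord (hF (-N) N) i).integral_mul_deriv_eq_deriv_mul (ac_coord hφ i)
    simp only [hN0, hN0', PiLp.zero_apply, mul_zero, sub_zero, zero_sub] at h1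
    have h2 : ∫ t in (-N)..N, F t i * deriv φ t i =
        ∫ t in (-N)..N, F t i * deriv (fun s => φ s i) t := by
      refine intervalIntegral.integral_congr_ae ?_
      filter_upwards [ac_ae_deriv_coord hφ i] with t ht ht'
      rw [ht ht']
    have h3 : ∫ t in (-N)..N, deriv F t i * φ t i =
        ∫ t in (-N)..N, deriv (fun s => F s i) t * φ t i := by
      refine intervalIntegral.integral_congr_ae ?_
      filter_upwards [ac_ae_deriv_coord (hF (-N) N) i] with t ht ht'
      rw [ht ht']
    rw [h2, h3, h1, neg_neg]
  have hi : ∀ i : Fin 2, IntervalIntegrable (fun t => deriv F t i * φ t i) volume (-N) N := fun i =>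
    (intervalIntegrable_plane_iff.1 (ac_intervalIntegrable_deriv (hF _ _)) i).mul_continuousOn
      (continuous_coord hK.continuous i).continuousOn
  have hi' : ∀ i : Fin 2, IntervalIntegrable (fun t => F t i * deriv φ t i) volume (-N) N :=
    fun i => lip_mul_coord_deriv hK ((ac_coord (hF (-N) N) i).continuousOn) i
  have e1 : ∀ x y : Plane, inner ℝ x y = x 0 * y 0 + x 1 * y 1 := fun x y => by
    simp [PiLp.inner_apply, Fin.sum_univ_two, mul_comm]
  simp only [e1]
  rw [intervalIntegral.integral_add (hi 0) (hi 1), intervalIntegral.integral_add (hi' 0) (hi' 1),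
    key, key]
  ring

end IsTest

/-- The lemma of du Bois-Reymond. -/
theorem exists_ae_eq_const_of_integral_inner_deriv {n : ℝ} (hn : 0 < n) {G : ℝ → Plane}
    (hG : LocallyIntegrable G) {C : ℝ} (hC : ∀ t ∈ Icc (-n) n, ‖G t‖ ≤ C)
    (h : ∀ φ, IsTest n φ → ∫ t, inner ℝ (G t) (deriv φ t) = 0) :
    ∃ m, ∀ᵐ t, t ∈ Ioo (-n) n → G t = m := by
  have hGi : IntervalIntegrable G volume (-n) n := intervalIntegrable_iff.2
    ((hG.integrableOn_isCompact isCompact_uIcc).mono_set uIoc_subset_uIcc)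
  set m := (1 / (2 * n)) • ∫ t in (-n)..n, G t with hm
  have hm0 : ∫ t in (-n)..n, (G t - m) = 0 := by
    rw [intervalIntegral.integral_sub hGi intervalIntegrable_const, intervalIntegral.integral_const,
      hm, smul_smul, show (n - -n) * (1 / (2 * n)) = 1 by field_simp; ring, one_smul, sub_self]
  set H : ℝ → Plane := indicator (Ioc (-n) n) fun t => G t - m with hH
  have hHm : AEStronglyMeasurable H volume :=
    (hG.aestronglyMeasurable.sub aestronglyMeasurable_const).indicator measurableSet_Ioc
  have hHb : ∀ t, ‖H t‖ ≤ |C| + ‖m‖ := fun t => by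
    by_cases ht : t ∈ Ioc (-n) n
    · rw [hH, indicator_of_mem ht]
      exact (norm_sub_le _ _).trans (add_le_add_left
        ((hC t (Ioc_subset_Icc_self ht)).trans (le_abs_self C)) _)
    · rw [hH, indicator_of_notMem ht, norm_zero]
      positivity
  have hHi : ∀ a b, IntervalIntegrable H volume a b := fun a b =>
    intervalIntegrable_of_bound hHm fun t _ => hHb t
  have hHn : ∫ t in (-n)..n, H t = 0 := by
    rw [← hm0]
    refine intervalIntegral.integral_congr_ae (Eventually.of_forall fun t ht => ?_)
    rw [uIoc_of_le (by linarith)] at ht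
    rw [hH, indicator_of_mem ht]
  have hz : ∀ a b, (∀ t ∈ uIoc a b, t ∉ Ioc (-n) n) → ∫ t in a..b, H t = 0 := fun a b hab => by
    rw [← intervalIntegral.integral_zero (a := a) (b := b) (E := Plane) (μ := volume)]
    refine intervalIntegral.integral_congr_ae (Eventually.of_forall fun t ht => ?_)
    rw [hH, indicator_of_notMem (hab t ht)]
  -- The test function is the primitive of G minus its mean; subtracting the mean makes it vanish at
  -- n. Pairing its derivative with G gives the integral of |G - m|².
  set φ : ℝ → Plane := fun t => ∫ τ in (-n)..t, H τ with hφ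
  have hφtest : IsTest n φ := by
    refine ⟨⟨⟨|C| + ‖m‖, by positivity⟩, LipschitzWith.of_dist_le_mul fun s t => ?_⟩, fun t ht => ?_⟩
    · rw [dist_eq_norm, hφ]
      simp only
      rw [intervalIntegral.integral_interval_sub_left (hHi _ _) (hHi _ _), Real.dist_eq]
      exact intervalIntegral.norm_integral_le_of_norm_le_const fun τ _ => hHb τ
    · rw [hφ]
      simp only
      rcases le_or_gt t (-n) with h' | h'
      · refine hz _ _ fun τ hτ hτ' => ?_
        rw [uIoc_of_ge h'] at hτ
        exact absurd hτ.2 (not_le.2 hτ'.1)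
      · have h'' : n ≤ t := not_lt.1 fun h'' => ht ⟨h', h''⟩
        rw [← intervalIntegral.integral_add_adjacent_intervals (hHi (-n) n) (hHi n t), hHn, zero_add]
        refine hz _ _ fun τ hτ hτ' => ?_
        rw [uIoc_of_le h''] at hτ
        exact absurd hτ.1 (not_lt.2 hτ'.2)
  have hloc : LocallyIntegrable H := fun x =>
    ⟨Icc (x - 1) (x + 1), Icc_mem_nhds (by linarith) (by linarith), by
      have := hHi (x - 1) (x + 1)
      rwa [intervalIntegrable_iff_integrableOn_Icc_of_le (by linarith)] at this⟩
  have hφd : ∀ᵐ t, deriv φ t = H t := by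
    filter_upwards [LocallyIntegrable.ae_hasDerivAt_integral hloc] with t ht
    exact (ht (-n)).deriv
  have hHint : Integrable H := by
    refine IsTest.integrable_of_bound (n := n) hHm (fun t ht => ?_)
      (locallyIntegrable_const (|C| + ‖m‖)) fun t _ => hHb t
    rw [hH, indicator_of_notMem fun h' => ht (Ioc_subset_Icc_self h')]
  have hHtot : ∫ t, H t = 0 := by
    rw [← hHn, intervalIntegral.integral_eq_integral_of_support_subset]
    exact support_indicator_subset
  have h1 := h φ hφtest
  have hsq : ∀ᵐ t, inner ℝ (G t) (deriv φ t) = ‖H t‖ ^ 2 + inner ℝ m (H t) := by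
    filter_upwards [hφd] with t ht
    rw [ht, ← real_inner_self_eq_norm_sq, ← inner_add_left]
    by_cases ht : t ∈ Ioc (-n) n
    · rw [hH, indicator_of_mem ht, sub_add_cancel]
    · rw [hH, indicator_of_notMem ht, inner_zero_right, inner_zero_right]
  have hsqi : Integrable fun t => ‖H t‖ ^ 2 := by
    refine IsTest.integrable_of_bound (n := n) (hHm.norm.pow 2) (fun t ht => ?_)
      (locallyIntegrable_const ((|C| + ‖m‖) ^ 2)) fun t _ => ?_
    · rw [hH, indicator_of_notMem fun h' => ht (Ioc_subset_Icc_self h'), norm_zero]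
      simp
    · rw [Real.norm_of_nonneg (by positivity)]
      exact pow_le_pow_left₀ (norm_nonneg _) (hHb t) 2
  rw [integral_congr_ae hsq, integral_add hsqi (hHint.const_inner m), integral_inner hHint, hHtot,
    inner_zero_right, add_zero, integral_eq_zero_iff_of_nonneg (fun t => by positivity) hsqi] at h1
  refine ⟨m, ?_⟩
  filter_upwards [h1] with t ht htm
  have h2 : H t = 0 := by simpa using ht
  rw [hH, indicator_of_mem (Ioo_subset_Ioc_self htm), sub_eq_zero] at h2
  exact h2

/-! ### First variations on the line -/

section Variation

variable {n A : ℝ} {U φ : ℝ → Plane} {K : NNReal}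

theorem IsTest.add_eventuallyEq (h : IsTest n φ) (U : ℝ → Plane) {t : ℝ} (ht : t ∉ Icc (-n) n) :
    U + φ =ᶠ[𝓝 t] U := by
  filter_upwards [isClosed_Icc.isOpen_compl.mem_nhds ht] with y hy
  rw [Pi.add_apply, h.zero' hy, add_zero]

theorem inner_symp (v w : Plane) : inner ℝ (symp v) w = v 1 * w 0 - v 0 * w 1 := by
  simp [PiLp.inner_apply, Fin.sum_univ_two, symp]
  ring

theorem IsTest.integrable_mul_deriv {f : ℝ → ℝ} (h : IsTest n φ) (hf : Continuous f) (i : Fin 2) :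
    Integrable fun t => f t * deriv φ t i := by
  obtain ⟨B, hB, hb⟩ := h.exists_bound
  refine IsTest.integrable_of_bound (n := n) (g := fun t => |f t| * B)
    (hf.aestronglyMeasurable.mul (aesm_deriv_coord φ i))
    (fun t ht => by rw [h.deriv_zero ht, PiLp.zero_apply, mul_zero])
    (hf.abs.mul continuous_const).locallyIntegrable fun t _ => ?_
  rw [norm_mul]
  exact mul_le_mul_of_nonneg_left ((abs_coord_le _ _).trans (hb t).2) (abs_nonneg _)

theorem IsTest.integrable_mul_deriv' (h : IsTest n φ) (hU : LipschitzWith K U) (i j : Fin 2) :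
    Integrable fun t => φ t i * deriv U t j := by
  obtain ⟨L, hL⟩ := h.lipschitz
  have hc := continuous_coord hL.continuous i
  refine IsTest.integrable_of_bound (n := n) (g := fun t => |φ t i| * K)
    (hc.aestronglyMeasurable.mul (aesm_deriv_coord U j))
    (fun t ht => by rw [h.zero' ht, PiLp.zero_apply, zero_mul])
    (hc.abs.mul continuous_const).locallyIntegrable fun t _ => ?_
  rw [norm_mul]
  exact mul_le_mul_of_nonneg_left (lip_coord_deriv_le hU j t) (abs_nonneg _)

/-- This puts all derivatives in the linear part of the area variation on the test function, so that
it pairs 𝕁U with φ', the form needed for du Bois-Reymond's lemma. -/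
theorem IsTest.integral_mul_deriv_coord (h : IsTest n φ) (hU : LipschitzWith K U) :
    ∫ t, φ t 1 * deriv U t 0 = -∫ t, U t 0 * deriv φ t 1 := by
  set P : Plane →L[ℝ] Plane :=
    (EuclideanSpace.proj (𝕜 := ℝ) (0 : Fin 2)).smulRight (EuclideanSpace.single (1 : Fin 2) (1 : ℝ))
    with hP
  have hPi : ∀ v w : Plane, inner ℝ (P v) w = v 0 * w 1 := fun v w => by
    simp [hP, PiLp.inner_apply, mul_comm]
  have h1 := h.integral_deriv_inner (F := P ∘ U) fun a b => (P.lipschitz.comp hU).ac a b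
  simp only [Function.comp_apply, hPi] at h1
  rw [← h1]
  refine integral_congr_ae ?_
  filter_upwards [hU.ae_differentiableAt_real] with t ht
  rw [(P.hasFDerivAt.comp_hasDerivAt t ht.hasDerivAt).deriv, hPi, mul_comm]

/-- The area of a perturbed curve. -/
theorem IsTest.hasLineArea_add (h : IsTest n φ) (hU : LipschitzWith K U) (hA : HasLineArea U A) :
    HasLineArea (U + φ)
      (A - ((∫ t, inner ℝ (symp (U t)) (deriv φ t)) + ∫ t, φ t 1 * deriv φ t 0)) := by
  obtain ⟨L, hL⟩ := id h.lipschitz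
  -- The two area densities differ only on a compact interval, so the improper integral changes by
  -- an ordinary one.
  set d : ℝ → ℝ := fun t => (U + φ) t 1 * deriv (U + φ) t 0 - U t 1 * deriv U t 0 with hd
  have hd0 : ∀ t, t ∉ Icc (-n) n → d t = 0 := fun t ht => by
    have := h.add_eventuallyEq U ht
    rw [hd]
    simp only
    rw [this.deriv_eq, this.eq_of_nhds, sub_self]
  have hda : ∀ᵐ t, d t = U t 1 * deriv φ t 0 + φ t 1 * deriv U t 0 + φ t 1 * deriv φ t 0 := by
    filter_upwards [hU.ae_differentiableAt_real, hL.ae_differentiableAt_real] with t h1 h2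
    rw [hd]
    simp only
    rw [deriv_add h1 h2, Pi.add_apply, PiLp.add_apply, PiLp.add_apply]
    ring
  have i1 := h.integrable_mul_deriv (continuous_coord hU.continuous 1) 0
  have i2 := h.integrable_mul_deriv' hU 1 0
  have i3 := h.integrable_mul_deriv (continuous_coord hL.continuous 1) 0
  have i4 := h.integrable_mul_deriv (continuous_coord hU.continuous 0) 1
  have i12 : Integrable fun t => U t 1 * deriv φ t 0 + φ t 1 * deriv U t 0 := i1.add i2
  have hdi : Integrable d := (i12.add i3).congr (by
    filter_upwards [hda] with t ht using ht.symm)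
  have hint : ∫ t, d t =
      (∫ t, inner ℝ (symp (U t)) (deriv φ t)) + ∫ t, φ t 1 * deriv φ t 0 := by
    rw [integral_congr_ae hda, integral_add i12 i3, integral_add i1 i2,
      h.integral_mul_deriv_coord hU]
    simp only [inner_symp]
    rw [integral_sub i1 i4]
    ring
  rw [← hint]
  refine (hA.sub_const (∫ t, d t)).congr' ?_
  filter_upwards [(eventually_lt_atBot (-n)).prod_mk (eventually_ge_atTop n)] with q hq
  have hUφ : LipschitzWith (K + L) (U + φ) := hU.add hL
  rw [IsTest.integral_eq_interval hd0 hq.1 hq.2, intervalIntegral.integral_sub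
    (lip_intervalIntegrable_area hUφ _ _) (lip_intervalIntegrable_area hU _ _)]
  ring

theorem IsTest.memH1 (h : IsTest n φ) : MemH1 φ := by
  obtain ⟨L, hL⟩ := id h.lipschitz
  obtain ⟨B, hB, hb⟩ := h.exists_bound
  refine ⟨fun a b => hL.ac a b, ?_, ?_⟩
  · refine hL.continuous.memLp_of_hasCompactSupport
      (HasCompactSupport.of_support_subset_isCompact (isCompact_Icc (a := -n) (b := n)) ?_)
    intro y hy
    by_contra h'
    exact hy (h.zero' h')
  · rw [memLp_two_iff_integrable_sq_norm (measurable_deriv_plane φ).aestronglyMeasurable]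
    refine IsTest.integrable_of_bound (n := n) ((aesm_norm_deriv φ).pow 2)
      (fun t ht => by simp [h.deriv_zero ht]) (locallyIntegrable_const (B ^ 2)) fun t _ => ?_
    rw [Real.norm_of_nonneg (by positivity)]
    exact pow_le_pow_left₀ (norm_nonneg _) (hb t).2 2

theorem IsTest.add_mem_lineClass {pm pp : Plane} {A' : ℝ} (h : IsTest n φ) (hU : LipschitzWith K U)
    (hUA : U ∈ lineClass pm pp A)
    (hA' : A' = A - ((∫ t, inner ℝ (symp (U t)) (deriv φ t)) + ∫ t, φ t 1 * deriv φ t 0)) :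
    U + φ ∈ lineClass pm pp A' := by
  obtain ⟨⟨g, hg, hgp, hgm, hac, h2, h2'⟩, hA⟩ := hUA
  obtain ⟨hac', h3, h3'⟩ := h.memH1
  obtain ⟨L, hL⟩ := h.lipschitz
  refine ⟨⟨g, hg, hgp, hgm, ?_⟩, hA' ▸ h.hasLineArea_add hU hA⟩
  rw [add_sub_right_comm]
  refine ⟨fun a b => (hac a b).add (hac' a b), h2.add h3, (h2'.add h3').ae_eq ?_⟩
  filter_upwards [hU.ae_differentiableAt_real, hL.ae_differentiableAt_real] with t h4 h5
  rw [deriv_add (h4.sub (hg.differentiable (by simp) t)) h5, Pi.add_apply]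

/-- Expansion of the energy. -/
theorem exists_energy_add_le {W : Plane → ℝ} (hW : ContDiff ℝ 2 W) (hnn : ∀ x, 0 ≤ W x)
    (hU : LipschitzWith K U)
    (hint : Integrable fun y => 1 / 2 * ‖deriv U y‖ ^ 2 + W (U y)) (n : ℝ) :
    ∃ N ≥ 0, ∀ φ κ, IsTest n φ → κ ≤ 1 → (∀ t, ‖φ t‖ ≤ κ) →
      (∀ᵐ t, ‖deriv φ t‖ ≤ κ) → ∃ X ≥ 0,
      energy W (U + φ) ≤ ENNReal.ofReal X ∧ X = (∫ y, (1 / 2 * ‖deriv U y‖ ^ 2 + W (U y))) +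
        (∫ t, inner ℝ (deriv U t) (deriv φ t)) + (∫ t, inner ℝ (gradient W (U t)) (φ t)) +
        N * κ ^ 2 := by
  obtain ⟨R, hR⟩ := (isCompact_Icc (a := -n) (b := n)).exists_bound_of_continuousOn
    hU.continuous.continuousOn
  -- The bound κ ≤ 1 keeps U + φ in the ball of radius R + 1 on `Icc (-n) n`, so one Taylor constant
  -- serves all test functions.
  obtain ⟨C, hC, hT⟩ := taylor_bound hW (R + 1)
  have hgrad : Continuous (gradient W) :=
    (InnerProductSpace.toDual ℝ Plane).symm.continuous.comp (hW.continuous_fderiv (by norm_num))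
  set V := ∫ t, indicator (Icc (-n) n) (fun _ => (1 : ℝ)) t with hV
  have hVi : Integrable (indicator (Icc (-n) n) fun _ => (1 : ℝ)) :=
    (integrable_indicator_iff measurableSet_Icc).2 (integrableOn_const (by simp))
  have hV0 : 0 ≤ V := integral_nonneg fun t => indicator_nonneg (fun _ _ => zero_le_one) _
  refine ⟨(1 / 2 + C) * V, by positivity, fun φ κ hφ hκ hb hb' => ?_⟩
  obtain ⟨L, hL⟩ := id hφ.lipschitz
  have hκ0 : 0 ≤ κ := (norm_nonneg _).trans (hb 0)
  have hderivU : LocallyIntegrable (deriv U) := fun x =>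
    ⟨Icc (x - 1) (x + 1), Icc_mem_nhds (by linarith) (by linarith), by
      have := ac_intervalIntegrable_deriv (hU.ac (x - 1) (x + 1))
      rwa [intervalIntegrable_iff_integrableOn_Icc_of_le (by linarith)] at this⟩
  have i1 := hφ.integrable_inner_deriv hderivU
  have i2 : Integrable fun t => inner ℝ (gradient W (U t)) (φ t) :=
    hφ.integrable_inner (hgrad.comp hU.continuous).locallyIntegrable
  have i3 := hVi.const_mul ((1 / 2 + C) * κ ^ 2)
  set F : ℝ → ℝ := fun t => 1 / 2 * ‖deriv U t‖ ^ 2 + W (U t) + inner ℝ (deriv U t) (deriv φ t) +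
    inner ℝ (gradient W (U t)) (φ t) +
    (1 / 2 + C) * κ ^ 2 * indicator (Icc (-n) n) (fun _ => (1 : ℝ)) t with hF
  have i01 : Integrable fun t => 1 / 2 * ‖deriv U t‖ ^ 2 + W (U t) +
      inner ℝ (deriv U t) (deriv φ t) := hint.add i1
  have i012 : Integrable fun t => 1 / 2 * ‖deriv U t‖ ^ 2 + W (U t) +
      inner ℝ (deriv U t) (deriv φ t) + inner ℝ (gradient W (U t)) (φ t) := i01.add i2
  have hFi : Integrable F := i012.add i3
  have hle : ∀ᵐ t, 1 / 2 * ‖deriv (U + φ) t‖ ^ 2 + W ((U + φ) t) ≤ F t := by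
    filter_upwards [hU.ae_differentiableAt_real, hL.ae_differentiableAt_real, hb'] with t h1 h2
      hbt
    by_cases ht : t ∈ Icc (-n) n
    · rw [hF]
      simp only
      rw [indicator_of_mem ht, deriv_add h1 h2, norm_add_sq_real, Pi.add_apply,
        inner_gradient_left]
      have hUR := hR t ht
      have h3 := (abs_le.1 (hT (U t) (by rw [mem_closedBall_zero_iff]; linarith) (U t + φ t) (by
        rw [mem_closedBall_zero_iff]
        exact (norm_add_le _ _).trans (add_le_add hUR ((hb t).trans hκ))))).2
      rw [add_sub_cancel_left] at h3
      have h4 : ‖φ t‖ ^ 2 ≤ κ ^ 2 := pow_le_pow_left₀ (norm_nonneg _) (hb t) 2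
      have h5 : ‖deriv φ t‖ ^ 2 ≤ κ ^ 2 := pow_le_pow_left₀ (norm_nonneg _) hbt 2
      nlinarith
    · have := hφ.add_eventuallyEq U ht
      rw [hF]
      simp only
      rw [indicator_of_notMem ht, this.deriv_eq, this.eq_of_nhds, hφ.zero' ht, hφ.deriv_zero ht]
      simp
  have hF0 : 0 ≤ᵐ[volume] F := by
    filter_upwards [hle] with t ht
    exact (add_nonneg (by positivity) (hnn _)).trans ht
  refine ⟨∫ t, F t, integral_nonneg_of_ae hF0, ?_, ?_⟩
  · rw [ofReal_integral_eq_lintegral_ofReal hFi hF0]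
    refine lintegral_mono_ae ?_
    filter_upwards [hle] with t ht using ENNReal.ofReal_le_ofReal ht
  · rw [integral_add i012 i3, integral_add i01 i2,
      integral_add hint i1, integral_const_mul]
    ring

end Variation

/-! ### The Euler–Lagrange equation -/

/-- For small s of sign opposite to x the linear term would win and make the expression negative. -/
theorem eq_zero_of_forall_small {x D s₀ : ℝ} (hs₀ : 0 < s₀) (hD : 0 ≤ D)
    (h : ∀ s, |s| ≤ s₀ → 0 ≤ s * x + D * s ^ 2) : x = 0 := by
  by_contra hx
  have hx' : 0 < |x| := abs_pos.2 hx
  set t := min (s₀ / |x|) (1 / (D + 1)) with ht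
  have ht0 : 0 < t := by positivity
  have h1 := h (-(t * x)) (by
    rw [abs_neg, abs_mul, abs_of_pos ht0, ← le_div_iff₀ hx']
    exact min_le_left _ _)
  have h2 : t * (D + 1) ≤ 1 := (le_div_iff₀ (by positivity)).1 (min_le_right _ _)
  have h3 : 0 < t * x ^ 2 := by positivity
  have h4 : (1 - D * t) * (t * x ^ 2) ≤ 0 := by nlinarith
  have h5 : 0 < 1 - D * t := by nlinarith
  exact absurd h4 (not_le.2 (mul_pos h5 h3))

/-- The symplectic matrix as a continuous linear map. -/
def sympL : Plane →L[ℝ] Plane :=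
  LinearMap.toContinuousLinearMap
    { toFun := symp
      map_add' := fun v w => by
        ext i
        fin_cases i <;> simp [symp]
        ring
      map_smul' := fun c v => by
        ext i
        fin_cases i <;> simp [symp] }

theorem symp_injective : Function.Injective symp := fun v w h => by
  have h0 := congrArg (fun x : Plane => x 0) h
  have h1 := congrArg (fun x : Plane => x 1) h
  ext i
  fin_cases i
  · simpa [symp] using h1
  · simpa [symp] using h0

section EulerLagrange

variable {n A : ℝ} {U : ℝ → Plane} {K : NNReal} {W : Plane → ℝ} {pm pp : Plane}

theorem IsTest.integral_area_add_smul {φ ψ : ℝ → Plane} (h : IsTest n φ) (h' : IsTest n ψ) :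
    ∃ a b c : ℝ, ∀ s τ : ℝ, ∫ t, (s • φ + τ • ψ) t 1 * deriv (s • φ + τ • ψ) t 0 =
      s ^ 2 * a + s * τ * b + τ ^ 2 * c := by
  obtain ⟨K, hK⟩ := h.lipschitz
  obtain ⟨L, hL⟩ := h'.lipschitz
  have i1 := h.integrable_mul_deriv (continuous_coord hK.continuous 1) 0
  have i2 := h'.integrable_mul_deriv (continuous_coord hK.continuous 1) 0
  have i3 := h.integrable_mul_deriv (continuous_coord hL.continuous 1) 0
  have i4 := h'.integrable_mul_deriv (continuous_coord hL.continuous 1) 0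
  have i23 : Integrable fun t => φ t 1 * deriv ψ t 0 + ψ t 1 * deriv φ t 0 := i2.add i3
  refine ⟨∫ t, φ t 1 * deriv φ t 0, ∫ t, (φ t 1 * deriv ψ t 0 + ψ t 1 * deriv φ t 0),
    ∫ t, ψ t 1 * deriv ψ t 0, fun s τ => ?_⟩
  have j12 : Integrable fun t => s ^ 2 * (φ t 1 * deriv φ t 0) +
      s * τ * (φ t 1 * deriv ψ t 0 + ψ t 1 * deriv φ t 0) :=
    (i1.const_mul (s ^ 2)).add (i23.const_mul (s * τ))
  rw [← integral_const_mul, ← integral_const_mul, ← integral_const_mul,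
    ← integral_add (i1.const_mul (s ^ 2)) (i23.const_mul (s * τ)),
    ← integral_add j12 (i4.const_mul (τ ^ 2))]
  refine integral_congr_ae ?_
  filter_upwards [h.ae_deriv_add_smul h' s τ] with t ht
  rw [ht]
  simp only [Pi.add_apply, Pi.smul_apply, PiLp.add_apply, PiLp.smul_apply, smul_eq_mul]
  ring

/-- The first variation of the energy vanishes where that of the area does. -/
theorem first_variation_eq_zero (hW : DoubleWell W pm pp) (hU : LipschitzWith K U)
    (hUA : U ∈ lineClass pm pp A) (hfin : energy W U ≠ ⊤)
    (hmin : ∀ u ∈ lineClass pm pp A, energy W U ≤ energy W u) {Z : ℝ → Plane}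
    (hZ : ∀ t, HasDerivAt Z (gradient W (U t)) t) (hZac : ∀ a b, AbsolutelyContinuousOnInterval Z a b)
    {φ ψ : ℝ → Plane} (hφ : IsTest n φ) (hψ : IsTest n ψ)
    (hφ0 : ∫ t, inner ℝ (symp (U t)) (deriv φ t) = 0)
    (hψ1 : ∫ t, inner ℝ (symp (U t)) (deriv ψ t) = 1) :
    ∫ t, inner ℝ (deriv U t - Z t) (deriv φ t) = 0 := by
  have hZc : Continuous Z := continuous_iff_continuousAt.2 fun t => (hZ t).continuousAt
  have hderivU : LocallyIntegrable (deriv U) := fun x =>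
    ⟨Icc (x - 1) (x + 1), Icc_mem_nhds (by linarith) (by linarith), by
      have := ac_intervalIntegrable_deriv (hU.ac (x - 1) (x + 1))
      rwa [intervalIntegrable_iff_integrableOn_Icc_of_le (by linarith)] at this⟩
  have hG : LocallyIntegrable fun t => deriv U t - Z t := hderivU.sub hZc.locallyIntegrable
  have hS : LocallyIntegrable fun t => symp (U t) :=
    (sympL.continuous.comp hU.continuous).locallyIntegrable
  have hc : Continuous fun y => W (U y) := hW.continuous.comp hU.continuous
  have hnn : ∀ y, 0 ≤ 1 / 2 * ‖deriv U y‖ ^ 2 + W (U y) := fun y =>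
    add_nonneg (by positivity) (hW.nonneg _)
  have hint : Integrable fun y => 1 / 2 * ‖deriv U y‖ ^ 2 + W (U y) := by
    refine ⟨(((aesm_norm_deriv U).pow 2).const_mul _).add hc.aestronglyMeasurable, ?_⟩
    rw [hasFiniteIntegral_iff_ofReal (Eventually.of_forall hnn)]
    exact lt_top_iff_ne_top.2 hfin
  have hen : energy W U = ENNReal.ofReal (∫ y, (1 / 2 * ‖deriv U y‖ ^ 2 + W (U y))) :=
    (ofReal_integral_eq_lintegral_ofReal hint (Eventually.of_forall hnn)).symm
  obtain ⟨N, hN, hexp⟩ := exists_energy_add_le hW.contDiff hW.nonneg hU hint n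
  -- Z is a primitive of ∇W(U). Integrating the potential term by parts brings the whole first
  -- variation into a form involving only χ'.
  set L₁ : (ℝ → Plane) → ℝ := fun χ => ∫ t, inner ℝ (deriv U t - Z t) (deriv χ t) with hL₁
  have hvar : ∀ χ, IsTest n χ → (∫ t, inner ℝ (deriv U t) (deriv χ t)) +
      (∫ t, inner ℝ (gradient W (U t)) (χ t)) = L₁ χ := fun χ hχ => by
    have h1 := hχ.integral_deriv_inner hZac
    simp only [fun t => (hZ t).deriv] at h1
    rw [h1, hL₁]
    simp only [inner_sub_left]
    rw [integral_sub (hχ.integrable_inner_deriv hderivU)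
      (hχ.integrable_inner_deriv hZc.locallyIntegrable)]
    ring
  have hstep : ∀ χ κ, IsTest n χ → κ ≤ 1 → (∀ t, ‖χ t‖ ≤ κ) →
      (∀ᵐ t, ‖deriv χ t‖ ≤ κ) → (∫ t, inner ℝ (symp (U t)) (deriv χ t)) + ∫ t, χ t 1 * deriv χ t 0 = 0 →
      0 ≤ L₁ χ + N * κ ^ 2 := fun χ κ hχ hκ hb hb' h0 => by
    obtain ⟨X, hX0, hX, hXeq⟩ := hexp χ κ hχ hκ hb hb'
    have h1 := (hmin _ (hχ.add_mem_lineClass hU hUA (by rw [h0, sub_zero]))).trans hX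
    rw [hen, ENNReal.ofReal_le_ofReal_iff hX0, hXeq] at h1
    have := hvar χ hχ
    linarith
  obtain ⟨a, b, c, habc⟩ := hφ.integral_area_add_smul hψ
  obtain ⟨B₁, hB₁, hb₁⟩ := hφ.exists_bound
  obtain ⟨B₂, hB₂, hb₂⟩ := hψ.exists_bound
  set M := 1 + |a| + |b| + |c| with hM
  have hM1 : 1 ≤ M := by
    have := abs_nonneg a
    have := abs_nonneg b
    have := abs_nonneg c
    linarith
  set B := B₁ + B₂ with hB
  have hBpos : 0 < B := add_pos hB₁ hB₂
  set s₀ := min (1 / (2 * M)) (1 / B) with hs₀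
  have hs₀pos : 0 < s₀ := by positivity
  refine eq_zero_of_forall_small (D := 2 * M * |L₁ ψ| + N * B ^ 2) hs₀pos (by positivity)
    fun s hs => ?_
  have hsM : |s| * (2 * M) ≤ 1 := (le_div_iff₀ (by positivity)).1 (hs.trans (min_le_left _ _))
  have hsB : |s| * B ≤ 1 := (le_div_iff₀ hBpos).1 (hs.trans (min_le_right _ _))
  have hs0 := abs_nonneg s
  have hs1 : |s| ≤ 1 := by nlinarith
  have hss : 2 * M * s ^ 2 ≤ |s| := by
    rw [← sq_abs]
    nlinarith
  have hrange : ∀ τ ∈ Icc (-(2 * M * s ^ 2)) (2 * M * s ^ 2), |τ| ≤ |s| ∧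
      |s ^ 2 * a + s * τ * b + τ ^ 2 * c| ≤ 2 * M * s ^ 2 := by
    intro τ hτ
    have h1 : |τ| ≤ |s| := (abs_le.2 hτ).trans hss
    have h2 : |s * τ| ≤ s ^ 2 := by
      rw [abs_mul, ← sq_abs s, sq]
      gcongr
    have h3 : τ ^ 2 ≤ s ^ 2 := sq_le_sq.2 h1
    refine ⟨h1, ?_⟩
    calc |s ^ 2 * a + s * τ * b + τ ^ 2 * c|
        ≤ |s ^ 2 * a| + |s * τ * b| + |τ ^ 2 * c| := abs_add_three _ _ _
      _ = s ^ 2 * |a| + |s * τ| * |b| + τ ^ 2 * |c| := by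
        rw [abs_mul, abs_mul (s * τ), abs_mul (τ ^ 2), abs_of_nonneg (sq_nonneg s),
          abs_of_nonneg (sq_nonneg τ)]
      _ ≤ s ^ 2 * |a| + s ^ 2 * |b| + s ^ 2 * |c| := by gcongr
      _ ≤ 2 * M * s ^ 2 := by nlinarith [sq_nonneg s]
  have hle : -(2 * M * s ^ 2) ≤ 2 * M * s ^ 2 := neg_le_self (by positivity)
  -- The direction ψ repairs the constraint: since φ leaves the area unchanged to first order, sφ +
  -- τψ has zero area variation for some τ of order s². The contribution of τ to the energy is
  -- therefore of second order in s.
  obtain ⟨τ, hτ, hroot⟩ := intermediate_value_Icc hle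
    (f := fun τ => τ + (s ^ 2 * a + s * τ * b + τ ^ 2 * c))
    (by fun_prop) (show (0 : ℝ) ∈ Icc _ _ from
      ⟨by have := (abs_le.1 (hrange _ (left_mem_Icc.2 hle)).2).2; linarith,
        by have := (abs_le.1 (hrange _ (right_mem_Icc.2 hle)).2).1; linarith⟩)
  obtain ⟨hτs, -⟩ := hrange τ hτ
  have hχ := hφ.add_smul hψ s τ
  have hLχ : L₁ (s • φ + τ • ψ) = s * L₁ φ + τ * L₁ ψ :=
    hφ.integral_inner_add_smul hψ hG s τ
  have hcomb : ∀ v w : Plane, ‖v‖ ≤ B₁ → ‖w‖ ≤ B₂ → ‖s • v + τ • w‖ ≤ |s| * B :=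
    fun v w hv hw => by
      calc ‖s • v + τ • w‖ ≤ |s| * ‖v‖ + |τ| * ‖w‖ :=
            (norm_add_le _ _).trans_eq (by rw [norm_smul, norm_smul, Real.norm_eq_abs,
              Real.norm_eq_abs])
        _ ≤ |s| * B₁ + |s| * B₂ := by gcongr
        _ = |s| * B := by rw [hB]; ring
  have hfinal := hstep (s • φ + τ • ψ) (|s| * B) hχ hsB
    (fun t => hcomb _ _ (hb₁ t).1 (hb₂ t).1) (by
      filter_upwards [hφ.ae_deriv_add_smul hψ s τ] with t ht
      rw [ht]
      exact hcomb _ _ (hb₁ t).2 (hb₂ t).2) (by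
      rw [hφ.integral_inner_add_smul hψ hS, hφ0, hψ1, habc, mul_zero, zero_add, mul_one]
      exact hroot)
  rw [hLχ, mul_pow, sq_abs] at hfinal
  have hτL : τ * L₁ ψ ≤ 2 * M * s ^ 2 * |L₁ ψ| := by
    refine (le_abs_self _).trans ?_
    rw [abs_mul]
    exact mul_le_mul_of_nonneg_right (abs_le.2 hτ) (abs_nonneg _)
  change 0 ≤ s * L₁ φ + _
  linarith

/-- A non-constant Lipschitz curve admits test functions changing the area at unit rate. -/
theorem exists_area_variation (hU : LipschitzWith K U) (hne : pm ≠ pp)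
    (hm : Tendsto U atBot (𝓝 pm)) (hp : Tendsto U atTop (𝓝 pp)) :
    ∃ n > 0, ∃ ψ, IsTest n ψ ∧ ∫ t, inner ℝ (symp (U t)) (deriv ψ t) = 1 := by
  have hSc : Continuous fun t => symp (U t) := sympL.continuous.comp hU.continuous
  -- By scaling, every test function would pair to zero. Du Bois-Reymond's lemma would make 𝕁U
  -- constant on every interval, contradicting the distinct limits.
  by_contra! hcon
  have hzero : ∀ n > 0, ∀ ψ, IsTest n ψ → ∫ t, inner ℝ (symp (U t)) (deriv ψ t) = 0 := by
    intro n hn ψ hψ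
    by_contra h0
    refine hcon n hn _ (hψ.add_smul hψ (∫ t, inner ℝ (symp (U t)) (deriv ψ t))⁻¹ 0) ?_
    rw [hψ.integral_inner_add_smul hψ hSc.locallyIntegrable, inv_mul_cancel₀ h0, zero_mul, add_zero]
  have hconst : ∀ t, U t = U 0 := by
    intro t
    have hn : 0 < |t| + 1 := by positivity
    obtain ⟨C, hC⟩ := (isCompact_Icc (a := -(|t| + 1)) (b := |t| + 1)).exists_bound_of_continuousOn
      hSc.continuousOn
    obtain ⟨m, hm⟩ := exists_ae_eq_const_of_integral_inner_deriv hn hSc.locallyIntegrable hC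
      (hzero _ hn)
    have heq : EqOn (fun t => symp (U t)) (fun _ => m) (Ioo (-(|t| + 1)) (|t| + 1)) :=
      Measure.eqOn_open_of_ae_eq ((ae_restrict_iff' measurableSet_Ioo).2 hm) isOpen_Ioo
        hSc.continuousOn continuousOn_const
    have h1 := heq (show t ∈ Ioo _ _ from
      ⟨by linarith [neg_abs_le t], by linarith [le_abs_self t]⟩)
    have h2 := heq (show (0 : ℝ) ∈ Ioo _ _ from ⟨by linarith, hn⟩)
    exact symp_injective (h1.trans h2.symm)
  have hUc : U = fun _ => U 0 := funext hconst
  rw [hUc] at hm hp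
  exact hne ((tendsto_nhds_unique tendsto_const_nhds hm).symm.trans
    (tendsto_nhds_unique tendsto_const_nhds hp))

/-- Minimizers of the energy under the area constraint solve the Euler–Lagrange equation. -/
theorem exists_isTravelingWave (hW : DoubleWell W pm pp) (hU : LipschitzWith K U)
    (hUA : U ∈ lineClass pm pp A) (hfin : energy W U ≠ ⊤)
    (hmin : ∀ u ∈ lineClass pm pp A, energy W U ≤ energy W u)
    (hm : Tendsto U atBot (𝓝 pm)) (hp : Tendsto U atTop (𝓝 pp)) :
    ∃ ν, IsTravelingWave W pm pp ν U := by
  have hgrad : Continuous fun t => gradient W (U t) :=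
    ((InnerProductSpace.toDual ℝ Plane).symm.continuous.comp
      (hW.contDiff.continuous_fderiv (by norm_num))).comp hU.continuous
  set Z : ℝ → Plane := fun t => ∫ τ in (0 : ℝ)..t, gradient W (U τ) with hZdef
  have hZ : ∀ t, HasDerivAt Z (gradient W (U t)) t := fun t =>
    intervalIntegral.integral_hasDerivAt_right (hgrad.intervalIntegrable 0 t)
      (hgrad.stronglyMeasurableAtFilter _ _) hgrad.continuousAt
  have hZc : Continuous Z := continuous_iff_continuousAt.2 fun t => (hZ t).continuousAt
  have hZ1 : ContDiff ℝ 1 Z := contDiff_one_iff_deriv.2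
    ⟨fun t => (hZ t).differentiableAt, by simpa only [funext fun t => (hZ t).deriv] using hgrad⟩
  have hZac : ∀ a b, AbsolutelyContinuousOnInterval Z a b := fun a b => by
    obtain ⟨L, hL⟩ := hZ1.locallyLipschitz.locallyLipschitzOn
      (s := uIcc a b) |>.exists_lipschitzOnWith_of_compact isCompact_uIcc
    exact hL.absolutelyContinuousOnInterval
  have hSc : Continuous fun t => symp (U t) := sympL.continuous.comp hU.continuous
  have hderivU : LocallyIntegrable (deriv U) := fun x =>
    ⟨Icc (x - 1) (x + 1), Icc_mem_nhds (by linarith) (by linarith), by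
      have := ac_intervalIntegrable_deriv (hU.ac (x - 1) (x + 1))
      rwa [intervalIntegrable_iff_integrableOn_Icc_of_le (by linarith)] at this⟩
  have hG₁ : LocallyIntegrable fun t => deriv U t - Z t := hderivU.sub hZc.locallyIntegrable
  obtain ⟨n₀, hn₀, ψ, hψ, hψ1⟩ := exists_area_variation hU hW.ne hm hp
  -- The Lagrange multiplier: any φ becomes admissible after subtracting the multiple of ψ with the
  -- same first order area, so the first variation is c times that of the area pairing. The speed
  -- will be ν = -c.
  set c := ∫ t, inner ℝ (deriv U t - Z t) (deriv ψ t) with hc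
  set R : ℝ → Plane := fun t => Z t + c • symp (U t) with hR
  have hRc : Continuous R := hZc.add (hSc.const_smul c)
  have hGR : LocallyIntegrable fun t => deriv U t - R t := hderivU.sub hRc.locallyIntegrable
  have hweak : ∀ n, n₀ ≤ n → ∀ φ, IsTest n φ → ∫ t, inner ℝ (deriv U t - R t) (deriv φ t) = 0 := by
    intro n hn φ hφ
    have hψn := hψ.mono hn
    set b := ∫ t, inner ℝ (symp (U t)) (deriv φ t) with hb
    have h1 := first_variation_eq_zero hW hU hUA hfin hmin hZ hZac (hφ.add_smul hψn 1 (-b)) hψn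
      (by rw [hφ.integral_inner_add_smul hψn hSc.locallyIntegrable, hψ1, ← hb]; ring) hψ1
    rw [hφ.integral_inner_add_smul hψn hG₁, ← hc, one_mul] at h1
    have h2 : ∀ t, inner ℝ (deriv U t - R t) (deriv φ t) =
        inner ℝ (deriv U t - Z t) (deriv φ t) - c * inner ℝ (symp (U t)) (deriv φ t) := fun t => by
      rw [hR, ← sub_sub, inner_sub_left, real_inner_smul_left]
    simp only [h2]
    rw [integral_sub (hφ.integrable_inner_deriv hG₁)
      ((hφ.integrable_inner_deriv hSc.locallyIntegrable).const_mul c), integral_const_mul, ← hb]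
    linarith
  have hlocal : ∀ n, n₀ ≤ n → ∃ m, ∀ t ∈ Ioo (-n) n, HasDerivAt U (R t + m) t := by
    intro n hn
    have hnpos := hn₀.trans_le hn
    obtain ⟨C, hC⟩ := (isCompact_Icc (a := -n) (b := n)).exists_bound_of_continuousOn
      hRc.continuousOn
    obtain ⟨m, hm⟩ := exists_ae_eq_const_of_integral_inner_deriv hnpos hGR (C := K + C)
      (fun t ht => (norm_sub_le _ _).trans (add_le_add (lip_norm_deriv_le hU t) (hC t ht)))
      (hweak n hn)
    refine ⟨m, fun t ht => ?_⟩
    have hRm : Continuous fun t => R t + m := hRc.add continuous_const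
    have hprim : HasDerivAt (fun t => U 0 + ∫ τ in (0 : ℝ)..t, (R τ + m)) (R t + m) t :=
      (intervalIntegral.integral_hasDerivAt_right (hRm.intervalIntegrable 0 t)
        (hRm.stronglyMeasurableAtFilter _ _) hRm.continuousAt).const_add _
    refine hprim.congr_of_eventuallyEq ?_
    filter_upwards [Ioo_mem_nhds ht.1 ht.2] with s hs
    have h1 : ∫ τ in (0 : ℝ)..s, deriv U τ = ∫ τ in (0 : ℝ)..s, (R τ + m) := by
      refine intervalIntegral.integral_congr_ae ?_
      filter_upwards [hm] with τ hτ hτs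
      have hmem : τ ∈ Ioo (-n) n := ordConnected_Ioo.uIcc_subset
        (show (0 : ℝ) ∈ Ioo (-n) n from ⟨by linarith, hnpos⟩) hs (uIoc_subset_uIcc hτs)
      rw [← hτ hmem]
      abel
    rw [← h1, ac_integral_deriv (hU.ac 0 s)]
    abel
  -- The integration constant found on each interval is determined by its value at 0, so it does not
  -- depend on the interval.
  set m := deriv U 0 - R 0 with hmdef
  have hUd : ∀ t, HasDerivAt U (R t + m) t := by
    intro t
    have hle : n₀ ≤ n₀ + |t| := by linarith [abs_nonneg t]
    obtain ⟨m', hm'⟩ := hlocal (n₀ + |t|) hle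
    have h0 := hm' 0 ⟨by linarith, by linarith⟩
    have : m' = m := by rw [hmdef, h0.deriv, add_sub_cancel_left]
    rw [← this]
    exact hm' t ⟨by linarith [neg_abs_le t], by linarith [le_abs_self t]⟩
  have hU' : deriv U = fun t => R t + m := funext fun t => (hUd t).deriv
  -- Bootstrapping: U' = R + m, and R = Z + c 𝕁U is differentiable because U is.
  have hU'' : ∀ t, HasDerivAt (deriv U) (gradient W (U t) + c • symp (deriv U t)) t := fun t => by
    have h1 : HasDerivAt (fun t => symp (U t)) (symp (deriv U t)) t := by
      have := sympL.hasFDerivAt.comp_hasDerivAt t (hUd t)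
      rw [(hUd t).deriv]
      exact this
    have h2 := ((hZ t).add (h1.const_smul c)).add_const m
    rw [hU'] at h2 ⊢
    exact h2
  have hU'c : Continuous (deriv U) := by
    rw [hU']
    exact hRc.add continuous_const
  refine ⟨-c, ?_, fun t => ?_, hm, hp⟩
  · rw [show (2 : WithTop ℕ∞) = 1 + 1 by norm_num, contDiff_succ_iff_deriv]
    refine ⟨fun t => (hUd t).differentiableAt, by simp, contDiff_one_iff_deriv.2
      ⟨fun t => (hU'' t).differentiableAt, ?_⟩⟩
    rw [funext fun t => (hU'' t).deriv]
    exact hgrad.add ((sympL.continuous.comp hU'c).const_smul c)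
  · rw [(hU'' t).deriv, neg_neg, add_sub_cancel_left]

end EulerLagrange

end Isoperimetric

end

/-! ### Assembly of the theorem -/

theorem theorem4p2 (W : Isoperimetric.Plane → ℝ) (pm pp : Isoperimetric.Plane)
    (hW : Isoperimetric.DoubleWell W pm pp)
    (γ₀ : ℝ → Isoperimetric.Plane) (hγ₀ : γ₀ ∈ Isoperimetric.curves pm pp)
    (hγ₀_min : IsMinOn (Isoperimetric.degLength W) (Isoperimetric.curves pm pp) γ₀) :
    ∃ ε₀ > 0, ∀ ε : ℝ, 0 < |ε| → |ε| < ε₀ → ∀ A : ℝ, A = Isoperimetric.area γ₀ + ε →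
      -- a minimizer, parametrized with constant speed, exists
      (∃ γ ∈ Isoperimetric.areaCurves pm pp A,
        IsMinOn (Isoperimetric.degLength W) (Isoperimetric.areaCurves pm pp A) γ ∧
          Isoperimetric.ConstantSpeed γ) ∧
      -- and every such minimizer has the following properties
      ∀ γ ∈ Isoperimetric.areaCurves pm pp A,
        IsMinOn (Isoperimetric.degLength W) (Isoperimetric.areaCurves pm pp A) γ →
        Isoperimetric.ConstantSpeed γ →
        -- there are no bubbles
        (∀ t ∈ Ioo (0 : ℝ) 1, γ t ≠ pm ∧ γ t ≠ pp) ∧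
        -- the reparametrization is well defined on the whole line
        BijOn (Isoperimetric.newParam W γ) (Ioo 0 1) univ ∧
        (∀ᵐ y : ℝ, ‖deriv (Isoperimetric.reparam W γ) y‖ =
          √2 * √(W (Isoperimetric.reparam W γ y))) ∧
        -- (i)
        (Isoperimetric.reparam W γ ∈ Isoperimetric.lineClass pm pp A ∧
          Isoperimetric.energy W (Isoperimetric.reparam W γ) ≠ ⊤ ∧
          Isoperimetric.energy W (Isoperimetric.reparam W γ) =
            ⨅ u ∈ Isoperimetric.lineClass pm pp A, Isoperimetric.energy W u) ∧
        -- (ii)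
        ((∀ u ∈ Isoperimetric.heteroclinics W pm pp, ¬ Isoperimetric.HasLineArea u A) →
          ∃ ν : ℝ, ν ≠ 0 ∧
            Isoperimetric.IsTravelingWave W pm pp ν (Isoperimetric.reparam W γ)) := by
  obtain ⟨ε₀, hε₀, h⟩ := hW.exists_threshold hγ₀ hγ₀_min
  refine ⟨ε₀, hε₀, fun ε _ hε A hA => ?_⟩
  obtain ⟨hex, hall⟩ := h A (by rwa [hA, add_sub_cancel_left])
  refine ⟨hex, fun γ hγ hm hs => ?_⟩
  obtain ⟨hno, k, hk, δ, hδ, hstab⟩ := hall γ hγ hm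
  obtain ⟨hbij, η, K, T, L, hL, hη, heq, hrep, hsp, hT⟩ := Isoperimetric.exists_reparam hW hγ.1 hs (hno hs)
  have hη0 : η 0 = pm := by rw [← heq (by simp), hγ.1.2.1]
  have hη1 : η 1 = pp := by rw [← heq (by simp), hγ.1.2.2]
  have hηA : Isoperimetric.area η = A := by rw [← Isoperimetric.area_congr heq, hγ.2]
  have hmem : η ∘ T ∈ Isoperimetric.lineClass pm pp A := hηA ▸ hT.mem_lineClass hW hη hη0 hη1 hL hsp
  have hen := hT.energy_eq hW hη hL hsp
  have hfin : Isoperimetric.energy W (η ∘ T) ≠ ⊤ := by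
    rw [hen]
    exact ENNReal.ofReal_ne_top
  have hle : ∀ u ∈ Isoperimetric.lineClass pm pp A, Isoperimetric.energy W (η ∘ T) ≤ Isoperimetric.energy W u := fun u hu => by
    rw [hen, ← Isoperimetric.degLength_congr W heq]
    exact hW.le_energy hk hδ hstab hu
  rw [hrep]
  refine ⟨hno hs, hbij, hT.ae_norm_deriv hη hL hsp,
    ⟨hmem, hfin, le_antisymm (le_iInf₂ hle) (iInf₂_le _ hmem)⟩, fun hhet => ?_⟩
  obtain ⟨K', hK'⟩ := hT.exists_lipschitz
  obtain ⟨ν, hν⟩ := Isoperimetric.exists_isTravelingWave hW (hη.comp hK') hmem hfin hle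
    (hη0 ▸ (hη.continuous.tendsto 0).comp hT.tendsto_atBot)
    (hη1 ▸ (hη.continuous.tendsto 1).comp hT.tendsto_atTop)
  refine ⟨ν, ?_, hν⟩
  -- With ν = 0 the curve would be a heteroclinic connection with area A.
  rintro rfl
  exact hhet _ hν hmem.2
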